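/- For $f:\mathbb N\to\mathbb N$ and $g:\mathbb N\to\mathbb R$ let $NDTIME(f(n),g(n))$ be the class of languages $L\subseteq\{0,1\}^*$ for which there is a deterministic multi-tape Turing machine that receives, besides the input $x$ of length $n$, a string $w$ of $f(n)$ bits (supplied by a non-deterministic oracle) on a separate tape, halts in $O(g(n))$ steps for all such $x$ and $w$, and satisfies: $x\in L$ if and only if the machine accepts $(x,w)$ for some $w\in\{0,1\}^{f(n)}$. Let $DTIME(g(n))=NDTIME(0,g(n))$. In the two conjectures below, an algorithm is a program of a random access machine (with the arithmetic operations $+,-,\times$ and integer division) and time is its logarithmic cost; inputs are given as finite sequences of integers. Low-dimension Orthogonal Vectors conjecture: for every function $d=d(N)$ with $d=\omega(\log N)$ and every $\delta>0$, there is no $O(N^{2-\delta})$-time algorithm which, given two collections $A,B$ of $N$ vectors each in $\{0,1\}^{d}$, decides whether there are $a\in A$ and $b\in B$ that are orthogonal in $\mathbb Z^{d}$. Strong Exponential Time Hypothesis (SETH): for every $\varepsilon>0$ there is a $k$ such that no $O(2^{(1-\varepsilon)\ell})$-time algorithm decides the satisfiability of $k$-CNF formulas (at most $k$ literals per clause)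 with $\ell$ variables and distinct clauses. **Theorem.** Suppose that the low-dimension Orthogonal Vectors conjecture holds, or that SETH holds. Then for every $\epsilon>0$, $$NDTIME(\lceil \log_2 n\rceil,\ n)\nsubseteq DTIME(n^{2-\epsilon}).$$ -/

import Mathlib

open Filter Asymptotics

/-! ## Multi-tape Turing machines with a non-deterministic oracle -/

/-- A multi-tape Turing machine. The tape alphabet is `Option Sym`, where `none` is the blank;
the bits `0`, `1` are two distinguished non-blank symbols. There are `work + 2` two-way infinite
read-write tapes: tape `0` initially holds the input, tape `1` holds the bits supplied by the
non-deterministic oracle, and the remaining tapes are initially blank. In one step the machine reads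
the scanned symbols and either halts (`none`), or enters a new state, overwrites each scanned symbol
and moves each head by at most one cell (`none` means that the head stays). A halting computation
is accepting or rejecting according to the state in which it halts. -/
structure MultiTapeTM where
  State : Type
  Sym : Type
  finiteState : Finite State
  finiteSym : Finite Sym
  bit : Bool ↪ Sym
  work : ℕ
  start : State
  accepting : State → Bool
  trans : State → (Fin (work + 2) → Option Sym) →
    Option (State × (Fin (work + 2) → Option Sym × Option Turing.Dir))

namespace MultiTapeTM

/-- Configurations: the current state and the tapes with their head positions. -/
structure Cfg (M : MultiTapeTM) where
  state : M.State
  tape : Fin (M.work + 2) → Turing.Tape (Option M.Sym)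

/-- Overwrite the scanned symbol, then move the head. -/
def act {Γ : Type} [Inhabited Γ] (T : Turing.Tape Γ) (a : Γ × Option Turing.Dir) :
    Turing.Tape Γ :=
  match a.2 with
  | none => T.write a.1
  | some D => (T.write a.1).move D

/-- One step of the machine; `none` if the machine has halted. -/
def step (M : MultiTapeTM) (c : M.Cfg) : Option M.Cfg :=
  (M.trans c.state fun i => (c.tape i).head).map fun r =>
    { state := r.1, tape := fun i => act (c.tape i) (r.2 i) }

/-- The tape containing a string of bits, with the head on the first bit. -/
def bitTape (M : MultiTapeTM) (x : List Bool) : Turing.Tape (Option M.Sym) :=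
  Turing.Tape.mk₁ (x.map fun b => some (M.bit b))

/-- The initial configuration on input `x` with oracle bits `w`. -/
def init (M : MultiTapeTM) (x w : List Bool) : M.Cfg where
  state := M.start
  tape := fun i =>
    if i.val = 0 then M.bitTape x else if i.val = 1 then M.bitTape w else M.bitTape []

/-- The configuration after `t` steps (a halted machine stays where it is). -/
def run (M : MultiTapeTM) (x w : List Bool) (t : ℕ) : M.Cfg :=
  (fun c => (M.step c).getD c)^[t] (M.init x w)

/-- On input `x` with oracle bits `w`, the machine halts after at most `t` steps. -/
def HaltsWithin (M : MultiTapeTM) (x w : List Bool) (t : ℕ) : Prop :=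
  M.step (M.run x w t) = none

/-- On input `x` with oracle bits `w`, the machine halts in an accepting state. -/
def Accepts (M : MultiTapeTM) (x w : List Bool) : Prop :=
  ∃ t, M.HaltsWithin x w t ∧ M.accepting (M.run x w t).state = true

end MultiTapeTM

/-- `NDTIME f g`: the problems (languages of bit strings) that are solved in time `O(g(n))` by a
multi-tape Turing machine using an `f(n)`-bit non-deterministic oracle, `n` being the length of
the input: an input is a yes-instance iff some string of `f(n)` oracle bits leads to acceptance. -/
def NDTIME (f : ℕ → ℕ) (g : ℕ → ℝ) : Set (Language Bool) :=
  {L | ∃ (M : MultiTapeTM) (T : ℕ → ℕ),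
    ((fun n => (T n : ℝ)) =O[atTop] g) ∧
    (∀ x w : List Bool, w.length = f x.length → M.HaltsWithin x w (T x.length)) ∧
    (∀ x : List Bool, x ∈ L ↔ ∃ w : List Bool, w.length = f x.length ∧ M.Accepts x w)}

/-- `DTIME g = NDTIME 0 g`. -/
def DTIME (g : ℕ → ℝ) : Set (Language Bool) :=
  NDTIME (fun _ => 0) g

/-! ## Random access machines under the logarithmic cost criterion -/

namespace RAM

/-- Operands `=i`, `i` and `*i`: a literal, the content of a register, indirect addressing. -/
inductive Operand where
  | lit (i : ℤ)
  | reg (i : ℕ)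
  | ind (i : ℕ)

/-- The instructions of a random access machine. The arithmetic instructions operate on the
accumulator (register `0`); the jumps go to the instruction with the given position, `jgtz` if the
accumulator is positive, `jzero` if it is zero. -/
inductive Instr where
  | load (a : Operand)
  | store (a : Operand)
  | add (a : Operand)
  | sub (a : Operand)
  | mult (a : Operand)
  | div (a : Operand)
  | read (a : Operand)
  | write (a : Operand)
  | jump (l : ℕ)
  | jgtz (l : ℕ)
  | jzero (l : ℕ)
  | halt

/-- A program is a finite sequence of instructions, at positions `0, 1, 2, …`. -/
abbrev Program := List Instr

/-- Configurations: the location counter (`none` once a halt instruction has been executed), the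
contents of the registers, the part of the input not yet read, the output written so far, and the
logarithmic cost accumulated so far. -/
structure Cfg where
  pc : Option ℕ
  mem : ℕ → ℤ
  input : List ℤ
  output : List ℤ
  cost : ℕ

/-- The logarithmic size of an integer: `⌊log₂ |i|⌋ + 1` if `i ≠ 0`, and `1` if `i = 0`. -/
def len (i : ℤ) : ℕ := Nat.log 2 i.natAbs + 1

/-- The register designated by an operand; undefined for literals and for indirect addressing
through a negative number. -/
def Operand.addr (m : ℕ → ℤ) : Operand → Option ℕ
  | lit _ => none
  | reg i => some i
  | ind i => if 0 ≤ m i then some (m i).toNat else none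

/-- The logarithmic cost of finding the register designated by an operand. -/
def Operand.addrCost (m : ℕ → ℤ) : Operand → ℕ
  | lit _ => 0
  | reg i => len i
  | ind i => len i + len (m i)

/-- The value of an operand. -/
def Operand.val (m : ℕ → ℤ) : Operand → Option ℤ
  | lit i => some i
  | reg i => some (m i)
  | ind i => ((ind i).addr m).map m

/-- The logarithmic cost of an operand with value `v`. -/
def Operand.cost (m : ℕ → ℤ) (a : Operand) (v : ℤ) : ℕ := a.addrCost m + len v

/-- Spend `k` units, set register `r` to `v`, and continue with the instruction at position `p`. -/
def Cfg.put (c : Cfg) (p k r : ℕ) (v : ℤ) : Cfg :=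
  { c with pc := some p, mem := Function.update c.mem r v, cost := c.cost + k }

/-- Spend `k` units and continue with the instruction at position `p`. -/
def Cfg.goto (c : Cfg) (p k : ℕ) : Cfg :=
  { c with pc := some p, cost := c.cost + k }

/-- Execution of one instruction, located at position `p`; `none` if it is not executable. Reading
beyond the end of the input gives `0`. -/
def exec (c : Cfg) (p : ℕ) : Instr → Option Cfg
  | .load a => (a.val c.mem).map fun v => c.put (p + 1) (a.cost c.mem v) 0 v
  | .store a => (a.addr c.mem).map fun r =>
      c.put (p + 1) (len (c.mem 0) + a.addrCost c.mem) r (c.mem 0)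
  | .add a => (a.val c.mem).map fun v =>
      c.put (p + 1) (len (c.mem 0) + a.cost c.mem v) 0 (c.mem 0 + v)
  | .sub a => (a.val c.mem).map fun v =>
      c.put (p + 1) (len (c.mem 0) + a.cost c.mem v) 0 (c.mem 0 - v)
  | .mult a => (a.val c.mem).map fun v =>
      c.put (p + 1) (len (c.mem 0) + a.cost c.mem v) 0 (c.mem 0 * v)
  | .div a => (a.val c.mem).bind fun v => if v = 0 then none else
      some (c.put (p + 1) (len (c.mem 0) + a.cost c.mem v) 0 ((c.mem 0).fdiv v))
  | .read a => (a.addr c.mem).map fun r =>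
      { c.put (p + 1) (len (c.input.headD 0) + a.addrCost c.mem) r (c.input.headD 0) with
        input := c.input.tail }
  | .write a => (a.val c.mem).map fun v =>
      { c.goto (p + 1) (a.cost c.mem v) with output := c.output ++ [v] }
  | .jump l => some (c.goto l 1)
  | .jgtz l => some (c.goto (if 0 < c.mem 0 then l else p + 1) (len (c.mem 0)))
  | .jzero l => some (c.goto (if c.mem 0 = 0 then l else p + 1) (len (c.mem 0)))
  | .halt => some { c with pc := none, cost := c.cost + 1 }

/-- One step of the program; `none` if it has stopped, by a halt instruction or because there is no
executable instruction at the current position. -/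
def step (P : Program) (c : Cfg) : Option Cfg :=
  c.pc.bind fun p => P[p]?.bind fun I => exec c p I

/-- The initial configuration: all registers contain `0`. -/
def init (x : List ℤ) : Cfg where
  pc := some 0
  mem := fun _ => 0
  input := x
  output := []
  cost := 0

/-- The configuration after `t` steps (a stopped program stays where it is). -/
def run (P : Program) (x : List ℤ) (t : ℕ) : Cfg :=
  (fun c => (step P c).getD c)^[t] (init x)

/-- On input `x`, the program stops with output `y` at a total logarithmic cost of at most `k`. -/
def ComputesWithin (P : Program) (x y : List ℤ) (k : ℕ) : Prop :=
  ∃ t, step P (run P x t) = none ∧ (run P x t).output = y ∧ (run P x t).cost ≤ k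

end RAM

/-- A decision problem whose instances have a size parameter (in which running times are measured)
and an encoding as a finite sequence of integers. -/
structure DecisionProblem where
  Instance : Type
  param : Instance → ℕ
  encode : Instance → List ℤ
  Yes : Instance → Prop

open Classical in
/-- The problem admits an `O(g)`-time algorithm: some random access machine program, on every
instance, outputs `1` or `0` according to whether it is a yes-instance, at a logarithmic cost which
is `O(g)` as a function of the parameter. -/
def DecisionProblem.SolvableInTime (Q : DecisionProblem) (g : ℕ → ℝ) : Prop :=
  ∃ (P : RAM.Program) (T : ℕ → ℕ),
    ((fun n => (T n : ℝ)) =O[atTop] g) ∧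
    ∀ x : Q.Instance,
      RAM.ComputesWithin P (Q.encode x) [if Q.Yes x then 1 else 0] (T (Q.param x))

/-! ## Orthogonal Vectors -/

/-- The integer `0` or `1` represented by a bit. -/
def bitVal (b : Bool) : ℤ := if b then 1 else 0

/-- Two collections `A`, `B` of `N` vectors each in `{0,1}^d`. -/
structure OVInstance (d : ℕ → ℕ) where
  N : ℕ
  A : Fin N → Fin (d N) → Bool
  B : Fin N → Fin (d N) → Bool

/-- The entries of a sequence of vectors, vector by vector. -/
def entries {N d : ℕ} (A : Fin N → Fin d → Bool) : List ℤ :=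
  (List.ofFn fun i => List.ofFn fun t => bitVal (A i t)).flatten

/-- The Orthogonal Vectors problem in dimension `d = d(N)`: given `A` and `B`, is there a pair of
vectors `a ∈ A`, `b ∈ B` with inner product `0` in `ℤ^d`? -/
def OV (d : ℕ → ℕ) : DecisionProblem where
  Instance := OVInstance d
  param x := x.N
  encode x := [(x.N : ℤ), (d x.N : ℤ)] ++ entries x.A ++ entries x.B
  Yes x := ∃ i j, ∑ t, bitVal (x.A i t) * bitVal (x.B j t) = 0

/-- The low-dimension Orthogonal Vectors conjecture: when `d = ω(log N)`, `OV(d)` admits no truly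
sub-`N²`-time algorithm, i.e. no `O(N^{2-δ})`-time algorithm for any `δ > 0`. -/
def LowDimensionOVConjecture : Prop :=
  ∀ d : ℕ → ℕ, ((fun N : ℕ => Real.log N) =o[atTop] fun N : ℕ => (d N : ℝ)) →
    ∀ δ : ℝ, 0 < δ → ¬ (OV d).SolvableInTime fun N => (N : ℝ) ^ (2 - δ)

/-! ## Satisfiability and the Strong Exponential Time Hypothesis -/

/-- A `k`-CNF formula in `ℓ` variables with distinct clauses. A literal is a variable together with
its sign (`true` for a positive literal); a clause has at most `k` literals. -/
structure KCNF (k ℓ : ℕ) where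
  clauses : List (List (Fin ℓ × Bool))
  width : ∀ C ∈ clauses, C.length ≤ k
  nodup : ∀ C ∈ clauses, C.Nodup
  distinct : (clauses.map List.toFinset).Nodup

/-- Some assignment satisfies at least one literal of every clause. -/
def KCNF.Satisfiable {k ℓ : ℕ} (φ : KCNF k ℓ) : Prop :=
  ∃ a : Fin ℓ → Bool, ∀ C ∈ φ.clauses, ∃ p ∈ C, a p.1 = p.2

/-- The `i`-th variable (counted from `1`) is written as `i`, its negation as `-i`. -/
def encodeLiteral {ℓ : ℕ} (p : Fin ℓ × Bool) : ℤ :=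
  if p.2 then (p.1.val : ℤ) + 1 else -((p.1.val : ℤ) + 1)

/-- The satisfiability problem for `k`-CNF formulas, parametrized by the number `ℓ` of variables. An
instance is encoded by `ℓ`, the number of clauses, and the clauses, each terminated by `0`. -/
def kSAT (k : ℕ) : DecisionProblem where
  Instance := Σ ℓ : ℕ, KCNF k ℓ
  param x := x.1
  encode x := [(x.1 : ℤ), (x.2.clauses.length : ℤ)] ++
    x.2.clauses.flatMap fun C => C.map encodeLiteral ++ [0]
  Yes x := x.2.Satisfiable

/-- The Strong Exponential Time Hypothesis: for every `ε > 0` there is a `k` such that `k`-SAT with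
`ℓ` variables admits no `O(2^{(1-ε)ℓ})`-time algorithm. -/
def SETH : Prop :=
  ∀ ε : ℝ, 0 < ε → ∃ k : ℕ, ¬ (kSAT k).SolvableInTime fun ℓ => (2 : ℝ) ^ ((1 - ε) * (ℓ : ℝ))

/-! A single language separates the two classes. `TapeCode.interp` is a two-tape machine that reads
its input once from left to right as a sequence of operations, in unary code, on the oracle tape:
moving the head, testing or writing a bit, closing a clause, a block or a formula. It spends one
step per input bit, so `TapeCode.lang` lies in nondeterministic linear time with any number of
oracle bits. If it were decidable in time $n^{2-\epsilon}$, a random access machine could turn an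
instance of either hard problem into operations, simulate the decider, and be too fast.

Orthogonal vectors: the oracle bits name an index $i$. The operations for $A$ compare every label
with these bits and copy the vector behind the matching label to the oracle tape. The operations for
$B$ then test orthogonality with each of its vectors. This takes $O(Nd)$ operations
(`ovOps_mem_lang`), and the input has length at least $N$, so $\lceil\log_2 n\rceil$ bits suffice
for an index. In dimension $d=(\lfloor\log_2 N\rfloor+1)^2=\omega(\log N)$ the length is $N$ up to
logarithmic factors.

Satisfiability: the $\ell$ variables are split in half. The input contains one copy of the formula
for each of the $2^{\lceil \ell/2\rceil}$ values of the first half, and the oracle bits are the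
values of the second half (`satOps_mem_lang`). Distinctness bounds the number of clauses by a
polynomial in $\ell$, so the length is $2^{\ell/2}$ up to polynomial factors, and its power
$2-\epsilon$ is below $2^{(1-\epsilon')\ell}$.

What remains is to keep the overhead on the random access machine below every power. Programs are
written in a small structured language whose values grow by at most one per tick, doubling excepted
(`Exec.bdd`). `Exec.sim` compiles them at a logarithmic cost per tick. `wp_simCode` simulates a
fixed Turing machine with constantly many ticks per step, `gwp_ovGen` and `gwp_satGen` write the
operations, and `solvableInTime_of_generator` adds up the times. -/

/-! ## A structured language for random access machines -/

namespace LoopProg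

/-- Elementary commands on variables and two-way infinite arrays. -/
inductive Atom where
  | lit (x : ℕ) (c : ℤ)
  | copy (x y : ℕ)
  | inc (x : ℕ)
  | dec (x : ℕ)
  | neg (x : ℕ)
  | double (x : ℕ)
  | half (x : ℕ)
  | parity (x y : ℕ)
  | read (x : ℕ)
  | get (x a y : ℕ)
  | put (a y x : ℕ)
  | putLit (a y : ℕ) (c : ℤ)

/-- Structured programs. The test of `ite` is `x = 0` or `0 < x`, according to the flag. -/
inductive Cmd where
  | skip
  | atom (a : Atom)
  | seq (c d : Cmd)
  | ite (zero : Bool) (x : ℕ) (c d : Cmd)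
  | while (x : ℕ) (c : Cmd)

/-- States: variables, arrays, number of inputs read, number of ticks spent. -/
@[ext] structure St where
  vars : ℕ → ℤ
  arr : ℕ → ℤ → ℤ
  rd : ℕ
  clk : ℕ

/-- Assign `v` to the variable `x`. -/
def St.set (s : St) (x : ℕ) (v : ℤ) : St :=
  { s with vars := Function.update s.vars x v, clk := s.clk + 1 }

/-- Assign `v` to the entry `p` of the array `a`. -/
def St.setArr (s : St) (a : ℕ) (p v : ℤ) : St :=
  { s with arr := Function.update s.arr a (Function.update (s.arr a) p v), clk := s.clk + 1 }

/-- Spend one tick. -/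
def St.tick (s : St) : St := { s with clk := s.clk + 1 }

def Atom.eval (X : List ℤ) (s : St) : Atom → St
  | lit x c => s.set x c
  | copy x y => s.set x (s.vars y)
  | inc x => s.set x (s.vars x + 1)
  | dec x => s.set x (s.vars x - 1)
  | neg x => s.set x (-s.vars x)
  | double x => s.set x (2 * s.vars x)
  | half x => s.set x (s.vars x / 2)
  | parity x y => s.set x (s.vars y % 2)
  | read x => { s.set x (X.getD s.rd 0) with rd := s.rd + 1 }
  | get x a y => s.set x (s.arr a (s.vars y))
  | put a y x => s.setArr a (s.vars y) (s.vars x)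
  | putLit a y c => s.setArr a (s.vars y) c

/-- The only elementary command that may violate the size bound is doubling. -/
def Atom.Ok (B : ℕ) (s : St) : Atom → Prop
  | double x => |2 * s.vars x| ≤ B
  | _ => True

/-- Big-step semantics. -/
inductive Exec (X : List ℤ) (B : ℕ) : Cmd → St → St → Prop
  | skip (s) : Exec X B .skip s s
  | atom (a s) : a.Ok B s → Exec X B (.atom a) s (a.eval X s)
  | seq {c d s t u} : Exec X B c s t → Exec X B d t u → Exec X B (.seq c d) s u
  | ite_true {z x c d s t} : (if z then s.vars x = 0 else 0 < s.vars x) →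
      Exec X B c s.tick t → Exec X B (.ite z x c d) s t
  | ite_false {z x c d s t} : ¬ (if z then s.vars x = 0 else 0 < s.vars x) →
      Exec X B d s.tick t → Exec X B (.ite z x c d) s t
  | while_done {x c s} : ¬ 0 < s.vars x → Exec X B (.while x c) s s.tick
  | while_step {x c s t u} : 0 < s.vars x → Exec X B c s.tick t →
      Exec X B (.while x c) t u → Exec X B (.while x c) s u

/-! ### Growth of the clock and of the values -/

theorem Atom.clk_eval (X : List ℤ) (s : St) (a : Atom) : (a.eval X s).clk = s.clk + 1 := by
  cases a <;> rfl

theorem Exec.clk_le {X : List ℤ} {B : ℕ} {c : Cmd} {s t : St} (h : Exec X B c s t) :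
    s.clk ≤ t.clk := by
  induction h with
  | skip => exact le_rfl
  | atom a s _ => rw [Atom.clk_eval]; omega
  | seq _ _ h1 h2 => exact h1.trans h2
  | ite_true _ _ h => exact (Nat.le_succ _).trans h
  | ite_false _ _ h => exact (Nat.le_succ _).trans h
  | while_done => exact Nat.le_succ _
  | while_step _ _ _ h1 h2 => exact (Nat.le_succ _).trans (h1.trans h2)

/-- All values are bounded by `B` plus the number of ticks. -/
def St.Bdd (B : ℕ) (s : St) : Prop :=
  (∀ x, |s.vars x| ≤ B + s.clk) ∧ ∀ a p, |s.arr a p| ≤ B + s.clk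

theorem St.Bdd.tick {B : ℕ} {s : St} (h : s.Bdd B) : s.tick.Bdd B := by
  refine ⟨fun x => (h.1 x).trans ?_, fun a p => (h.2 a p).trans ?_⟩ <;> simp [St.tick]

/-- The assignment itself takes a tick, which raises the bound by one; hence the new value may
exceed the old bound by one. -/
theorem St.Bdd.set {B : ℕ} {s : St} (h : s.Bdd B) (x : ℕ) {v : ℤ} (hv : |v| ≤ B + s.clk + 1) :
    (s.set x v).Bdd B := by
  refine ⟨fun y => ?_, fun a p => (h.2 a p).trans (by simp [St.set])⟩
  by_cases hy : y = x
  · subst hy; simp [St.set]; linarith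
  · have := h.1 y
    simp [St.set, hy]; linarith

theorem St.Bdd.setArr {B : ℕ} {s : St} (h : s.Bdd B) (a : ℕ) (p : ℤ) {v : ℤ}
    (hv : |v| ≤ B + s.clk + 1) : (s.setArr a p v).Bdd B := by
  refine ⟨fun x => (h.1 x).trans (by simp [St.setArr]), fun b q => ?_⟩
  have := h.2 b q
  by_cases hb : b = a
  · subst hb
    by_cases hq : q = p
    · subst hq; simp [St.setArr]; linarith
    · simp [St.setArr, hq]; linarith
  · simp [St.setArr, hb]; linarith

/-- A bound for the constants that occur in an elementary command. -/
def Atom.size : Atom → ℕ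
  | lit x c => x + c.natAbs
  | copy x y => x + y
  | inc x => x
  | dec x => x
  | neg x => x
  | double x => x
  | half x => x
  | parity x y => x + y
  | read x => x
  | get x a y => x + 2 ^ a + y
  | put a y x => x + 2 ^ a + y
  | putLit a y c => c.natAbs + 2 ^ a + y

/-- A bound for the constants that occur in a program. -/
def Cmd.size : Cmd → ℕ
  | skip => 0
  | atom a => a.size
  | seq c d => c.size + d.size
  | ite _ x c d => x + c.size + d.size
  | .while x c => x + c.size

/-- Except for doubling, which `Atom.Ok` guards, a command exceeds the values present by at most
one. Constants are covered by `Atom.size` and inputs by `hX`. -/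
theorem Atom.bdd_eval {X : List ℤ} {B : ℕ} (hX : ∀ v ∈ X, |v| ≤ B) {s : St} (h : s.Bdd B) (a : Atom)
    (ha : a.size ≤ B) (hok : a.Ok B s) : (a.eval X s).Bdd B := by
  have hc : (0 : ℤ) ≤ s.clk := Int.natCast_nonneg _
  have hB : (0 : ℤ) ≤ B := Int.natCast_nonneg _
  cases a with
  | lit x c => exact h.set x (by simp only [Atom.size] at ha; rw [Int.abs_eq_natAbs]; omega)
  | copy x y => exact h.set x (by have := h.1 y; linarith)
  | inc x => exact h.set x (by have := h.1 x; rw [abs_le] at *; constructor <;> linarith)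
  | dec x => exact h.set x (by have := h.1 x; rw [abs_le] at *; constructor <;> linarith)
  | neg x => exact h.set x (by have := h.1 x; rw [abs_neg]; linarith)
  | double x => exact h.set x (by simp only [Atom.Ok] at hok; linarith)
  | half x => exact h.set x (by have := h.1 x; rw [abs_le] at *; omega)
  | parity x y => exact h.set x (by rw [abs_le]; omega)
  | read x =>
    have hv : |X.getD s.rd 0| ≤ B + s.clk + 1 := by
      by_cases hl : s.rd < X.length
      · rw [List.getD_eq_getElem _ _ hl]
        have := hX _ (List.getElem_mem hl)
        linarith
      · rw [List.getD_eq_default _ _ (not_lt.1 hl)]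
        simp; positivity
    exact h.set x hv
  | get x a y => exact h.set x (by have := h.2 a (s.vars y); linarith)
  | put a y x => exact h.setArr a _ (by have := h.1 x; linarith)
  | putLit a y c => exact h.setArr a _ (by
    have := Nat.two_pow_pos a
    simp only [Atom.size] at ha; rw [Int.abs_eq_natAbs]; omega)

/-- This is the point of the language: values stay at most linear in the time, so one logarithm
bounds the cost of every operand. -/
theorem Exec.bdd {X : List ℤ} {B : ℕ} (hX : ∀ v ∈ X, |v| ≤ B) {c : Cmd} {s t : St}
    (h : Exec X B c s t) (hc : c.size ≤ B) (hs : s.Bdd B) : t.Bdd B := by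
  induction h with
  | skip => exact hs
  | atom a s hok => exact a.bdd_eval hX hs hc hok
  | seq _ _ h1 h2 =>
    simp only [Cmd.size] at hc
    exact h2 (by omega) (h1 (by omega) hs)
  | ite_true _ _ h => simp only [Cmd.size] at hc; exact h (by omega) hs.tick
  | ite_false _ _ h => simp only [Cmd.size] at hc; exact h (by omega) hs.tick
  | while_done => exact hs.tick
  | while_step _ _ _ h1 h2 =>
    have hc' := hc
    simp only [Cmd.size] at hc'
    exact h2 hc (h1 (by omega) hs.tick)

/-! ### Compilation -/

open RAM (Instr Operand)

/-- The register of a variable. -/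
def reg (x : ℕ) : ℕ := 2 * x + 2

/-- The address of an array entry, as an integer. -/
def addrInt (a : ℕ) (p : ℤ) : ℤ := (p + p + 1) * p * (4 * 2 ^ a) + (2 * 2 ^ a + 1)

/-- The register of an array entry. -/
def addr (a : ℕ) (p : ℤ) : ℕ := (addrInt a p).toNat

/-- The factors $2p+1$ and $p$ never have opposite signs for an integer $p$. Array entries therefore
avoid the accumulator and the scratch register `1`. -/
theorem addrInt_pos (a : ℕ) (p : ℤ) : 2 < addrInt a p := by
  have h : 0 ≤ (p + p + 1) * p := by
    rcases le_or_gt 0 p with h | h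
    · positivity
    · exact mul_nonneg_of_nonpos_of_nonpos (by omega) (by omega)
  have h2 : (0 : ℤ) < 2 ^ a := by positivity
  unfold addrInt
  nlinarith [mul_nonneg h h2.le]

theorem addr_cast (a : ℕ) (p : ℤ) : (addr a p : ℤ) = addrInt a p :=
  Int.toNat_of_nonneg (by have := addrInt_pos a p; omega)

/-- Array entries have odd addresses, variables have even ones. -/
theorem addr_ne_reg (a : ℕ) (p : ℤ) (x : ℕ) : addr a p ≠ reg x := by
  intro h
  have h1 := addr_cast a p
  rw [h, addrInt, reg] at h1
  push_cast at h1
  have h2 : (2 * (x : ℤ) + 2) = 2 * ((p + p + 1) * p * (2 * 2 ^ a) + 2 ^ a) + 1 := by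
    rw [h1]; ring
  omega

theorem two_lt_addr (a : ℕ) (p : ℤ) : 2 < addr a p := by
  have h1 := addr_cast a p
  have := addrInt_pos a p
  omega

/-- Subtracting $1$ and halving gives $2^a(2(2p+1)p+1)$, a power of two times an odd number, so $a$
is determined. The difference of $(2p+1)p$ and $(2q+1)q$ is $(p-q)(2(p+q)+1)$, whose second factor
is odd and hence not zero. -/
theorem addr_injective {a b : ℕ} {p q : ℤ} (h : addr a p = addr b q) : a = b ∧ p = q := by
  have h1 : addrInt a p = addrInt b q := by rw [← addr_cast, ← addr_cast, h]
  have key : ∀ (a b : ℕ) (p q : ℤ), a ≤ b → addrInt a p = addrInt b q → a = b ∧ p = q := by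
    intro a b p q hab h1
    obtain ⟨k, rfl⟩ := Nat.exists_eq_add_of_le hab
    have h2 : 2 * ((p + p + 1) * p) + 1 = (2 * ((q + q + 1) * q) + 1) * 2 ^ k := by
      have h3 : (2 * 2 ^ a : ℤ) ≠ 0 := by positivity
      apply mul_left_cancel₀ h3
      unfold addrInt at h1
      rw [pow_add] at h1
      linear_combination h1
    rcases k with _ | k
    · refine ⟨by simp, ?_⟩
      have h4 : (p - q) * (2 * (p + q) + 1) = 0 := by
        simp only [pow_zero, mul_one] at h2
        nlinarith [h2]
      rcases mul_eq_zero.1 h4 with h5 | h5 <;> omega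
    · exfalso
      rw [pow_succ] at h2
      have : (2 * ((q + q + 1) * q) + 1) * (2 ^ k * 2) = 2 * ((2 * ((q + q + 1) * q) + 1) * 2 ^ k) := by
        ring
      omega
  rcases le_total a b with hab | hab
  · exact key a b p q hab h1
  · obtain ⟨h2, h3⟩ := key b a q p hab h1.symm
    exact ⟨h2.symm, h3.symm⟩

/-- Store the address of entry `y` of the array `a` in register `1`. -/
def addrCode (a y : ℕ) : List Instr :=
  [.load (.reg (reg y)), .add (.reg (reg y)), .add (.lit 1), .mult (.reg (reg y)),
    .mult (.lit (4 * 2 ^ a)), .add (.lit (2 * 2 ^ a + 1)), .store (.reg 1)]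

/-- Register `0` is the accumulator and register `1` is scratch space, for an address or for the
half of a number; neither represents a part of the state. -/
def Atom.code : Atom → List Instr
  | lit x c => [.load (.lit c), .store (.reg (reg x))]
  | copy x y => [.load (.reg (reg y)), .store (.reg (reg x))]
  | inc x => [.load (.reg (reg x)), .add (.lit 1), .store (.reg (reg x))]
  | dec x => [.load (.reg (reg x)), .sub (.lit 1), .store (.reg (reg x))]
  | neg x => [.load (.lit 0), .sub (.reg (reg x)), .store (.reg (reg x))]
  | double x => [.load (.reg (reg x)), .add (.reg (reg x)), .store (.reg (reg x))]
  | half x => [.load (.reg (reg x)), .div (.lit 2), .store (.reg (reg x))]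
  | parity x y => [.load (.reg (reg y)), .div (.lit 2), .store (.reg 1), .load (.reg (reg y)),
      .sub (.reg 1), .sub (.reg 1), .store (.reg (reg x))]
  | read x => [.read (.reg (reg x))]
  | get x a y => addrCode a y ++ [.load (.ind 1), .store (.reg (reg x))]
  | put a y x => addrCode a y ++ [.load (.reg (reg x)), .store (.ind 1)]
  | putLit a y c => addrCode a y ++ [.load (.lit c), .store (.ind 1)]

/-- The number of instructions of the compiled program. -/
def Cmd.length : Cmd → ℕ
  | skip => 0
  | atom a => a.code.length
  | seq c d => c.length + d.length
  | ite _ _ c d => 3 + d.length + c.length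
  | .while _ c => 4 + c.length

/-- The compiled program, to be placed at position `p`. -/
def Cmd.code : Cmd → ℕ → List Instr
  | skip, _ => []
  | atom a, _ => a.code
  | seq c d, p => c.code p ++ d.code (p + c.length)
  | ite z x c d, p =>
      [.load (.reg (reg x)), (if z then .jzero (p + 3 + d.length) else .jgtz (p + 3 + d.length))] ++
        d.code (p + 2) ++ [.jump (p + 3 + d.length + c.length)] ++ c.code (p + 3 + d.length)
  | .while x c, p =>
      [.load (.reg (reg x)), .jgtz (p + 3), .jump (p + 4 + c.length)] ++ c.code (p + 3) ++ [.jump p]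

theorem Cmd.length_code : ∀ (c : Cmd) (p : ℕ), (c.code p).length = c.length
  | .skip, _ => rfl
  | .atom _, _ => rfl
  | .seq c d, p => by simp [Cmd.code, Cmd.length, c.length_code, d.length_code]
  | .ite z x c d, p => by simp [Cmd.code, Cmd.length, c.length_code, d.length_code]; omega
  | .while x c, p => by simp [Cmd.code, Cmd.length, c.length_code]; omega

/-- The code `l` stands in the program `P` at position `p`. -/
def CodeAt (P : RAM.Program) (p : ℕ) (l : List Instr) : Prop :=
  ∀ i I, l[i]? = some I → P[p + i]? = some I

theorem CodeAt.left {P : RAM.Program} {p : ℕ} {l m : List Instr} (h : CodeAt P p (l ++ m)) :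
    CodeAt P p l := fun i I hi => h i I (by
  rw [List.getElem?_append_left (List.getElem?_eq_some_iff.1 hi).1]; exact hi)

theorem CodeAt.right {P : RAM.Program} {p q : ℕ} {l m : List Instr} (h : CodeAt P p (l ++ m))
    (hq : q = p + l.length) : CodeAt P q m := fun i I hi => by
  subst hq
  rw [add_assoc]
  exact h (l.length + i) I (by rw [List.getElem?_append_right (by omega)]; simpa using hi)

/-! ### Execution of compiled code -/

/-- Reachability between configurations. -/
def Reaches (P : RAM.Program) : RAM.Cfg → RAM.Cfg → Prop :=
  Relation.ReflTransGen fun c d => RAM.step P c = some d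

theorem reaches_head {P : RAM.Program} {c d e : RAM.Cfg} {p : ℕ} {I : Instr} (hp : c.pc = some p)
    (hI : P[p]? = some I) (hc : RAM.exec c p I = some d) (h : Reaches P d e) : Reaches P c e :=
  Relation.ReflTransGen.head (by simp [RAM.step, hp, hI, hc]) h

/-- Run a list of instructions one after the other. -/
def runList : List Instr → ℕ → RAM.Cfg → Option RAM.Cfg
  | [], _, c => some c
  | I :: l, p, c => (RAM.exec c p I).bind (runList l (p + 1))

/-- The instruction is not a jump. -/
def IsStraight : Instr → Prop
  | .jump _ | .jgtz _ | .jzero _ | .halt => False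
  | _ => True

theorem exec_pc {c d : RAM.Cfg} {p : ℕ} {I : Instr} (hI : IsStraight I)
    (h : RAM.exec c p I = some d) : d.pc = some (p + 1) := by
  cases I <;> simp only [IsStraight] at hI <;>
    simp only [RAM.exec, Option.map_eq_some_iff, Option.bind_eq_some_iff] at h
  case div a =>
    obtain ⟨v, -, h⟩ := h
    split_ifs at h
    cases h; rfl
  all_goals
    obtain ⟨v, -, rfl⟩ := h
    rfl

/-- Code without jumps can be evaluated by rewriting with `runList`; only the control structures
need an argument about locations. -/
theorem reaches_runList {P : RAM.Program} (l : List Instr) {p : ℕ} {c d : RAM.Cfg}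
    (hl : ∀ I ∈ l, IsStraight I) (hP : CodeAt P p l) (hp : c.pc = some p)
    (h : runList l p c = some d) : Reaches P c d ∧ d.pc = some (p + l.length) := by
  induction l generalizing p c with
  | nil => cases h; exact ⟨.refl, hp⟩
  | cons I l ih =>
    simp only [runList, Option.bind_eq_some_iff] at h
    obtain ⟨e, he, h⟩ := h
    have h1 := ih (fun J hJ => hl J (List.mem_cons_of_mem _ hJ))
      (CodeAt.right (l := [I]) hP rfl) (exec_pc (hl I List.mem_cons_self) he) h
    refine ⟨reaches_head hp (hP 0 I rfl) he h1.1, ?_⟩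
    rw [h1.2]
    simp only [List.length_cons, List.length_nil, Option.some.injEq]
    omega

/-- The configuration represents the state. -/
structure Sim (X : List ℤ) (s : St) (c : RAM.Cfg) : Prop where
  vars : ∀ x, c.mem (reg x) = s.vars x
  arr : ∀ a p, c.mem (addr a p) = s.arr a p
  input : c.input = X.drop s.rd
  output : c.output = []

theorem reg_ne (x : ℕ) : reg x ≠ 0 ∧ reg x ≠ 1 := by simp [reg]

theorem addr_ne (a : ℕ) (p : ℤ) : addr a p ≠ 0 ∧ addr a p ≠ 1 := by
  have := two_lt_addr a p; omega

theorem Sim.tick {X : List ℤ} {s : St} {c d : RAM.Cfg} (h : Sim X s c)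
    (hd : ∀ r, r ≠ 0 → r ≠ 1 → d.mem r = c.mem r)
    (hi : d.input = c.input) (ho : d.output = c.output) : Sim X s.tick d :=
  ⟨fun x => (hd _ (reg_ne x).1 (reg_ne x).2).trans (h.vars x),
    fun a p => (hd _ (addr_ne a p).1 (addr_ne a p).2).trans (h.arr a p), hi.trans h.input,
    ho.trans h.output⟩

theorem Sim.set {X : List ℤ} {s : St} {c d : RAM.Cfg} (h : Sim X s c) (x : ℕ) {u : ℤ}
    (hd : ∀ r, r ≠ 0 → r ≠ 1 → d.mem r = Function.update c.mem (reg x) u r)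
    (hi : d.input = c.input) (ho : d.output = c.output) : Sim X (s.set x u) d := by
  have h4 : ∀ x y, reg x = reg y ↔ x = y := fun x y => by simp [reg]
  refine ⟨fun y => ?_, fun a p => ?_, hi.trans h.input, ho.trans h.output⟩
  · rw [hd _ (reg_ne y).1 (reg_ne y).2]
    simp only [St.set, Function.update_apply, h4, h.vars]
  · rw [hd _ (addr_ne a p).1 (addr_ne a p).2, Function.update_of_ne (addr_ne_reg _ _ _), h.arr]; rfl

theorem Sim.setArr {X : List ℤ} {s : St} {c d : RAM.Cfg} (h : Sim X s c) (a : ℕ) (p : ℤ) {u : ℤ}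
    (hd : ∀ r, r ≠ 0 → r ≠ 1 → d.mem r = Function.update c.mem (addr a p) u r)
    (hi : d.input = c.input) (ho : d.output = c.output) : Sim X (s.setArr a p u) d := by
  refine ⟨fun y => ?_, fun b q => ?_, hi.trans h.input, ho.trans h.output⟩
  · rw [hd _ (reg_ne y).1 (reg_ne y).2, Function.update_of_ne (addr_ne_reg _ _ _).symm, h.vars]; rfl
  rw [hd _ (addr_ne b q).1 (addr_ne b q).2]
  simp only [St.setArr, Function.update_apply, h.arr]
  by_cases hb : b = a
  · subst hb
    by_cases hq : q = p
    · subst hq; simp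
    · have : addr b q ≠ addr b p := fun h => hq (addr_injective h).2
      simp [this, hq]
  · have : addr b q ≠ addr a p := fun h => hb (addr_injective h).1
    simp [this, hb]

/-! ### Logarithmic cost of a tick -/

/-- A bound for all integers that occur in computations with values bounded by `A`. -/
def bigBound (A : ℕ) : ℕ := 12 * (A + 1) ^ 3

/-- The cost of one tick. -/
def tickCost (A : ℕ) : ℕ := 40 * (Nat.log 2 (bigBound A) + 1)

theorem len_le {A : ℕ} {v : ℤ} (hv : |v| ≤ 12 * ((A : ℤ) + 1) ^ 3) :
    RAM.len v ≤ Nat.log 2 (bigBound A) + 1 := by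
  unfold RAM.len
  have : v.natAbs ≤ bigBound A := by
    unfold bigBound
    zify
    exact hv
  have := Nat.log_mono_right (b := 2) this
  omega

theorem len_le_of_le {A : ℕ} {v : ℤ} (hv : |v| ≤ 12 * ((A : ℤ) + 1)) :
    RAM.len v ≤ Nat.log 2 (bigBound A) + 1 := by
  refine len_le (hv.trans ?_)
  have : (1 : ℤ) ≤ (A + 1) ^ 2 := one_le_pow₀ (by omega)
  nlinarith [(Int.natCast_nonneg A)]

set_option linter.unusedSimpArgs false

/-- The address is quadratic in the index with a coefficient of order $A$, which explains the
exponent in `bigBound`. The intermediate results are included because they pass through the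
accumulator and are charged. -/
theorem addr_bounds {A a : ℕ} {y : ℤ} (hy : |y| ≤ A) (ha : 2 ^ a ≤ A) :
    |y + y + 1| ≤ 12 * ((A : ℤ) + 1) ∧ |(y + y + 1) * y| ≤ 12 * ((A : ℤ) + 1) ^ 3 ∧
    |(y + y + 1) * y * (4 * 2 ^ a)| ≤ 12 * ((A : ℤ) + 1) ^ 3 ∧
    |addrInt a y| ≤ 12 * ((A : ℤ) + 1) ^ 3 := by
  have h2 : (2 : ℤ) ^ a ≤ A := by exact_mod_cast ha
  have h3 : (0 : ℤ) < 2 ^ a := by positivity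
  have h1 : |y + y + 1| ≤ 2 * (A : ℤ) + 1 := by rw [abs_le] at *; constructor <;> linarith
  have hA : (0 : ℤ) ≤ A := Int.natCast_nonneg _
  have h4 : |(y + y + 1) * y| ≤ (2 * (A : ℤ) + 1) * A := by
    rw [abs_mul]; exact mul_le_mul h1 hy (abs_nonneg _) (by positivity)
  have h5 : |(y + y + 1) * y * (4 * 2 ^ a)| ≤ (2 * (A : ℤ) + 1) * A * (4 * A) := by
    rw [abs_mul]
    refine mul_le_mul h4 ?_ (abs_nonneg _) (by positivity)
    rw [abs_of_pos (by positivity)]; linarith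
  have h6 : |addrInt a y| ≤ (2 * (A : ℤ) + 1) * A * (4 * A) + (2 * A + 1) := by
    refine (abs_add_le _ _).trans (add_le_add h5 ?_)
    rw [abs_of_pos (by positivity)]; linarith
  have h7 : (0 : ℤ) ≤ A ^ 2 := by positivity
  have h8 : (0 : ℤ) ≤ A ^ 3 := by positivity
  refine ⟨by linarith, h4.trans ?_, h5.trans ?_, h6.trans ?_⟩ <;> nlinarith

theorem runList_append (l m : List Instr) (p : ℕ) (c : RAM.Cfg) :
    runList (l ++ m) p c = (runList l p c).bind (runList m (p + l.length)) := by
  induction l generalizing p c with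
  | nil => rfl
  | cons I l ih =>
    simp only [List.cons_append, runList, ih, List.length_cons, Option.bind_assoc]
    congr 1
    funext e
    rw [add_assoc, add_comm 1]

theorem abs_reg_le {A x : ℕ} (hx : x ≤ A) : |(reg x : ℤ)| ≤ 12 * ((A : ℤ) + 1) := by
  rw [abs_of_nonneg (by positivity)]
  simp only [reg]
  push_cast
  omega

/-- The effect of the computation of an address. -/
theorem runList_addrCode {A a y : ℕ} {p : ℕ} {c : RAM.Cfg} (hy : |c.mem (reg y)| ≤ A)
    (ha : 2 ^ a ≤ A) (hyA : y ≤ A) : ∃ d v, runList (addrCode a y) p c = some d ∧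
      d.mem = Function.update (Function.update c.mem 0 v) 1 (addrInt a (c.mem (reg y))) ∧
      d.input = c.input ∧ d.output = c.output ∧
      d.cost ≤ c.cost + 20 * (Nat.log 2 (bigBound A) + 1) := by
  obtain ⟨b1, b2, b3, b4⟩ := addr_bounds (a := a) hy ha
  have h3 : reg y ≠ 0 := by simp [reg]
  have e0 : RAM.len (c.mem (reg y)) ≤ _ := len_le_of_le (A := A) (by linarith [Int.natCast_nonneg A])
  have e1 : RAM.len (c.mem (reg y) + c.mem (reg y)) ≤ _ := len_le_of_le (A := A) (by
    rw [abs_le] at *; constructor <;> linarith)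
  have e2 := len_le_of_le b1
  have e3 := len_le b2
  have e4 := len_le b3
  have e5 := len_le b4
  have e6 := len_le_of_le (abs_reg_le hyA)
  have e7 : RAM.len 1 ≤ _ := len_le_of_le (A := A) (v := 1) (by simp; omega)
  have h2 : (2 : ℤ) ^ a ≤ A := by exact_mod_cast ha
  have h4 : (0 : ℤ) < 2 ^ a := by positivity
  have e8 : RAM.len (4 * 2 ^ a) ≤ _ := len_le_of_le (A := A) (by
    rw [abs_of_pos (by positivity)]; linarith)
  have e9 : RAM.len (2 * 2 ^ a + 1) ≤ _ := len_le_of_le (A := A) (by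
    rw [abs_of_pos (by positivity)]; linarith)
  simp only [addrInt] at e5 ⊢
  simp only [addrCode, runList, RAM.exec, Operand.val, Operand.addr,
    Operand.cost, Operand.addrCost, RAM.Cfg.put, Option.map_some, Option.bind_some, Function.update_self,
    Function.update_of_ne h3, Function.update_idem]
  refine ⟨_, _, rfl, rfl, rfl, rfl, ?_⟩
  simp only [Nat.cast_one]
  omega

/-- Every command compiles to at most nine instructions, each charged for a few integers below
`bigBound`; the factor `40` in `tickCost` is generous. -/
theorem Atom.sim {X : List ℤ} {A : ℕ} {s : St} {c : RAM.Cfg} (a : Atom) (p : ℕ) (h : Sim X s c)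
    (hv : ∀ x, |s.vars x| ≤ A) (harr : ∀ a p, |s.arr a p| ≤ A) (hX : ∀ v ∈ X, |v| ≤ A)
    (ha : a.size ≤ A) : ∃ d, runList a.code p c = some d ∧ Sim X (a.eval X s) d ∧
      d.cost ≤ c.cost + tickCost A := by
  have hA : (0 : ℤ) ≤ A := Int.natCast_nonneg A
  have lv : ∀ x, RAM.len (s.vars x) ≤ Nat.log 2 (bigBound A) + 1 := fun x =>
    len_le_of_le (by linarith [hv x])
  have la : ∀ a p, RAM.len (s.arr a p) ≤ Nat.log 2 (bigBound A) + 1 := fun a p =>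
    len_le_of_le (by linarith [harr a p])
  have lr : ∀ x, x ≤ A → RAM.len (reg x) ≤ Nat.log 2 (bigBound A) + 1 := fun x hx =>
    len_le_of_le (abs_reg_le hx)
  have l0 : RAM.len 0 ≤ Nat.log 2 (bigBound A) + 1 := len_le_of_le (by simp; positivity)
  have l1 : RAM.len 1 ≤ Nat.log 2 (bigBound A) + 1 := len_le_of_le (by simp; omega)
  have l2 : RAM.len 2 ≤ Nat.log 2 (bigBound A) + 1 := len_le_of_le (by simp; omega)
  have f0 : ∀ x, reg x ≠ 0 := fun x => (reg_ne x).1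
  have f1 : ∀ x, reg x ≠ 1 := fun x => (reg_ne x).2
  have g0 : ∀ a p, addr a p ≠ 0 := fun a p => (addr_ne a p).1
  have g1 : ∀ a p, addr a p ≠ 1 := fun a p => (addr_ne a p).2
  have hdiv : ∀ v : ℤ, v.fdiv 2 = v / 2 := fun v => Int.fdiv_eq_ediv_of_nonneg v (by norm_num)
  cases a with
  | lit x k =>
    simp only [Atom.size] at ha
    have := lr x (by omega)
    have : RAM.len k ≤ _ := len_le_of_le (A := A) (by rw [Int.abs_eq_natAbs]; omega)
    simp only [Atom.code, runList, RAM.exec, Operand.val, Operand.addr, Operand.cost,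
      Operand.addrCost, RAM.Cfg.put, Option.map_some, Option.bind_some, Function.update_self, f0, ne_eq,
      not_false_eq_true, Function.update_of_ne]
    refine ⟨_, rfl, h.set x (fun r h0 h1 => ?_) rfl rfl, ?_⟩
    · simp [Function.update_apply, h0]
    · simp only [tickCost]; omega
  | copy x y =>
    simp only [Atom.size] at ha
    have := lr x (by omega)
    have := lr y (by omega)
    have := lv y
    simp only [Atom.code, runList, RAM.exec, Operand.val, Operand.addr, Operand.cost,
      Operand.addrCost, RAM.Cfg.put, Option.map_some, Option.bind_some, Function.update_self, f0, ne_eq,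
      not_false_eq_true, Function.update_of_ne, h.vars]
    refine ⟨_, rfl, h.set x (fun r h0 h1 => ?_) rfl rfl, ?_⟩
    · simp [Function.update_apply, h0]
    · simp only [tickCost]; omega
  | inc x =>
    simp only [Atom.size] at ha
    have := lr x (by omega)
    have := lv x
    have : RAM.len (s.vars x + 1) ≤ _ := len_le_of_le (A := A) (by
      have := hv x; rw [abs_le] at *; constructor <;> linarith)
    simp only [Atom.code, runList, RAM.exec, Operand.val, Operand.addr, Operand.cost,
      Operand.addrCost, RAM.Cfg.put, Option.map_some, Option.bind_some, Function.update_self, f0, ne_eq,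
      not_false_eq_true, Function.update_of_ne, h.vars]
    refine ⟨_, rfl, h.set x (fun r h0 h1 => ?_) rfl rfl, ?_⟩
    · simp [Function.update_apply, h0]
    · simp only [tickCost]; omega
  | dec x =>
    simp only [Atom.size] at ha
    have := lr x (by omega)
    have := lv x
    have : RAM.len (s.vars x - 1) ≤ _ := len_le_of_le (A := A) (by
      have := hv x; rw [abs_le] at *; constructor <;> linarith)
    simp only [Atom.code, runList, RAM.exec, Operand.val, Operand.addr, Operand.cost,
      Operand.addrCost, RAM.Cfg.put, Option.map_some, Option.bind_some, Function.update_self, f0, ne_eq,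
      not_false_eq_true, Function.update_of_ne, h.vars]
    refine ⟨_, rfl, h.set x (fun r h0 h1 => ?_) rfl rfl, ?_⟩
    · simp [Function.update_apply, h0]
    · simp only [tickCost]; omega
  | neg x =>
    simp only [Atom.size] at ha
    have := lr x (by omega)
    have := lv x
    have : RAM.len (0 - s.vars x) ≤ _ := len_le_of_le (A := A) (by
      have := hv x; rw [abs_le] at *; constructor <;> linarith)
    simp only [Atom.code, runList, RAM.exec, Operand.val, Operand.addr, Operand.cost,
      Operand.addrCost, RAM.Cfg.put, Option.map_some, Option.bind_some, Function.update_self, f0, ne_eq,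
      not_false_eq_true, Function.update_of_ne, h.vars]
    refine ⟨_, rfl, h.set x (fun r h0 h1 => ?_) rfl rfl, ?_⟩
    · simp [Function.update_apply, h0]
    · simp only [tickCost]; omega
  | double x =>
    simp only [Atom.size] at ha
    have := lr x (by omega)
    have := lv x
    have : RAM.len (s.vars x + s.vars x) ≤ _ := len_le_of_le (A := A) (by
      have := hv x; rw [abs_le] at *; constructor <;> linarith)
    simp only [Atom.code, runList, RAM.exec, Operand.val, Operand.addr, Operand.cost,
      Operand.addrCost, RAM.Cfg.put, Option.map_some, Option.bind_some, Function.update_self, f0, ne_eq,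
      not_false_eq_true, Function.update_of_ne, h.vars]
    refine ⟨_, rfl, h.set x (fun r h0 h1 => ?_) rfl rfl, ?_⟩
    · simp [Function.update_apply, h0, two_mul]
    · simp only [tickCost]; omega
  | half x =>
    simp only [Atom.size] at ha
    have := lr x (by omega)
    have := lv x
    have : RAM.len (s.vars x / 2) ≤ _ := len_le_of_le (A := A) (by
      have := hv x; rw [abs_le] at *; omega)
    simp only [Atom.code, runList, RAM.exec, Operand.val, Operand.addr, Operand.cost,
      Operand.addrCost, RAM.Cfg.put, Option.map_some, Option.bind_some, Function.update_self, f0, ne_eq,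
      not_false_eq_true, Function.update_of_ne, h.vars, OfNat.ofNat_ne_zero, if_false, hdiv]
    refine ⟨_, rfl, h.set x (fun r h0 h1 => ?_) rfl rfl, ?_⟩
    · simp [Function.update_apply, h0]
    · simp only [tickCost]; omega
  | parity x y =>
    simp only [Atom.size] at ha
    have := lr x (by omega)
    have := lr y (by omega)
    have := lv y
    have : RAM.len (s.vars y / 2) ≤ _ := len_le_of_le (A := A) (by
      have := hv y; rw [abs_le] at *; omega)
    have : RAM.len (s.vars y - s.vars y / 2) ≤ _ := len_le_of_le (A := A) (by
      have := hv y; rw [abs_le] at *; omega)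
    have : RAM.len (s.vars y - s.vars y / 2 - s.vars y / 2) ≤ _ := len_le_of_le (A := A) (by
      have := hv y; rw [abs_le] at *; omega)
    simp only [Atom.code, runList, RAM.exec, Operand.val, Operand.addr, Operand.cost,
      Operand.addrCost, RAM.Cfg.put, Option.map_some, Option.bind_some, Function.update_self, f0, f1, ne_eq,
      not_false_eq_true, Function.update_of_ne, h.vars, OfNat.ofNat_ne_zero, if_false, hdiv,
      one_ne_zero, Nat.cast_one]
    refine ⟨_, rfl, h.set x (fun r h0 h1 => ?_) rfl rfl, ?_⟩
    · have : s.vars y - s.vars y / 2 - s.vars y / 2 = s.vars y % 2 := by omega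
      simp [Function.update_apply, h0, h1, this]
    · simp only [tickCost]; omega
  | read x =>
    simp only [Atom.size] at ha
    have := lr x (by omega)
    have e : c.input.headD 0 = X.getD s.rd 0 := by
      rw [h.input, List.headD_eq_head?_getD, List.head?_drop, List.getD_eq_getElem?_getD]
    have : RAM.len (X.getD s.rd 0) ≤ Nat.log 2 (bigBound A) + 1 := by
      by_cases hl : s.rd < X.length
      · rw [List.getD_eq_getElem _ _ hl]
        have := hX _ (List.getElem_mem hl)
        exact len_le_of_le (by linarith)
      · rw [List.getD_eq_default _ _ (not_lt.1 hl)]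
        exact l0
    simp only [Atom.code, runList, RAM.exec, Operand.addr,
      Operand.addrCost, RAM.Cfg.put, Option.map_some, Option.bind_some, e]
    have h' : Sim X (s.set x (X.getD s.rd 0))
        { c with mem := Function.update c.mem (reg x) (X.getD s.rd 0) } :=
      h.set x (fun r h0 h1 => rfl) rfl rfl
    refine ⟨_, rfl, ⟨h'.vars, h'.arr, ?_, h'.output⟩, ?_⟩
    · rw [h.input, List.tail_drop]; rfl
    · simp only [tickCost]; omega
  | get x a y =>
    simp only [Atom.size] at ha
    have h2a := Nat.two_pow_pos a
    obtain ⟨d, v, hd, hm, hi, ho, hk⟩ := runList_addrCode (p := p) (A := A) (a := a) (y := y) (c := c)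
      (by rw [h.vars]; exact hv y) (by omega) (by omega)
    have := lr x (by omega)
    have := la a (s.vars y)
    have l3 := len_le (addr_bounds (A := A) (a := a) (hv y) (by omega)).2.2.2
    have e : (addrInt a (s.vars y)).toNat = addr a (s.vars y) := rfl
    have e' : (if 0 ≤ addrInt a (s.vars y) then some (addr a (s.vars y)) else none) =
      some (addr a (s.vars y)) := if_pos (by have := addrInt_pos a (s.vars y); omega)
    simp only [Atom.code, runList_append, hd, Option.bind_some, runList, RAM.exec, Operand.val, Operand.addr,
      Operand.cost, Operand.addrCost, RAM.Cfg.put, Option.map_some, Function.update_self, f0,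
      ne_eq, not_false_eq_true, Function.update_of_ne, h.vars, hm, e, e', g0, g1, h.arr, Nat.cast_one]
    refine ⟨_, rfl, h.set x (fun r h0 h1 => ?_) hi ho, ?_⟩
    · simp [Function.update_apply, h0, h1]
    · simp only [tickCost]; omega
  | put a y x =>
    simp only [Atom.size] at ha
    have h2a := Nat.two_pow_pos a
    obtain ⟨d, v, hd, hm, hi, ho, hk⟩ := runList_addrCode (p := p) (A := A) (a := a) (y := y) (c := c)
      (by rw [h.vars]; exact hv y) (by omega) (by omega)
    have := lr x (by omega)
    have := lv x
    have l3 := len_le (addr_bounds (A := A) (a := a) (hv y) (by omega)).2.2.2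
    have e : (addrInt a (s.vars y)).toNat = addr a (s.vars y) := rfl
    have e' : (if 0 ≤ addrInt a (s.vars y) then some (addr a (s.vars y)) else none) =
      some (addr a (s.vars y)) := if_pos (by have := addrInt_pos a (s.vars y); omega)
    simp only [Atom.code, runList_append, hd, Option.bind_some, runList, RAM.exec, Operand.val, Operand.addr,
      Operand.cost, Operand.addrCost, RAM.Cfg.put, Option.map_some, Function.update_self, f0, f1,
      ne_eq, not_false_eq_true, Function.update_of_ne, h.vars, hm, e, e', Nat.cast_one, one_ne_zero]
    refine ⟨_, rfl, h.setArr a _ (fun r h0 h1 => ?_) hi ho, ?_⟩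
    · simp [Function.update_apply, h0, h1]
    · simp only [tickCost]; omega
  | putLit a y k =>
    simp only [Atom.size] at ha
    have h2a := Nat.two_pow_pos a
    obtain ⟨d, v, hd, hm, hi, ho, hk⟩ := runList_addrCode (p := p) (A := A) (a := a) (y := y) (c := c)
      (by rw [h.vars]; exact hv y) (by omega) (by omega)
    have : RAM.len k ≤ _ := len_le_of_le (A := A) (by rw [Int.abs_eq_natAbs]; omega)
    have l3 := len_le (addr_bounds (A := A) (a := a) (hv y) (by omega)).2.2.2
    have e : (addrInt a (s.vars y)).toNat = addr a (s.vars y) := rfl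
    have e' : (if 0 ≤ addrInt a (s.vars y) then some (addr a (s.vars y)) else none) =
      some (addr a (s.vars y)) := if_pos (by have := addrInt_pos a (s.vars y); omega)
    simp only [Atom.code, runList_append, hd, Option.bind_some, runList, RAM.exec, Operand.val, Operand.addr,
      Operand.cost, Operand.addrCost, RAM.Cfg.put, Option.map_some, Function.update_self,
      ne_eq, not_false_eq_true, Function.update_of_ne, h.vars, hm, e, e', Nat.cast_one, one_ne_zero]
    refine ⟨_, rfl, h.setArr a _ (fun r h0 h1 => ?_) hi ho, ?_⟩
    · simp [Function.update_apply, h0, h1]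
    · simp only [tickCost]; omega

theorem Atom.code_straight (a : Atom) : ∀ I ∈ a.code, IsStraight I := by
  cases a <;> simp [Atom.code, addrCode, IsStraight]

/-- Compiled programs simulate the big-step semantics. -/
theorem Exec.sim {P : RAM.Program} {X : List ℤ} {A B : ℕ} (hX : ∀ v ∈ X, |v| ≤ B) {k : Cmd} {s t : St}
    (h : Exec X B k s t) : ∀ {p : ℕ} {c : RAM.Cfg}, CodeAt P p (k.code p) → k.size ≤ B →
      B + t.clk ≤ A → s.Bdd B → c.pc = some p → Sim X s c →
      ∃ d, Reaches P c d ∧ d.pc = some (p + k.length) ∧ Sim X t d ∧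
        d.cost + tickCost A * s.clk ≤ c.cost + tickCost A * t.clk := by
  have hv : ∀ {s : St} {n : ℕ}, s.Bdd B → s.clk ≤ n → B + n ≤ A →
      (∀ x, |s.vars x| ≤ A) ∧ ∀ a p, |s.arr a p| ≤ A := fun h h1 h2 =>
    ⟨fun x => (h.1 x).trans (by exact_mod_cast (by omega)),
      fun a p => (h.2 a p).trans (by exact_mod_cast (by omega))⟩
  -- A test costs the loading of the variable, the conditional jump and one unconditional jump; its
  -- tick pays for all of them.
  have htest : ∀ {s : St} {x n : ℕ}, s.Bdd B → s.clk ≤ n → B + n ≤ A → x ≤ B →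
      RAM.len (reg x) + 3 * RAM.len (s.vars x) + 2 ≤ tickCost A := fun {s x n} h h1 h2 h3 => by
    have e1 := len_le_of_le (abs_reg_le (x := x) (A := A) (by omega))
    have e2 : RAM.len (s.vars x) ≤ _ := len_le_of_le (A := A) (by
      have := (hv h h1 h2).1 x
      have : (0 : ℤ) ≤ A := Int.natCast_nonneg A
      linarith)
    simp only [tickCost]
    omega
  induction h with
  | skip s =>
    intro p c _ _ _ _ hp hs
    exact ⟨c, .refl, hp, hs, le_rfl⟩
  | atom a s hok =>
    intro p c hP hsize hA hb hp hs
    rw [Atom.clk_eval] at hA ⊢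
    obtain ⟨hb1, hb2⟩ := hv hb (Nat.le_succ s.clk) hA
    obtain ⟨d, hd, hsim, hcost⟩ := a.sim (A := A) p hs hb1 hb2
      (fun v hv => (hX v hv).trans (by exact_mod_cast (by omega))) (le_trans hsize (by omega))
    obtain ⟨h1, h2⟩ := reaches_runList _ a.code_straight hP hp hd
    exact ⟨d, h1, h2, hsim, by rw [mul_add]; omega⟩
  | @seq c₁ c₂ s t u h1 h2 ih1 ih2 =>
    intro p c hP hsize hA hb hp hs
    simp only [Cmd.size] at hsize
    have hle := h2.clk_le
    obtain ⟨d, r1, p1, s1, k1⟩ := ih1 hP.left (by omega) (by omega) hb hp hs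
    obtain ⟨e, r2, p2, s2, k2⟩ := ih2 (hP.right (by rw [Cmd.length_code])) (by omega) hA
      (h1.bdd hX (by omega) hb) p1 s1
    exact ⟨e, r1.trans r2, by rw [p2, Cmd.length, add_assoc], s2, by omega⟩
  | @ite_true z x c₁ c₂ s t hz h1 ih =>
    intro p c hP hsize hA hb hp hs
    simp only [Cmd.size] at hsize
    have hle := h1.clk_le
    simp only [St.tick] at hle
    have hcost := htest (x := x) hb (by omega : s.clk ≤ t.clk) hA (by omega)
    have hPl := hP.left.left.left
    have hPc : CodeAt P (p + 3 + c₂.length) (c₁.code (p + 3 + c₂.length)) :=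
      hP.right (by simp [Cmd.length_code]; omega)
    let d : RAM.Cfg := { c with
      pc := some (p + 3 + c₂.length)
      mem := Function.update c.mem 0 (s.vars x)
      cost := c.cost + (RAM.len (reg x) + RAM.len (s.vars x)) + RAM.len (s.vars x) }
    obtain ⟨e, r2, p2, s2, k2⟩ := ih (c := d) hPc (by omega) hA hb.tick rfl
      (hs.tick (fun r h0 _ => by simp [d, h0]) rfl rfl)
    refine ⟨e, reaches_head hp (hPl 0 _ rfl) (d := { c with
      pc := some (p + 1)
      mem := Function.update c.mem 0 (s.vars x)
      cost := c.cost + (RAM.len (reg x) + RAM.len (s.vars x)) }) ?_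
        (reaches_head rfl (hPl 1 _ rfl) ?_ r2), ?_, s2, ?_⟩
    · simp [RAM.exec, Operand.val, Operand.cost, Operand.addrCost, RAM.Cfg.put, hs.vars]
    · cases z
      · simp at hz
        simp [RAM.exec, RAM.Cfg.goto, hz, d]
      · simp at hz
        simp [RAM.exec, RAM.Cfg.goto, hz, d]
    · rw [p2, Cmd.length]; congr 1; omega
    · simp only [St.tick, mul_add, d] at k2
      omega
  | @ite_false z x c₁ c₂ s t hz h1 ih =>
    intro p c hP hsize hA hb hp hs
    simp only [Cmd.size] at hsize
    have hle := h1.clk_le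
    simp only [St.tick] at hle
    have hcost := htest (x := x) hb (by omega : s.clk ≤ t.clk) hA (by omega)
    have hPl := hP.left.left.left
    have hPd : CodeAt P (p + 2) (c₂.code (p + 2)) := hP.left.left.right rfl
    -- The second branch stands first in the code, so it ends with a jump over the other one.
    have hPj : P[p + 2 + c₂.length]? = some (.jump (p + 3 + c₂.length + c₁.length)) :=
      hP.left.right (q := p + 2 + c₂.length) (by simp [Cmd.length_code]; omega) 0 _ rfl
    let d : RAM.Cfg := { c with
      pc := some (p + 2)
      mem := Function.update c.mem 0 (s.vars x)
      cost := c.cost + (RAM.len (reg x) + RAM.len (s.vars x)) + RAM.len (s.vars x) }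
    obtain ⟨e, r2, p2, s2, k2⟩ := ih (c := d) hPd (by omega) hA hb.tick rfl
      (hs.tick (fun r h0 _ => by simp [d, h0]) rfl rfl)
    refine ⟨e.goto (p + 3 + c₂.length + c₁.length) 1, reaches_head hp (hPl 0 _ rfl) (d := { c with
      pc := some (p + 1)
      mem := Function.update c.mem 0 (s.vars x)
      cost := c.cost + (RAM.len (reg x) + RAM.len (s.vars x)) }) ?_
        (reaches_head rfl (hPl 1 _ rfl) ?_ (r2.trans (reaches_head p2 hPj rfl .refl))), ?_,
        ⟨s2.vars, s2.arr, s2.input, s2.output⟩, ?_⟩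
    · simp [RAM.exec, Operand.val, Operand.cost, Operand.addrCost, RAM.Cfg.put, hs.vars]
    · cases z
      · simp at hz
        simp [RAM.exec, RAM.Cfg.goto, hz, d]
      · simp at hz
        simp [RAM.exec, RAM.Cfg.goto, hz, d]
    · simp only [RAM.Cfg.goto, Cmd.length]; congr 1; omega
    · simp only [St.tick, mul_add, d, RAM.Cfg.goto] at k2 ⊢
      omega
  | @while_done x c₁ s hz =>
    intro p c hP hsize hA hb hp hs
    simp only [Cmd.size] at hsize
    simp only [St.tick] at hA
    have hcost := htest (x := x) hb (by omega : s.clk ≤ s.clk + 1) hA (by omega)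
    have hPl := hP.left.left
    refine ⟨_, reaches_head hp (hPl 0 _ rfl) (d := { c with
      pc := some (p + 1)
      mem := Function.update c.mem 0 (s.vars x)
      cost := c.cost + (RAM.len (reg x) + RAM.len (s.vars x)) }) ?_
        (reaches_head rfl (hPl 1 _ rfl) rfl (reaches_head ?_ (hPl 2 _ rfl) rfl .refl)), ?_, ?_, ?_⟩
    · simp [RAM.exec, Operand.val, Operand.cost, Operand.addrCost, RAM.Cfg.put, hs.vars]
    · simp [RAM.Cfg.goto, hz]
    · simp only [RAM.Cfg.goto, Cmd.length]; congr 1; omega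
    · exact hs.tick (fun r h0 _ => by simp [RAM.Cfg.goto, h0]) rfl rfl
    · simp only [St.tick, mul_add, RAM.Cfg.goto, Function.update_self]
      omega
  | @while_step x c₁ s t u hz h1 h2 ih1 ih2 =>
    intro p c hP hsize hA hb hp hs
    have hsize' := hsize
    simp only [Cmd.size] at hsize'
    have hle := h1.clk_le
    have hle2 := h2.clk_le
    simp only [St.tick] at hle
    have hcost := htest (x := x) hb (by omega : s.clk ≤ u.clk) hA (by omega)
    have hPl := hP.left.left
    have hPc : CodeAt P (p + 3) (c₁.code (p + 3)) := hP.left.right rfl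
    have hPj : P[p + 3 + c₁.length]? = some (.jump p) :=
      hP.right (q := p + 3 + c₁.length) (by simp [Cmd.length_code]; omega) 0 _ rfl
    let d : RAM.Cfg := { c with
      pc := some (p + 3)
      mem := Function.update c.mem 0 (s.vars x)
      cost := c.cost + (RAM.len (reg x) + RAM.len (s.vars x)) + RAM.len (s.vars x) }
    obtain ⟨e, r2, p2, s2, k2⟩ := ih1 (c := d) hPc (by omega) (by omega) hb.tick rfl
      (hs.tick (fun r h0 _ => by simp [d, h0]) rfl rfl)
    obtain ⟨f, r3, p3, s3, k3⟩ := ih2 (c := e.goto p 1) hP hsize hA (h1.bdd hX (by omega) hb.tick) rfl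
      ⟨s2.vars, s2.arr, s2.input, s2.output⟩
    refine ⟨f, reaches_head hp (hPl 0 _ rfl) (d := { c with
      pc := some (p + 1)
      mem := Function.update c.mem 0 (s.vars x)
      cost := c.cost + (RAM.len (reg x) + RAM.len (s.vars x)) }) ?_
        (reaches_head rfl (hPl 1 _ rfl) ?_ (r2.trans (reaches_head p2 hPj rfl r3))), p3, s3, ?_⟩
    · simp [RAM.exec, Operand.val, Operand.cost, Operand.addrCost, RAM.Cfg.put, hs.vars]
    · simp [RAM.exec, RAM.Cfg.goto, hz, d]
    · simp only [St.tick, mul_add, d, RAM.Cfg.goto] at k2 k3 ⊢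
      omega

/-- The initial state. -/
def St.zero : St := ⟨fun _ => 0, fun _ _ => 0, 0, 0⟩

theorem exists_run_of_reaches {P : RAM.Program} {X : List ℤ} {c d : RAM.Cfg} (h : Reaches P c d)
    (hc : ∃ t, RAM.run P X t = c) : ∃ t, RAM.run P X t = d := by
  induction h with
  | refl => exact hc
  | tail _ h ih =>
    obtain ⟨t, ht⟩ := ih
    refine ⟨t + 1, ?_⟩
    rw [RAM.run, Function.iterate_succ_apply']
    rw [RAM.run] at ht
    simp [ht, h]

/-- The random access machine program that executes `k` and writes the variable `x`. -/
def Cmd.program (k : Cmd) (x : ℕ) : RAM.Program := k.code 0 ++ [.write (.reg (reg x))]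

theorem Cmd.computesWithin {X : List ℤ} {B A : ℕ} (hX : ∀ v ∈ X, |v| ≤ B) {k : Cmd} {s : St} {x : ℕ}
    (h : Exec X B k St.zero s) (hk : k.size + x ≤ B) (hA : B + s.clk ≤ A) :
    RAM.ComputesWithin (k.program x) X [s.vars x] (tickCost A * (s.clk + 1)) := by
  have hP : CodeAt (k.program x) 0 (k.program x) := fun i I h => by rwa [zero_add]
  have hz : St.zero.Bdd B := ⟨fun _ => by simp [St.zero], fun _ _ => by simp [St.zero]⟩
  obtain ⟨d, r, hp, hs, hcost⟩ := h.sim (P := k.program x) (A := A) hX (c := RAM.init X) hP.left (by omega)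
    hA hz rfl ⟨fun _ => rfl, fun _ _ => rfl, rfl, rfl⟩
  have hw : (k.program x)[0 + k.length]? = some (.write (.reg (reg x))) :=
    hP.right (q := 0 + k.length) (by rw [Cmd.length_code]) 0 _ rfl
  have hb := h.bdd hX (by omega) hz
  have e1 := len_le_of_le (abs_reg_le (x := x) (A := A) (by omega))
  have e2 : RAM.len (s.vars x) ≤ _ := len_le_of_le (A := A) (by
    have := hb.1 x
    have h2 : (B : ℤ) + s.clk ≤ A := by exact_mod_cast hA
    have : (0 : ℤ) ≤ A := Int.natCast_nonneg A
    linarith)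
  obtain ⟨t, ht⟩ := exists_run_of_reaches (r.trans (reaches_head hp hw rfl .refl)) ⟨0, rfl⟩
  refine ⟨t, ?_, ?_, ?_⟩
  · rw [ht]
    -- The `write` is the last instruction. Afterwards the location counter points behind the
    -- program, which stops without a `halt`.
    have : (k.program x).length ≤ 0 + k.length + 1 := by simp [Cmd.program, Cmd.length_code]
    simp only [RAM.step, RAM.Cfg.goto, Option.bind_some]
    rw [List.getElem?_eq_none this]; rfl
  · rw [ht]; simp [hs.output, hs.vars]
  · rw [ht]
    simp only [RAM.init, St.zero, mul_zero, Operand.cost, Operand.addrCost, RAM.Cfg.goto, hs.vars] at hcost ⊢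
    rw [mul_add]
    simp only [tickCost] at hcost ⊢
    omega

end LoopProg

/-! ## Simulation of Turing machines -/

/-- The displacement of the head by a movement. -/
def MultiTapeTM.displacement : Option Turing.Dir → ℤ
  | none => 0
  | some .left => -1
  | some .right => 1

/-- Cells are counted from the head, so a movement shifts the whole tape. In these coordinates a
step is a pointwise formula, and an array with a head position can represent the tape. -/
theorem MultiTapeTM.act_nth {Γ : Type} [Inhabited Γ] (T : Turing.Tape Γ)
    (r : Γ × Option Turing.Dir) (z : ℤ) : (MultiTapeTM.act T r).nth z =
      if z + displacement r.2 = 0 then r.1 else T.nth (z + displacement r.2) := by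
  rcases r with ⟨a, _ | _ | _⟩
  · simp [MultiTapeTM.act, displacement]
  · simp [MultiTapeTM.act, Turing.Tape.move_left_nth, ← sub_eq_add_neg, displacement]
  · simp [MultiTapeTM.act, Turing.Tape.move_right_nth, displacement]
    rfl

theorem Turing.Tape.mk₁_nth {Γ : Type} [Inhabited Γ] (l : List Γ) (z : ℤ) :
    (Turing.Tape.mk₁ l).nth z = if 0 ≤ z then l.getI z.toNat else default := by
  rcases z with n | n
  · simp [Turing.Tape.mk₁, Turing.Tape.mk₂, Turing.Tape.mk'_nth_nat]
  · simp [Turing.Tape.mk₁, Turing.Tape.mk₂, Turing.Tape.nth, Turing.Tape.mk']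

theorem MultiTapeTM.bitTape_nth (M : MultiTapeTM) (x : List Bool) (z : ℤ) :
    (M.bitTape x).nth z = if 0 ≤ z then (x[z.toNat]?).map M.bit else none := by
  rw [MultiTapeTM.bitTape, Turing.Tape.mk₁_nth]
  split_ifs
  · rw [← List.getD_default_eq_getI, List.getD_eq_getElem?_getD, List.getElem?_map]
    rcases x[z.toNat]? with _ | b <;> rfl
  · rfl

namespace LoopProg

/-! ### Executions with postconditions -/

/-- Some execution of `c` from `s` ends in a state with the property `Q`. -/
def Wp (X : List ℤ) (B : ℕ) (c : Cmd) (Q : St → Prop) (s : St) : Prop :=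
  ∃ t, Exec X B c s t ∧ Q t

variable {X : List ℤ} {B : ℕ}

theorem Wp.seq {c d : Cmd} {Q : St → Prop} {s : St} (h : Wp X B c (Wp X B d Q) s) :
    Wp X B (.seq c d) Q s := by
  obtain ⟨t, h1, u, h2, hQ⟩ := h
  exact ⟨u, .seq h1 h2, hQ⟩

theorem Wp.atom {a : Atom} {Q : St → Prop} {s : St} (ha : a.Ok B s) (h : Q (a.eval X s)) :
    Wp X B (.atom a) Q s := ⟨_, .atom a s ha, h⟩

theorem Wp.mono {c : Cmd} {Q R : St → Prop} {s : St} (h : Wp X B c Q s) (hQ : ∀ t, Q t → R t) :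
    Wp X B c R s := by
  obtain ⟨t, h1, h2⟩ := h
  exact ⟨t, h1, hQ t h2⟩

/-- Case distinction on the value of `x`, which is destroyed. -/
def caseOn (x : ℕ) : ℕ → (ℕ → Cmd) → Cmd
  | 0, _ => .skip
  | n + 1, f => .ite true x (f 0) (.seq (.atom (.dec x)) (caseOn x n fun j => f (j + 1)))

theorem Wp.caseOn {x : ℕ} {Q : St → Prop} {n j : ℕ} {f : ℕ → Cmd} {s : St} (hj : j < n)
    (hx : s.vars x = j)
    (h : ∀ t : St, t.arr = s.arr → t.rd = s.rd → (∀ y, y ≠ x → t.vars y = s.vars y) →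
      t.clk ≤ s.clk + 2 * n → Wp X B (f j) Q t) : Wp X B (caseOn x n f) Q s := by
  induction n generalizing j f s with
  | zero => omega
  | succ n ih =>
    rcases j with _ | j
    · obtain ⟨t, h1, h2⟩ := h s.tick rfl rfl (fun _ _ => rfl) (by simp only [St.tick]; omega)
      exact ⟨t, .ite_true (by simpa using hx) h1, h2⟩
    · have : Wp X B (.seq (.atom (.dec x)) (LoopProg.caseOn x n fun j => f (j + 1))) Q s.tick := by
        refine Wp.seq (Wp.atom trivial (ih (j := j) (by omega) ?_ fun t h1 h2 h3 h4 => ?_))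
        · simp [Atom.eval, St.set, St.tick, hx]
        · refine h t h1 h2 (fun y hy => ?_) ?_
          · rw [h3 y hy]; simp [Atom.eval, St.set, St.tick, hy]
          · simp only [Atom.eval, St.set, St.tick] at h4; omega
      obtain ⟨t, h1, h2⟩ := this
      exact ⟨t, .ite_false (by simp [hx]; omega) h1, h2⟩

/-! ### The simulator of a fixed machine -/

section Simulator

variable (M : MultiTapeTM)

open Classical in
/-- A numbering of the symbols, in which the blank is `0`. -/
noncomputable def symCode : Option M.Sym → ℕ
  | none => 0
  | some a => (haveI := M.finiteSym; Finite.equivFin M.Sym a).val + 1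

/-- A numbering of the states. -/
noncomputable def stateCode (q : M.State) : ℕ := (haveI := M.finiteState; Finite.equivFin M.State q).val

theorem symCode_injective : Function.Injective (symCode M) := by
  rintro (_ | a) (_ | b) h <;> simp_all [symCode, Fin.val_inj]

theorem stateCode_injective : Function.Injective (stateCode M) := fun a b h => by
  simpa [stateCode, Fin.val_inj] using h

theorem symCode_lt (a : Option M.Sym) : symCode M a < Nat.card M.Sym + 1 := by
  rcases a with _ | a
  · simp [symCode]
  · simp [symCode]

theorem stateCode_lt (q : M.State) : stateCode M q < Nat.card M.State := Fin.is_lt _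

/-- The case distinctions of the program run over numbers, whereas the transition function expects
symbols. -/
noncomputable def symDecode : ℕ → Option M.Sym := Function.invFun (symCode M)

noncomputable def stateDecode : ℕ → M.State :=
  haveI : Nonempty M.State := ⟨M.start⟩
  Function.invFun (stateCode M)

theorem symDecode_symCode (a : Option M.Sym) : symDecode M (symCode M a) = a :=
  Function.leftInverse_invFun (symCode_injective M) a

theorem stateDecode_stateCode (q : M.State) : stateDecode M (stateCode M q) = q :=
  haveI : Nonempty M.State := ⟨M.start⟩
  Function.leftInverse_invFun (stateCode_injective M) q

/-- The array `i` with head position in the variable `24 + i` holds the tape `T`. -/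
def HoldsTape (i : ℕ) (s : St) (T : Turing.Tape (Option M.Sym)) : Prop :=
  ∀ z : ℤ, s.arr i (s.vars (24 + i) + z) = symCode M (T.nth z)

variable {M} in
theorem HoldsTape.congr {i : ℕ} {s t : St} {T : Turing.Tape (Option M.Sym)} (h : HoldsTape M i s T)
    (h1 : t.arr i = s.arr i) (h2 : t.vars (24 + i) = s.vars (24 + i)) : HoldsTape M i t T := by
  intro z
  rw [h1, h2, h z]

/-- Write a symbol on the tape `i` and move the head. -/
noncomputable def actCode (i : ℕ) : Option M.Sym × Option Turing.Dir → Cmd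
  | (a, none) => .atom (.putLit i (24 + i) (symCode M a))
  | (a, some .left) => .seq (.atom (.putLit i (24 + i) (symCode M a))) (.atom (.dec (24 + i)))
  | (a, some .right) => .seq (.atom (.putLit i (24 + i) (symCode M a))) (.atom (.inc (24 + i)))

theorem wp_actCode (i : ℕ) (r : Option M.Sym × Option Turing.Dir) (s : St) :
    Wp X B (actCode M i r) (fun t => (∀ T, HoldsTape M i s T → HoldsTape M i t (MultiTapeTM.act T r)) ∧
      (∀ x, x ≠ 24 + i → t.vars x = s.vars x) ∧ (∀ a, a ≠ i → t.arr a = s.arr a) ∧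
      t.clk ≤ s.clk + 2) s := by
  rcases r with ⟨a, _ | _ | _⟩
  · refine Wp.atom trivial ⟨fun T hT z => ?_, fun x hx => rfl, fun b hb => ?_, ?_⟩
    · have := hT z
      simp [Atom.eval, St.setArr, MultiTapeTM.act_nth, MultiTapeTM.displacement, Function.update_apply, this]
      split_ifs <;> rfl
    · simp [Atom.eval, St.setArr, hb]
    · simp [Atom.eval, St.setArr]
  · refine Wp.seq (Wp.atom trivial (Wp.atom trivial ⟨fun T hT z => ?_, fun x hx => ?_, fun b hb => ?_, ?_⟩))
    · have := hT (z + -1)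
      have e : s.vars (24 + i) - 1 + z = s.vars (24 + i) + (z + -1) := by ring
      simp only [Atom.eval, St.setArr, St.set, MultiTapeTM.act_nth, MultiTapeTM.displacement, Function.update_apply, if_true, e, this,
        add_eq_left]
      by_cases hz : z + -1 = 0 <;> simp only [hz, if_true, if_false]
    · simp [Atom.eval, St.setArr, St.set, hx]
    · simp [Atom.eval, St.setArr, St.set, hb]
    · simp [Atom.eval, St.setArr, St.set]
  · refine Wp.seq (Wp.atom trivial (Wp.atom trivial ⟨fun T hT z => ?_, fun x hx => ?_, fun b hb => ?_, ?_⟩))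
    · have := hT (z + 1)
      have e : s.vars (24 + i) + 1 + z = s.vars (24 + i) + (z + 1) := by ring
      simp only [Atom.eval, St.setArr, St.set, MultiTapeTM.act_nth, MultiTapeTM.displacement, Function.update_apply, if_true, e, this,
        add_eq_left]
      by_cases hz : z + 1 = 0 <;> simp only [hz, if_true, if_false]
    · simp [Atom.eval, St.setArr, St.set, hx]
    · simp [Atom.eval, St.setArr, St.set, hb]
    · simp [Atom.eval, St.setArr, St.set]

/-- Act on the tapes in the list. -/
noncomputable def actsCode (r : Fin (M.work + 2) → Option M.Sym × Option Turing.Dir) :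
    List (Fin (M.work + 2)) → Cmd
  | [] => .skip
  | i :: l => .seq (actCode M i (r i)) (actsCode r l)

theorem wp_actsCode (r : Fin (M.work + 2) → Option M.Sym × Option Turing.Dir)
    (l : List (Fin (M.work + 2))) (hl : l.Nodup) (s : St) :
    Wp X B (actsCode M r l) (fun t =>
      (∀ i ∈ l, ∀ T, HoldsTape M i s T → HoldsTape M i t (MultiTapeTM.act T (r i))) ∧
      (∀ i ∉ l, ∀ T, HoldsTape M i s T → HoldsTape M i t T) ∧
      (∀ x < 24, t.vars x = s.vars x) ∧ t.clk ≤ s.clk + 2 * l.length) s := by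
  induction l generalizing s with
  | nil => exact ⟨s, .skip s, by simp, by simp, by simp, by simp⟩
  | cons i l ih =>
    rw [List.nodup_cons] at hl
    refine Wp.seq ((wp_actCode M i (r i) s).mono fun t ht => (ih hl.2 t).mono fun u hu => ?_)
    obtain ⟨h1, h2, h3, h4⟩ := ht
    obtain ⟨k1, k2, k3, k4⟩ := hu
    have hne : ∀ j : Fin (M.work + 2), j ≠ i → ∀ T, HoldsTape M j s T → HoldsTape M j t T := fun j hj T hT =>
      have hj' : (j : ℕ) ≠ i := fun h => hj (Fin.ext h)
      hT.congr (h3 _ hj') (h2 _ (by omega))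
    refine ⟨fun j hj T hT => ?_, fun j hj T hT => ?_, fun x hx => (k3 x hx).trans (h2 x (by omega)), ?_⟩
    · by_cases hji : j = i
      · subst hji
        exact k2 _ hl.1 _ (h1 T hT)
      · exact k1 j (by simpa [hji] using hj) _ (hne j hji T hT)
    · rw [List.mem_cons, not_or] at hj
      exact k2 j hj.2 _ (hne j hj.1 T hT)
    · simp only [List.length_cons]; omega

/-- Read the tapes in the list and branch accordingly. -/
noncomputable def treeCode (leaf : (Fin (M.work + 2) → Option M.Sym) → Cmd) :
    List (Fin (M.work + 2)) → (Fin (M.work + 2) → Option M.Sym) → Cmd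
  | [], σ => leaf σ
  | i :: l, σ => .seq (.atom (.get 23 i (24 + i)))
      (caseOn 23 (Nat.card M.Sym + 1) fun a => treeCode leaf l (Function.update σ i (symDecode M a)))

/-- The argument `σ` collects the symbols read so far, which makes the induction over the tapes
possible. The whole transition table is unfolded into the program, whose size depends on the machine
alone. -/
theorem wp_treeCode (leaf : (Fin (M.work + 2) → Option M.Sym) → Cmd) (Q : St → Prop)
    (T : Fin (M.work + 2) → Turing.Tape (Option M.Sym))
    (l : List (Fin (M.work + 2))) (σ : Fin (M.work + 2) → Option M.Sym) (s : St)
    (hs : ∀ i : Fin (M.work + 2), HoldsTape M i s (T i))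
    (h : ∀ t : St, t.arr = s.arr → (∀ y, y ≠ 23 → t.vars y = s.vars y) →
      t.clk ≤ s.clk + l.length * (2 * Nat.card M.Sym + 3) →
      Wp X B (leaf fun i => if i ∈ l then (T i).head else σ i) Q t) :
    Wp X B (treeCode M leaf l σ) Q s := by
  induction l generalizing σ s with
  | nil => simpa [treeCode] using h s rfl (fun _ _ => rfl) (by simp)
  | cons i l ih =>
    refine Wp.seq (Wp.atom trivial (Wp.caseOn (j := symCode M (T i).head) (symCode_lt M _) ?_ ?_))
    · have := hs i 0
      simp only [add_zero] at this
      simp [Atom.eval, St.set, this]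
    · intro t h1 _ h2 h3
      have hv : ∀ y, y ≠ 23 → t.vars y = s.vars y := fun y hy => by
        rw [h2 y hy]; simp [Atom.eval, St.set, hy]
      refine ih _ _ (fun j => (hs j).congr (by rw [h1]; rfl) (hv _ (by omega))) fun u k1 k2 k3 => ?_
      have := h u (k1.trans h1) (fun y hy => (k2 y hy).trans (hv y hy)) (by
        simp only [Atom.eval, St.set] at h3
        simp only [List.length_cons, add_mul]; omega)
      convert this using 2
      funext j
      by_cases hj : j ∈ l
      · simp [hj]
      · by_cases hji : j = i
        · subst hji; simp [hj, symDecode_symCode]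
        · simp [hj, hji]

/-- Execute the instruction of the machine for the given state and symbols. -/
noncomputable def leafCode (q : M.State) (σ : Fin (M.work + 2) → Option M.Sym) : Cmd :=
  match M.trans q σ with
  | none => .seq (.atom (.lit 21 (if M.accepting q then 1 else 0))) (.atom (.lit 20 0))
  | some r => .seq (.atom (.lit 22 (stateCode M r.1))) (actsCode M r.2 (List.finRange _))

/-- One step of the machine. -/
noncomputable def stepCode : Cmd :=
  .seq (.atom (.copy 23 22)) (caseOn 23 (Nat.card M.State) fun j =>
    treeCode M (leafCode M (stateDecode M j)) (List.finRange _) fun _ => none)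

/-- The simulation of the machine. Its answer is in the variable `21`. -/
noncomputable def simCode : Cmd :=
  .seq (.atom (.lit 22 (stateCode M M.start))) (.seq (.atom (.lit 20 1)) (.while 20 (stepCode M)))

/-- The state represents the configuration of the machine. -/
structure HoldsCfg (s : St) (c : M.Cfg) : Prop where
  state : s.vars 22 = stateCode M c.state
  tape : ∀ i : Fin (M.work + 2), HoldsTape M i s (c.tape i)

/-- A bound for the number of ticks for one step of the machine. -/
noncomputable def stepCost : ℕ :=
  2 * Nat.card M.State + (M.work + 2) * (2 * Nat.card M.Sym + 5) + 8

/-- The two spare ticks pay for the tests of the surrounding loop. Halting clears the variable `20`,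
which ends that loop. -/
theorem wp_stepCode (s : St) (c : M.Cfg) (hs : HoldsCfg M s c) :
    Wp X B (stepCode M) (fun t => t.clk + 2 ≤ s.clk + stepCost M ∧
      match M.step c with
      | none => t.vars 20 = 0 ∧ t.vars 21 = if M.accepting c.state then 1 else 0
      | some c' => HoldsCfg M t c' ∧ t.vars 20 = s.vars 20) s := by
  refine Wp.seq (Wp.atom trivial (Wp.caseOn (j := stateCode M c.state) (stateCode_lt M _) ?_ ?_))
  · simp [Atom.eval, St.set, hs.state]
  intro t h1 _ h2 h3
  have hv : ∀ y, y ≠ 23 → t.vars y = s.vars y := fun y hy => by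
    rw [h2 y hy]; simp [Atom.eval, St.set, hy]
  rw [stateDecode_stateCode]
  refine wp_treeCode M _ _ c.tape _ _ _
    (fun j => (hs.tape j).congr (by rw [h1]; rfl) (hv _ (by omega))) fun u k1 k2 k3 => ?_
  have hu : ∀ i : Fin (M.work + 2), HoldsTape M i u (c.tape i) := fun i =>
    (hs.tape i).congr (by rw [k1, h1]; rfl) ((k2 _ (by omega)).trans (hv _ (by omega)))
  simp only [List.mem_finRange, if_true, List.length_finRange] at k3 ⊢
  have hclk : u.clk ≤ s.clk + (2 * Nat.card M.State + (M.work + 2) * (2 * Nat.card M.Sym + 3) + 1) := by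
    simp only [Atom.eval, St.set] at h3; omega
  have hcost : stepCost M = 2 * Nat.card M.State + (M.work + 2) * (2 * Nat.card M.Sym + 3) + 1 +
      (2 * (M.work + 2) + 7) := by unfold stepCost; ring
  unfold leafCode MultiTapeTM.step
  rcases M.trans c.state fun i => (c.tape i).head with _ | r
  · refine Wp.seq (Wp.atom trivial (Wp.atom trivial ⟨?_, ?_⟩))
    · simp only [Atom.eval, St.set]; omega
    · simp [Atom.eval, St.set]
  · refine Wp.seq (Wp.atom trivial ((wp_actsCode M r.2 _ (List.nodup_finRange _) _).mono ?_))
    rintro v ⟨m1, -, m2, m3⟩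
    refine ⟨?_, ⟨?_, fun i => ?_⟩, ?_⟩
    · simp only [Atom.eval, St.set, List.length_finRange] at m3; omega
    · rw [m2 22 (by norm_num)]; simp [Atom.eval, St.set]
    · refine m1 i (List.mem_finRange i) _ ((hu i).congr rfl ?_)
      simp only [Atom.eval, St.set]
      rw [Function.update_of_ne (by omega)]
    · rw [m2 20 (by norm_num)]
      simp [Atom.eval, St.set, k2, hv]

theorem wp_whileStep (n : ℕ) (s : St) (c : M.Cfg) (hs : HoldsCfg M s c) (h20 : s.vars 20 = 1)
    (hn : M.step ((fun c => (M.step c).getD c)^[n] c) = none) :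
    Wp X B (.while 20 (stepCode M)) (fun t => t.clk ≤ s.clk + (n + 1) * stepCost M ∧
      t.vars 21 = if M.accepting ((fun c => (M.step c).getD c)^[n] c).state then 1 else 0) s := by
  induction n generalizing s c with
  | zero =>
    obtain ⟨t, h1, h2, h3⟩ := wp_stepCode (X := X) (B := B) M s.tick c ⟨hs.state, hs.tape⟩
    simp only [Function.iterate_zero, id] at hn ⊢
    rw [hn] at h3
    refine ⟨t.tick, .while_step (by omega) h1 (.while_done (by omega)), ?_, h3.2⟩
    simp only [St.tick] at h2 ⊢; omega
  | succ n ih =>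
    obtain ⟨t, h1, h2, h3⟩ := wp_stepCode (X := X) (B := B) M s.tick c ⟨hs.state, hs.tape⟩
    simp only [Function.iterate_succ_apply] at hn ⊢
    obtain hc | ⟨c', hc⟩ : M.step c = none ∨ ∃ c', M.step c = some c' := by
      cases M.step c <;> simp
    · rw [hc] at h3
      -- The machine may halt before step `n`; a halted configuration is a fixed point, so the
      -- iterate is still the final configuration.
      have hfix : ∀ m, (fun c => (M.step c).getD c)^[m] c = c := fun m =>
        Function.iterate_fixed (by simp [hc]) m
      simp only [hc, Option.getD_none, hfix]
      refine ⟨t.tick, .while_step (by omega) h1 (.while_done (by omega)), ?_, h3.2⟩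
      simp only [St.tick] at h2 ⊢
      rw [add_mul]
      omega
    · rw [hc] at h3
      simp only [hc, Option.getD_some] at hn ⊢
      obtain ⟨u, k1, k2, k3⟩ := ih t c' h3.1 (h3.2.trans h20) hn
      refine ⟨u, .while_step (by omega) h1 k1, ?_, k3⟩
      simp only [St.tick] at h2
      rw [add_mul, one_mul]
      omega

/-- A run is constant once the machine has halted, so acceptance can be read off at any time after
that. -/
theorem accepts_iff {M : MultiTapeTM} {x w : List Bool} {n : ℕ} (hn : M.HaltsWithin x w n) :
    M.Accepts x w ↔ M.accepting (M.run x w n).state = true := by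
  have key : ∀ {m n : ℕ}, m ≤ n → M.HaltsWithin x w m → M.run x w n = M.run x w m := by
    intro m n hmn hm
    obtain ⟨k, rfl⟩ := Nat.exists_eq_add_of_le' hmn
    unfold MultiTapeTM.run
    rw [Function.iterate_add_apply]
    refine Function.iterate_fixed ?_ k
    unfold MultiTapeTM.HaltsWithin MultiTapeTM.run at hm
    rw [hm]; rfl
  refine ⟨fun ⟨m, hm, ha⟩ => ?_, fun h => ⟨n, hn, h⟩⟩
  rcases le_total m n with h | h
  · rwa [key h hm]
  · rwa [← key h hn]

/-- The content of the cells of a tape with the bits `x`. -/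
noncomputable def bitCell (x : List Bool) (p : ℤ) : ℤ :=
  if 0 ≤ p then symCode M ((x[p.toNat]?).map M.bit) else 0

/-- Correctness of the simulation. -/
theorem wp_simCode (x : List Bool) (n : ℕ) (hn : M.HaltsWithin x [] n) (s : St)
    (h0 : s.arr 0 = bitCell M x) (harr : ∀ i, 0 < i → i < M.work + 2 → s.arr i = 0)
    (hpos : ∀ i, s.vars (24 + i) = 0) :
    Wp X B (simCode M) (fun t => t.clk ≤ s.clk + (n + 2) * stepCost M ∧
      (t.vars 21 = 1 ↔ M.Accepts x []) ∧ (t.vars 21 = 0 ↔ ¬ M.Accepts x [])) s := by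
  refine Wp.seq (Wp.atom trivial (Wp.seq (Wp.atom trivial
    ((wp_whileStep M n _ (M.init x []) ⟨?_, fun i z => ?_⟩ ?_ hn).mono ?_))))
  · simp [Atom.eval, St.set, MultiTapeTM.init]
  · have : (24 + i.val) ≠ 20 ∧ (24 + i.val) ≠ 22 := by omega
    simp only [Atom.eval, St.set, Function.update_of_ne this.1, Function.update_of_ne this.2, hpos, zero_add]
    by_cases hi : i.val = 0
    · simp only [MultiTapeTM.init, hi, if_true, h0, bitCell, MultiTapeTM.bitTape_nth]
      split_ifs <;> rfl
    -- Without oracle bits tape `1` is blank like the work tapes, and a blank has the code `0` of an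
    -- untouched array entry.
    · simp only [MultiTapeTM.init, hi, if_false, ite_self, MultiTapeTM.bitTape_nth]
      rw [harr i (by omega) i.2]
      simp [symCode]
  · simp [Atom.eval, St.set]
  · rintro t ⟨h1, h2⟩
    rw [accepts_iff hn]
    unfold MultiTapeTM.run
    refine ⟨?_, ?_, ?_⟩
    · simp only [Atom.eval, St.set] at h1
      have : 2 ≤ stepCost M := by unfold stepCost; omega
      rw [add_mul] at h1 ⊢
      omega
    · rw [h2]; split_ifs with h <;> simp [h]
    · rw [h2]; split_ifs with h <;> simp [h]

end Simulator

end LoopProg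

/-! ## A real-time machine that interprets its input as a program for the oracle tape -/

namespace TapeCode

/-- The operations of the interpreter. -/
inductive Op where
  | left
  | right
  | test (b : Bool)
  | endClause
  | write (b : Bool)
  | enable
  | endFormula

/-- The flags of the interpreter: the present clause is satisfied, all clauses so far are satisfied,
acceptance is enabled, some formula was satisfied. -/
@[ext] structure Flags where
  hit : Bool
  ok : Bool
  found : Bool
  acc : Bool

/-- The new flags, when the scanned symbol is `h`. -/
def Op.flags (h : Option Bool) (f : Flags) : Op → Flags
  | left | right | write _ => f
  | test b => { f with hit := f.hit || ((h == some true) == b) }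
  | endClause => { f with ok := f.ok && f.hit, hit := false }
  | enable => ⟨false, true, f.found || f.ok, f.acc⟩
  | endFormula => ⟨false, true, f.found, f.acc || (f.ok && f.found)⟩

/-- The symbol written and the movement of the head, when the scanned symbol is `h`. -/
def Op.action (h : Option Bool) (f : Flags) : Op → Option Bool × Option Turing.Dir
  | left => (h, some .left)
  | right => (h, some .right)
  | write b => (if f.ok then some b else h, none)
  | _ => (h, none)

/-- The displacement of the head. -/
def Op.shift : Op → ℤ
  | left => -1
  | right => 1
  | _ => 0

theorem Op.displacement_action (h : Option Bool) (f : Flags) (o : Op) :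
    MultiTapeTM.displacement (o.action h f).2 = o.shift := by
  cases o <;> rfl

def Op.index : Op → Fin 9
  | left => 0
  | right => 1
  | test false => 2
  | test true => 3
  | endClause => 4
  | write false => 5
  | write true => 6
  | enable => 7
  | endFormula => 8

def Op.ofIndex : Fin 9 → Op :=
  ![left, right, test false, test true, endClause, write false, write true, enable, endFormula]

/-- The unary code of an operation. -/
def Op.code (o : Op) : List Bool := List.replicate o.index.val false ++ [true]

theorem Op.length_code_le (o : Op) : o.code.length ≤ 9 := by
  have := o.index.isLt
  simp only [Op.code, List.length_append, List.length_replicate, List.length_singleton]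
  omega

/-- The state of an abstract interpreter. -/
@[ext] structure Mach where
  flags : Flags
  pos : ℤ
  cell : ℤ → Option Bool

/-- The cells of a `Mach` have absolute positions, unlike those of a tape; operations that do not
write are given the scanned symbol as the one to write. -/
def Op.exec (m : Mach) (o : Op) : Mach where
  flags := o.flags (m.cell m.pos) m.flags
  pos := m.pos + o.shift
  cell := Function.update m.cell m.pos (o.action (m.cell m.pos) m.flags).1

/-- The effect of a sequence of operations. -/
def exec (l : List Op) (m : Mach) : Mach := l.foldl Op.exec m

/-- The transition function of the interpreter. -/
def interpTrans (q : Fin 9 × Flags) (h₀ h₁ : Option Bool) :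
    Option ((Fin 9 × Flags) × (Fin 2 → Option Bool × Option Turing.Dir)) :=
  match h₀ with
  | none => none
  | some false => some ((q.1 + 1, q.2), ![(some false, some .right), (h₁, none)])
  | some true => some ((0, (Op.ofIndex q.1).flags h₁ q.2),
      ![(some true, some .right), (Op.ofIndex q.1).action h₁ q.2])

/-- The interpreter, as a two-tape Turing machine. -/
def interp : MultiTapeTM where
  State := Fin 9 × Flags
  Sym := Bool
  finiteState :=
    haveI : Finite Flags := Finite.of_injective (fun f : Flags => (f.hit, f.ok, f.found, f.acc))
      fun f g h => by
        simp only [Prod.mk.injEq] at h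
        ext <;> simp [h]
    inferInstance
  finiteSym := inferInstance
  bit := Function.Embedding.refl _
  work := 0
  start := (0, ⟨false, true, false, false⟩)
  accepting q := q.2.acc
  trans q σ := interpTrans q (σ 0) (σ 1)

theorem interp_step (c : interp.Cfg) : interp.step c =
    (interpTrans c.state (c.tape 0).head (c.tape 1).head).map fun r =>
      { state := r.1, tape := fun i => MultiTapeTM.act (c.tape i) (r.2 i) } := rfl

/-- The effect of one input bit. -/
def bitStep (k : Fin 9 × Mach) : Bool → Fin 9 × Mach
  | false => (k.1 + 1, k.2)
  | true => (0, (Op.ofIndex k.1).exec k.2)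

/-- The initial state with oracle bits `w`. -/
def Mach.init (w : List Bool) : Mach where
  flags := ⟨false, true, false, false⟩
  pos := 0
  cell p := if 0 ≤ p then w[p.toNat]? else none

/-- Tapes count from their heads: the input tape is shifted by the `t` bits already read, the oracle
tape by `pos`. Nothing is required to the left of the input head, which never turns back. -/
structure Holds (x : List Bool) (t : ℕ) (k : Fin 9 × Mach) (c : interp.Cfg) : Prop where
  state : c.state = (k.1, k.2.flags)
  input : ∀ n : ℕ, (c.tape 0).nth n = x[t + n]?
  oracle : ∀ z : ℤ, (c.tape 1).nth z = k.2.cell (k.2.pos + z)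

theorem Holds.step_none {x : List Bool} {t : ℕ} {k : Fin 9 × Mach} {c : interp.Cfg}
    (h : Holds x t k c) (hx : x[t]? = none) : interp.step c = none := by
  have h0 : (c.tape 0).head = none := (h.input 0).trans hx
  rw [interp_step, h0]
  rfl

theorem Holds.step_some {x : List Bool} {t : ℕ} {k : Fin 9 × Mach} {c : interp.Cfg}
    (h : Holds x t k c) {b : Bool} (hx : x[t]? = some b) :
    ∃ d, interp.step c = some d ∧ Holds x (t + 1) (bitStep k b) d := by
  have h0 : (c.tape 0).head = some b := (h.input 0).trans hx
  have h1 : (c.tape 1).head = k.2.cell k.2.pos := (h.oracle 0).trans (by rw [add_zero])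
  have hin : ∀ n : ℕ, (MultiTapeTM.act (c.tape 0) ((c.tape 0).head, some .right)).nth n = x[t + 1 + n]? := by
    intro n
    rw [MultiTapeTM.act_nth]
    have : (n : ℤ) + 1 ≠ 0 := by omega
    simp only [MultiTapeTM.displacement, this, if_false]
    have := h.input (n + 1)
    push_cast at this
    rw [this]
    congr 1
    omega
  cases b
  · refine ⟨_, by rw [interp_step, h0, h.state]; rfl, rfl, ?_, fun z => ?_⟩
    · rw [h0] at hin; exact hin
    · refine (MultiTapeTM.act_nth (Γ := Option Bool) (c.tape 1) ((c.tape 1).head, none) z).trans ?_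
      simp only [MultiTapeTM.displacement, add_zero]
      by_cases hz : z = 0
      · simp only [hz]; exact h.oracle 0
      · simp only [hz]; exact h.oracle z
  · refine ⟨_, by rw [interp_step, h0, h1, h.state]; rfl, rfl, ?_, fun z => ?_⟩
    · rw [h0] at hin; exact hin
    · refine (MultiTapeTM.act_nth (Γ := Option Bool) (c.tape 1)
        ((Op.ofIndex k.1).action (k.2.cell k.2.pos) k.2.flags) z).trans ?_
      have e : k.2.pos + (Op.ofIndex k.1).shift + z = k.2.pos + (z + (Op.ofIndex k.1).shift) := by ring
      simp only [bitStep, Op.exec, Op.displacement_action, Function.update_apply, e, add_eq_left]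
      split_ifs
      · rfl
      · exact h.oracle _

theorem holds_run (x w : List Bool) (t : ℕ) (ht : t ≤ x.length) :
    Holds x t ((x.take t).foldl bitStep (0, Mach.init w)) (interp.run x w t) := by
  induction t with
  | zero =>
    refine ⟨rfl, fun n => ?_, fun z => ?_⟩
    · refine (interp.bitTape_nth x n).trans ?_
      rw [if_pos (Int.natCast_nonneg n), Int.toNat_natCast, zero_add]
      rcases x[n]? with _ | b <;> rfl
    · refine (interp.bitTape_nth w z).trans ?_
      simp only [Mach.init, List.take_zero, List.foldl_nil, zero_add]
      split_ifs
      · rcases w[z.toNat]? with _ | b <;> rfl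
      · rfl
  | succ t ih =>
    have ih := ih (by omega)
    have hx : x[t]? = some x[t] := List.getElem?_eq_getElem (by omega)
    obtain ⟨d, hd, h⟩ := ih.step_some hx
    rw [List.take_add_one, hx, Option.toList_some, List.foldl_append]
    simp only [MultiTapeTM.run] at hd
    simp only [MultiTapeTM.run, Function.iterate_succ_apply', hd]
    exact h

/-- Every step consumes one input bit and the blank behind the input halts the machine, whatever the
oracle bits are. -/
theorem interp_haltsWithin (x w : List Bool) : interp.HaltsWithin x w x.length :=
  (holds_run x w _ le_rfl).step_none (List.getElem?_eq_none le_rfl)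

theorem interp_accepts (x w : List Bool) :
    interp.Accepts x w ↔ (x.foldl bitStep (0, Mach.init w)).2.flags.acc = true := by
  rw [LoopProg.accepts_iff (interp_haltsWithin x w)]
  have h := (holds_run x w _ le_rfl).state
  rw [List.take_length] at h
  rw [h]
  rfl

/-- The zeros count up to the index of the operation; the final one executes it and resets the
counter. -/
theorem foldl_code (o : Op) (m : Mach) : o.code.foldl bitStep (0, m) = (0, o.exec m) := by
  rcases o with _ | _ | (_ | _) | _ | (_ | _) | _ | _ <;> rfl

theorem foldl_flatMap_code (l : List Op) (m : Mach) :
    (l.flatMap Op.code).foldl bitStep (0, m) = (0, exec l m) := by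
  induction l generalizing m with
  | nil => rfl
  | cons o l ih => rw [List.flatMap_cons, List.foldl_append, foldl_code, ih]; rfl

/-- The language of the interpreter with `f(n)` oracle bits. -/
def lang (f : ℕ → ℕ) : Language Bool :=
  {x | ∃ w : List Bool, w.length = f x.length ∧ interp.Accepts x w}

/-- This is the separating language. It is defined by the machine itself, so inputs that are not
sequences of codes need no attention. -/
theorem lang_mem_NDTIME (f : ℕ → ℕ) : lang f ∈ NDTIME f fun n => (n : ℝ) :=
  ⟨interp, id, isBigO_refl _ _, fun x w _ => interp_haltsWithin x w, fun _ => Iff.rfl⟩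

theorem mem_lang_iff {f : ℕ → ℕ} {l : List Op} : l.flatMap Op.code ∈ lang f ↔
    ∃ w : List Bool, w.length = f (l.flatMap Op.code).length ∧
      (exec l (Mach.init w)).flags.acc = true := by
  have h : ∀ x, x ∈ lang f ↔ ∃ w : List Bool, w.length = f x.length ∧ interp.Accepts x w :=
    fun x => Iff.rfl
  simp only [h, interp_accepts, foldl_flatMap_code]

end TapeCode

/-! ## Programs that write operations of the interpreter -/

namespace LoopProg

open TapeCode (Op)

/-- States of a generator: variables, an array, number of inputs read, number of ticks, operations
written so far. -/
@[ext] structure Gen where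
  v : ℕ → ℤ
  fm : ℤ → ℤ
  rd : ℕ
  clk : ℕ
  out : List Op

/-- The bits written so far. -/
def Gen.bits (g : Gen) : List Bool := g.out.flatMap Op.code

variable (M : MultiTapeTM) {X : List ℤ} {B : ℕ}

/-- The representation of a state of a generator: variable `0` is the number of bits written, array
`0` contains these bits, variables from `20` on are reserved for the simulator. -/
noncomputable def Gen.conc (g : Gen) : St where
  vars x := if x = 0 then g.bits.length else if x < 20 then g.v x else 0
  arr a := if a = 0 then bitCell M g.bits else if a = M.work + 2 then g.fm else 0
  rd := g.rd
  clk := g.clk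

/-- Some execution of `c` from `g` ends in a state with the property `Q`. -/
def GWp (X : List ℤ) (B : ℕ) (c : Cmd) (Q : Gen → Prop) (g : Gen) : Prop :=
  ∃ g', Exec X B c (g.conc M) (g'.conc M) ∧ Q g'

def Gen.set (g : Gen) (x : ℕ) (u : ℤ) : Gen :=
  { g with v := Function.update g.v x u, clk := g.clk + 1 }

def Gen.tick (g : Gen) : Gen := { g with clk := g.clk + 1 }

/-! ### Rules for generators -/

variable {M} {c d : Cmd} {Q R : Gen → Prop} {g : Gen} {x y : ℕ}

theorem Gen.conc_set (hx : 0 < x ∧ x < 20) (u : ℤ) : (g.set x u).conc M = (g.conc M).set x u := by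
  ext y
  · simp only [Gen.conc, Gen.set, St.set, Gen.bits, Function.update_apply]
    by_cases hy : y = x
    · subst hy; simp [hx.2, hx.1.ne']
    · simp [hy]
  · rfl
  · rfl
  · rfl

theorem Gen.conc_vars (hx : 0 < x ∧ x < 20) : (g.conc M).vars x = g.v x := by
  simp [Gen.conc, hx.2, hx.1.ne']

theorem GWp.mono (h : GWp M X B c Q g) (hQ : ∀ g, Q g → R g) : GWp M X B c R g := by
  obtain ⟨t, h1, h2⟩ := h
  exact ⟨t, h1, hQ t h2⟩

theorem GWp.skip (h : Q g) : GWp M X B .skip Q g := ⟨g, .skip _, h⟩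

theorem GWp.seq (h : GWp M X B c (GWp M X B d Q) g) : GWp M X B (.seq c d) Q g := by
  obtain ⟨t, h1, u, h2, hQ⟩ := h
  exact ⟨u, .seq h1 h2, hQ⟩

theorem GWp.atom_of {a : Atom} {g' : Gen} (ha : a.Ok B (g.conc M))
    (he : a.eval X (g.conc M) = g'.conc M) (h : Q g') : GWp M X B (.atom a) Q g :=
  ⟨g', he ▸ .atom a _ ha, h⟩

theorem GWp.lit {u : ℤ} (hx : 0 < x ∧ x < 20) (h : Q (g.set x u)) : GWp M X B (.atom (.lit x u)) Q g :=
  .atom_of trivial (Gen.conc_set hx _).symm h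

theorem GWp.copy (hx : 0 < x ∧ x < 20) (hy : 0 < y ∧ y < 20) (h : Q (g.set x (g.v y))) :
    GWp M X B (.atom (.copy x y)) Q g :=
  .atom_of trivial (by rw [Gen.conc_set hx, Atom.eval, Gen.conc_vars hy]) h

theorem GWp.inc (hx : 0 < x ∧ x < 20) (h : Q (g.set x (g.v x + 1))) : GWp M X B (.atom (.inc x)) Q g :=
  .atom_of trivial (by rw [Gen.conc_set hx, Atom.eval, Gen.conc_vars hx]) h

theorem GWp.dec (hx : 0 < x ∧ x < 20) (h : Q (g.set x (g.v x - 1))) : GWp M X B (.atom (.dec x)) Q g :=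
  .atom_of trivial (by rw [Gen.conc_set hx, Atom.eval, Gen.conc_vars hx]) h

theorem GWp.neg (hx : 0 < x ∧ x < 20) (h : Q (g.set x (-g.v x))) : GWp M X B (.atom (.neg x)) Q g :=
  .atom_of trivial (by rw [Gen.conc_set hx, Atom.eval, Gen.conc_vars hx]) h

theorem GWp.double (hx : 0 < x ∧ x < 20) (hB : |2 * g.v x| ≤ B) (h : Q (g.set x (2 * g.v x))) :
    GWp M X B (.atom (.double x)) Q g :=
  .atom_of (by rw [Atom.Ok, Gen.conc_vars hx]; exact hB)
    (by rw [Gen.conc_set hx, Atom.eval, Gen.conc_vars hx]) h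

theorem GWp.half (hx : 0 < x ∧ x < 20) (h : Q (g.set x (g.v x / 2))) : GWp M X B (.atom (.half x)) Q g :=
  .atom_of trivial (by rw [Gen.conc_set hx, Atom.eval, Gen.conc_vars hx]) h

theorem GWp.parity (hx : 0 < x ∧ x < 20) (hy : 0 < y ∧ y < 20) (h : Q (g.set x (g.v y % 2))) :
    GWp M X B (.atom (.parity x y)) Q g :=
  .atom_of trivial (by rw [Gen.conc_set hx, Atom.eval, Gen.conc_vars hy]) h

theorem GWp.read (hx : 0 < x ∧ x < 20) (h : Q { g.set x (X.getD g.rd 0) with rd := g.rd + 1 }) :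
    GWp M X B (.atom (.read x)) Q g := by
  refine .atom_of trivial ?_ h
  have := Gen.conc_set (M := M) (g := g) hx (X.getD g.rd 0)
  rw [Atom.eval]
  simp only [Gen.conc] at this ⊢
  rw [← this]
  rfl

theorem GWp.get (hx : 0 < x ∧ x < 20) (hy : 0 < y ∧ y < 20) (h : Q (g.set x (g.fm (g.v y)))) :
    GWp M X B (.atom (.get x (M.work + 2) y)) Q g :=
  .atom_of trivial (by
    rw [Gen.conc_set hx, Atom.eval, Gen.conc_vars hy]
    congr 1
    simp [Gen.conc]) h

theorem GWp.put (hx : 0 < x ∧ x < 20) (hy : 0 < y ∧ y < 20)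
    (h : Q { g with fm := Function.update g.fm (g.v y) (g.v x), clk := g.clk + 1 }) :
    GWp M X B (.atom (.put (M.work + 2) y x)) Q g := by
  refine .atom_of trivial ?_ h
  rw [Atom.eval, Gen.conc_vars hy, Gen.conc_vars hx]
  ext a p
  · rfl
  · simp only [Gen.conc, St.setArr, Function.update_apply]
    by_cases ha : a = M.work + 2
    · subst ha; simp [Function.update_apply]
    · simp [ha, Gen.bits]
  · rfl
  · rfl

theorem GWp.ite {z : Bool} (hx : 0 < x ∧ x < 20)
    (h1 : (if z then g.v x = 0 else 0 < g.v x) → GWp M X B c Q g.tick)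
    (h2 : ¬ (if z then g.v x = 0 else 0 < g.v x) → GWp M X B d Q g.tick) :
    GWp M X B (.ite z x c d) Q g := by
  have e : (g.tick.conc M) = (g.conc M).tick := rfl
  by_cases h : if z then g.v x = 0 else 0 < g.v x
  · obtain ⟨t, k1, k2⟩ := h1 h
    exact ⟨t, .ite_true (by rwa [Gen.conc_vars hx]) (e ▸ k1), k2⟩
  · obtain ⟨t, k1, k2⟩ := h2 h
    exact ⟨t, .ite_false (by rwa [Gen.conc_vars hx]) (e ▸ k1), k2⟩

/-- The rule for loops of which the number of iterations is known. -/
theorem GWp.while (hx : 0 < x ∧ x < 20) (n k : ℕ) (I : ℕ → Gen → Prop)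
    (hI : ∀ i g t, I i g → I i { g with clk := t })
    (hpos : ∀ i g, I i g → (0 < g.v x ↔ i < n))
    (hbody : ∀ i g, i < n → I i g → GWp M X B c (fun g' => I (i + 1) g' ∧ g'.clk ≤ g.clk + k) g)
    (h0 : I 0 g) (hQ : ∀ g', I n g' → g'.clk ≤ g.clk + n * (k + 1) + 1 → Q g') :
    GWp M X B (.while x c) Q g := by
  -- The induction is on the number `m` of iterations left; their time is kept on the left-hand side
  -- to avoid subtraction.
  suffices h : ∀ m i g', i + m = n → I i g' → g'.clk + m * (k + 1) ≤ g.clk + n * (k + 1) →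
      GWp M X B (.while x c) Q g' from h n 0 g (zero_add n) h0 le_rfl
  intro m
  induction m with
  | zero =>
    intro i g' him hi hclk
    refine ⟨g'.tick, .while_done ?_, hQ _ (hI _ _ _ (by rwa [← him])) ?_⟩
    · rw [Gen.conc_vars hx, hpos i g' hi]; omega
    · simp only [Gen.tick]; omega
  | succ m ih =>
    intro i g' him hi hclk
    obtain ⟨t, h1, h2, h3⟩ := hbody i g'.tick (by omega) (hI _ _ _ hi)
    simp only [Gen.tick] at h3
    rw [add_mul, one_mul] at hclk
    obtain ⟨u, h4, h5⟩ := ih (i + 1) t (by omega) h2 (by omega)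
    exact ⟨u, .while_step (by rw [Gen.conc_vars hx, hpos i g' hi]; omega) h1 h4, h5⟩

/-- Repeat `c` as often as `x` says. -/
def forLoop (x : ℕ) (c : Cmd) : Cmd := .while x (.seq c (.atom (.dec x)))

/-- The rule itself follows the counter, so the invariant must be insensitive to the counter and the
clock, and the body must leave the counter alone. -/
theorem GWp.forLoop (hx : 0 < x ∧ x < 20) (n k : ℕ) (I : ℕ → Gen → Prop)
    (hI : ∀ i g u t, I i g → I i { g with v := Function.update g.v x u, clk := t })
    (hbody : ∀ i g, i < n → I i g →
      GWp M X B c (fun g' => I (i + 1) g' ∧ g'.v x = g.v x ∧ g'.clk ≤ g.clk + k) g)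
    (h0 : I 0 g) (hn : g.v x = n) (hQ : ∀ g', I n g' → g'.clk ≤ g.clk + n * (k + 2) + 1 → Q g') :
    GWp M X B (forLoop x c) Q g := by
  refine GWp.while hx n (k + 1) (fun i g => I i g ∧ g.v x = n - i ∧ i ≤ n) ?_ ?_ ?_
    ⟨h0, by simp [hn], by omega⟩ (fun g' h => hQ g' h.1)
  · rintro i g t ⟨h1, h2⟩
    refine ⟨?_, h2⟩
    have := hI i g (g.v x) t h1
    rwa [Function.update_eq_self] at this
  · rintro i g ⟨-, h2, h3⟩
    rw [h2]; omega
  · rintro i g hi ⟨h1, h2, -⟩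
    refine GWp.seq ((hbody i g hi h1).mono fun g' ⟨k1, k2, k3⟩ => GWp.dec hx ⟨⟨hI _ _ _ _ k1, ?_, hi⟩, ?_⟩)
    · simp only [Gen.set, Function.update_self, k2, h2]; push_cast; ring
    · simp only [Gen.set]; omega

/-! ### Writing operations -/

/-- Write a bit. -/
noncomputable def emitBit (M : MultiTapeTM) (b : Bool) : Cmd :=
  .seq (.atom (.putLit 0 0 (symCode M (some (M.bit b))))) (.atom (.inc 0))

noncomputable def emitBits (M : MultiTapeTM) : List Bool → Cmd
  | [] => .skip
  | b :: l => .seq (emitBit M b) (emitBits M l)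

/-- Write a sequence of operations. -/
noncomputable def emits (M : MultiTapeTM) : List Op → Cmd
  | [] => .skip
  | o :: l => .seq (emitBits M o.code) (emits M l)

/-- The representation of a state with the bits `y`. -/
noncomputable def Gen.concBits (M : MultiTapeTM) (g : Gen) (y : List Bool) (t : ℕ) : St where
  vars x := if x = 0 then y.length else if x < 20 then g.v x else 0
  arr a := if a = 0 then bitCell M y else if a = M.work + 2 then g.fm else 0
  rd := g.rd
  clk := t

/-- Variable `0` is both the number of bits written and the position of the next free cell. Thus
array `0` is at any time the initial input tape of the simulated machine. -/
theorem exec_emitBit (g : Gen) (y : List Bool) (t : ℕ) (b : Bool) :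
    Exec X B (emitBit M b) (g.concBits M y t) (g.concBits M (y ++ [b]) (t + 2)) := by
  refine .seq (.atom _ _ trivial) ?_
  have := Exec.atom (X := X) (B := B) (.inc 0)
    ((Atom.putLit 0 0 (symCode M (some (M.bit b)))).eval X (g.concBits M y t)) trivial
  convert this using 1
  ext a p
  · simp only [Gen.concBits, Atom.eval, St.set, St.setArr, Function.update_apply]
    split_ifs <;> simp
  · simp only [Gen.concBits, Atom.eval, St.set, St.setArr, Function.update_apply]
    by_cases ha : a = 0
    · subst ha
      simp only [if_true, bitCell, Function.update_apply]
      by_cases hp : p = y.length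
      · subst hp; simp
      · simp only [hp, if_false]
        split_ifs with h0
        · by_cases hlt : p.toNat < y.length
          · rw [List.getElem?_append_left hlt]
          · rw [List.getElem?_eq_none (by simp; omega), List.getElem?_eq_none (by omega)]
        · rfl
    · simp [ha]
  · rfl
  · rfl

theorem exec_emitBits (g : Gen) (l y : List Bool) (t : ℕ) :
    Exec X B (emitBits M l) (g.concBits M y t) (g.concBits M (y ++ l) (t + 2 * l.length)) := by
  induction l generalizing y t with
  | nil => simpa [emitBits] using Exec.skip _
  | cons b l ih =>
    refine .seq (exec_emitBit g y t b) ?_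
    convert ih (y ++ [b]) (t + 2) using 2
    · simp
    · simp only [List.length_cons]; ring

/-- An operation has at most nine bits, and each bit takes two ticks. -/
theorem GWp.emits (l : List Op)
    (h : ∀ t ≤ g.clk + 18 * l.length, Q { g with out := g.out ++ l, clk := t }) :
    GWp M X B (emits M l) Q g := by
  induction l generalizing g with
  | nil =>
    refine GWp.skip ?_
    have := h g.clk (by simp)
    rwa [List.append_nil] at this
  | cons o l ih =>
    refine GWp.seq ⟨{ g with out := g.out ++ [o], clk := g.clk + 2 * o.code.length }, ?_,
      ih fun t ht => ?_⟩
    · have := exec_emitBits (M := M) (X := X) (B := B) g o.code g.bits g.clk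
      convert this using 1 <;> simp only [Gen.conc, Gen.concBits, Gen.bits, List.flatMap_append, List.flatMap_cons, List.flatMap_nil,
        List.append_nil]
    · have h9 := o.length_code_le
      have := h t (by simp only [List.length_cons] at ht ⊢; omega)
      simpa using this

theorem GWp.forEmit (hx : 0 < x ∧ x < 20) (n : ℕ) (hn : g.v x = n) (l : List Op)
    (h : ∀ t ≤ g.clk + n * (18 * l.length + 2) + 1,
      Q { g with v := Function.update g.v x 0, out := g.out ++ (List.replicate n l).flatten, clk := t }) :
    GWp M X B (LoopProg.forLoop x (LoopProg.emits M l)) Q g := by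
  refine GWp.while hx n (18 * l.length + 1) (fun i g' => i ≤ n ∧ ∃ t, g' = { g with
    v := Function.update g.v x (n - i), out := g.out ++ (List.replicate i l).flatten, clk := t }) ?_ ?_ ?_ ?_ ?_
  · rintro i _ t ⟨hi, u, rfl⟩
    exact ⟨hi, t, rfl⟩
  · rintro i _ ⟨hi, u, rfl⟩
    simp
  · rintro i _ hi ⟨-, u, rfl⟩
    refine GWp.seq (GWp.emits l fun t ht => GWp.dec hx ⟨⟨hi, t + 1, ?_⟩, ?_⟩)
    · simp only [Gen.set, Function.update_self, Function.update_idem, List.append_assoc]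
      congr 2
      · push_cast; ring
      · rw [List.replicate_succ', List.flatten_append]; simp
    · simp only [Gen.set] at ht ⊢; omega
  · refine ⟨by omega, g.clk, ?_⟩
    simp [← hn]
  · rintro _ ⟨-, t, rfl⟩ ht
    have := h t ht
    simpa using this

end LoopProg

/-! ## Orthogonal vectors -/

namespace TapeCode

/-! ### Effects of single operations and of head movements -/

theorem exec_append (l l' : List Op) (m : Mach) : exec (l ++ l') m = exec l' (exec l m) :=
  List.foldl_append

theorem exec_cons (o : Op) (l : List Op) (m : Mach) : exec (o :: l) m = exec l (o.exec m) := rfl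

theorem exec_nil (m : Mach) : exec [] m = m := rfl

theorem exec_right (m : Mach) : Op.right.exec m = { m with pos := m.pos + 1 } := by
  simp [Op.exec, Op.flags, Op.shift, Op.action]

theorem exec_left (m : Mach) : Op.left.exec m = { m with pos := m.pos - 1 } := by
  simp [Op.exec, Op.flags, Op.shift, Op.action, sub_eq_add_neg]

theorem exec_test (m : Mach) (b : Bool) : (Op.test b).exec m =
    { m with flags := { m.flags with hit := m.flags.hit || ((m.cell m.pos == some true) == b) } } := by
  simp [Op.exec, Op.flags, Op.shift, Op.action]

theorem exec_endClause (m : Mach) : Op.endClause.exec m =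
    { m with flags := { m.flags with ok := m.flags.ok && m.flags.hit, hit := false } } := by
  simp [Op.exec, Op.flags, Op.shift, Op.action]

theorem exec_write (m : Mach) (b : Bool) : (Op.write b).exec m =
    { m with cell := if m.flags.ok then Function.update m.cell m.pos (some b) else m.cell } := by
  rcases m with ⟨⟨h, _ | _, f, a⟩, p, c⟩ <;> simp [Op.exec, Op.flags, Op.shift, Op.action]

theorem exec_enable (m : Mach) : Op.enable.exec m =
    { m with flags := ⟨false, true, m.flags.found || m.flags.ok, m.flags.acc⟩ } := by
  simp [Op.exec, Op.flags, Op.shift, Op.action]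

theorem exec_endFormula (m : Mach) : Op.endFormula.exec m =
    { m with flags := ⟨false, true, m.flags.found, m.flags.acc || (m.flags.ok && m.flags.found)⟩ } := by
  simp [Op.exec, Op.flags, Op.shift, Op.action]

theorem exec_rights (n : ℕ) (m : Mach) :
    exec (List.replicate n [Op.right]).flatten m = { m with pos := m.pos + n } := by
  induction n generalizing m with
  | zero => simp [exec_nil]
  | succ n ih =>
    rw [List.replicate_succ, List.flatten_cons, exec_append, ih, exec_cons, exec_nil, exec_right]
    simp only [Mach.mk.injEq, true_and, and_true]
    push_cast; ring

theorem exec_lefts (n : ℕ) (m : Mach) :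
    exec (List.replicate n [Op.left]).flatten m = { m with pos := m.pos - n } := by
  induction n generalizing m with
  | zero => simp [exec_nil]
  | succ n ih =>
    rw [List.replicate_succ, List.flatten_cons, exec_append, ih, exec_cons, exec_nil, exec_left]
    simp only [Mach.mk.injEq, true_and, and_true]
    push_cast; ring

theorem exec_lefts₂ (n : ℕ) (m : Mach) :
    exec (List.replicate n [Op.left, Op.left]).flatten m = { m with pos := m.pos - 2 * n } := by
  induction n generalizing m with
  | zero => simp [exec_nil]
  | succ n ih =>
    rw [List.replicate_succ, List.flatten_cons, exec_append, ih, exec_cons, exec_cons, exec_nil, exec_left,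
      exec_left]
    simp only [Mach.mk.injEq, true_and, and_true]
    push_cast; ring

/-! ### Operation sequences for orthogonal vectors -/

/-- Compare the bits from the present position on with the binary digits of `i`. -/
def labelOps (i D : ℕ) : List Op :=
  (List.range D).flatMap fun t => [.test (i.testBit t), .endClause, .right]

/-- Write a vector. -/
def vecOps (a : ℕ → Bool) (D : ℕ) : List Op := (List.range D).flatMap fun t => [.write (a t), .right]

/-- Test orthogonality with a vector. -/
def orthOps (b : ℕ → Bool) (D : ℕ) : List Op :=
  (List.range D).flatMap fun t => if b t then [.test false, .endClause, .right] else [.right]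

/-- If the oracle bits are the digits of `i`, write the vector `a` behind them. -/
def storeOps (D i : ℕ) (a : ℕ → Bool) : List Op :=
  labelOps i D ++ vecOps a D ++ (List.replicate D [Op.left, Op.left]).flatten ++ [.enable]

/-- Test orthogonality of the stored vector and `b`. -/
def compareOps (D : ℕ) (b : ℕ → Bool) : List Op :=
  (List.replicate D [Op.right]).flatten ++ orthOps b D ++ (List.replicate D [Op.left, Op.left]).flatten ++
    [.endFormula]

/-- The operations for an instance of the orthogonal vectors problem. -/
def ovOps (N D : ℕ) (A B : ℕ → ℕ → Bool) : List Op :=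
  (List.range N).flatMap (fun i => storeOps D i (A i)) ++ (List.range N).flatMap fun j => compareOps D (B j)

/-- Every digit is a clause with one test, so `ok` survives exactly when all digits agree. A blank
cell counts as the digit zero. -/
theorem exec_labelOps (i D : ℕ) (m : Mach) (hm : m.flags.hit = false) : exec (labelOps i D) m =
    { m with
      pos := m.pos + D
      flags := { m.flags with
        ok := m.flags.ok && decide (∀ t < D, (m.cell (m.pos + t) == some true) = i.testBit t) } } := by
  induction D with
  | zero =>
    rcases m with ⟨⟨h, o, f, a⟩, p, c⟩
    simp [labelOps, exec_nil]
  | succ D ih =>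
    have : labelOps i (D + 1) = labelOps i D ++ [.test (i.testBit D), .endClause, .right] := by
      simp [labelOps, List.range_succ]
    rw [this, exec_append, ih]
    simp only [exec_cons, exec_nil, exec_test, exec_endClause, exec_right, hm, Bool.false_or, Mach.mk.injEq,
      Flags.mk.injEq, true_and, and_true]
    refine ⟨?_, by push_cast; ring⟩
    rw [Bool.and_assoc]
    congr 1
    rw [Bool.eq_iff_iff]
    simp only [Bool.and_eq_true, decide_eq_true_eq, beq_iff_eq, Nat.lt_succ_iff_lt_or_eq, or_imp, forall_and,
      forall_eq]

/-- Writing takes effect only under `ok`, so a vector behind a wrong label leaves the tape as it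
was, while the head moves in any case. -/
theorem exec_vecOps (a : ℕ → Bool) (D : ℕ) (m : Mach) : exec (vecOps a D) m =
    { m with
      pos := m.pos + D
      cell := fun p => if m.flags.ok ∧ m.pos ≤ p ∧ p < m.pos + D then some (a (p - m.pos).toNat)
        else m.cell p } := by
  induction D with
  | zero =>
    rcases m with ⟨f, p, c⟩
    simp only [vecOps, List.range_zero, List.flatMap_nil, exec_nil, Nat.cast_zero, add_zero, Mach.mk.injEq, true_and]
    funext q
    rw [if_neg (by omega)]
  | succ D ih =>
    have : vecOps a (D + 1) = vecOps a D ++ [.write (a D), .right] := by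
      simp [vecOps, List.range_succ]
    rw [this, exec_append, ih]
    simp only [exec_cons, exec_nil, exec_write, exec_right, Mach.mk.injEq, true_and]
    refine ⟨by push_cast; ring, ?_⟩
    funext p
    by_cases hok : m.flags.ok = true
    · simp only [hok, if_true, true_and, Function.update_apply]
      push_cast
      by_cases hp : p = m.pos + D
      · subst hp
        simp
      · have : p < m.pos + (D + 1) ↔ p < m.pos + D := by omega
        simp only [hp, if_false, this]
    · simp [hok]

/-- Only the coordinates where `b` is one impose a condition: there the stored bit has to be zero.
-/
theorem exec_orthOps (b : ℕ → Bool) (D : ℕ) (m : Mach) (hm : m.flags.hit = false) :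
    exec (orthOps b D) m =
    { m with
      pos := m.pos + D
      flags := { m.flags with
        ok := m.flags.ok && decide (∀ t < D, b t → (m.cell (m.pos + t) == some true) = false) } } := by
  induction D with
  | zero =>
    rcases m with ⟨⟨h, o, f, a⟩, p, c⟩
    simp [orthOps, exec_nil]
  | succ D ih =>
    have : orthOps b (D + 1) = orthOps b D ++ if b D then [.test false, .endClause, .right] else [.right] := by
      simp [orthOps, List.range_succ]
    rw [this, exec_append, ih]
    by_cases hb : b D = true
    · simp only [hb, if_true, exec_cons, exec_nil, exec_test, exec_endClause, exec_right, hm, Bool.false_or,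
        Mach.mk.injEq, Flags.mk.injEq, true_and, and_true]
      refine ⟨?_, by push_cast; ring⟩
      rw [Bool.and_assoc]
      congr 1
      rw [Bool.eq_iff_iff]
      simp only [Bool.and_eq_true, decide_eq_true_eq, beq_iff_eq, Nat.lt_succ_iff_lt_or_eq, or_imp, forall_and,
        forall_eq, hb, forall_const]
    · rw [Bool.not_eq_true] at hb
      simp only [hb, Bool.false_eq_true, if_false, exec_cons, exec_nil, exec_right, Mach.mk.injEq, Flags.mk.injEq, true_and, and_true]
      refine ⟨?_, by push_cast; ring⟩
      congr 1
      rw [Bool.eq_iff_iff]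
      simp only [decide_eq_true_eq, Nat.lt_succ_iff_lt_or_eq, or_imp, forall_and, forall_eq, hb]
      simp

/-- The first `D` oracle bits, read as a binary number, are `i`. -/
def Matches (D : ℕ) (c : ℤ → Option Bool) (i : ℕ) : Prop :=
  ∀ t < D, (c t == some true) = i.testBit t

/-- At most one label matches, so a vector once stored is never overwritten. -/
theorem Matches.unique {D : ℕ} {c : ℤ → Option Bool} {i j : ℕ} (hi : i < 2 ^ D) (hj : j < 2 ^ D)
    (h : Matches D c i) (h' : Matches D c j) : i = j := by
  apply Nat.eq_of_testBit_eq
  intro t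
  by_cases ht : t < D
  · rw [← h t ht, h' t ht]
  · rw [Nat.testBit_eq_false_of_lt (hi.trans_le (Nat.pow_le_pow_right (by norm_num) (not_lt.1 ht))),
      Nat.testBit_eq_false_of_lt (hj.trans_le (Nat.pow_le_pow_right (by norm_num) (not_lt.1 ht)))]

open Classical in
-- Label and vector both have length `D`, so the head returns to the origin by `D` double moves. The
-- final `enable` records the match in `found` and restores `ok`.
theorem exec_storeOps (D i : ℕ) (a : ℕ → Bool) (m : Mach) (hm : m.flags.hit = false) (hok : m.flags.ok = true)
    (hp : m.pos = 0) : exec (storeOps D i a) m =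
      { m with
        flags := { m.flags with found := m.flags.found || decide (Matches D m.cell i) }
        cell := fun p => if Matches D m.cell i ∧ (D : ℤ) ≤ p ∧ p < D + D then some (a (p - D).toNat)
          else m.cell p } := by
  rcases m with ⟨⟨h, o, f, e⟩, p, c⟩
  simp only at hm hok hp
  subst hm hok hp
  simp only [storeOps, exec_append, exec_labelOps, exec_vecOps, exec_lefts₂, exec_cons, exec_nil, exec_enable,
    Mach.mk.injEq, Flags.mk.injEq, true_and, and_true, zero_add, Bool.true_and]
  refine ⟨?_, by ring, ?_⟩
  · congr 1
    exact decide_eq_decide.2 Iff.rfl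
  · funext p
    simp only [Matches, decide_eq_true_eq]
    congr

open Classical in
-- Vectors are written from cell `D` on, so the label in front of them stays intact; by uniqueness
-- the vector of the matching index survives. Surplus oracle bits may stand in those cells
-- beforehand and are harmless: without a match `found` is false and nothing is accepted later.
theorem exec_stores (D n : ℕ) (A : ℕ → ℕ → Bool) (hn : n ≤ 2 ^ D) (m : Mach) (hm : m.flags.hit = false)
    (hok : m.flags.ok = true) (hf : m.flags.found = false) (hp : m.pos = 0) :
    ∃ c, exec ((List.range n).flatMap fun i => storeOps D i (A i)) m =
      { m with
        flags := { m.flags with found := decide (∃ i < n, Matches D m.cell i) }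
        cell := c } ∧ (∀ i, Matches D c i ↔ Matches D m.cell i) ∧
      ∀ i < n, Matches D m.cell i → ∀ t < D, c (D + t) = some (A i t) := by
  induction n with
  | zero =>
    refine ⟨m.cell, ?_, fun _ => Iff.rfl, by simp⟩
    rcases m with ⟨⟨h, o, f, e⟩, p, c⟩
    simp only at hf
    simp [exec_nil, hf]
  | succ n ih =>
    obtain ⟨c, h1, h2, h3⟩ := ih (by omega)
    refine ⟨fun p => if Matches D c n ∧ (D : ℤ) ≤ p ∧ p < D + D then some (A n (p - D).toNat) else c p,
      ?_, ?_, ?_⟩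
    · rw [List.range_succ, List.flatMap_append, exec_append, h1, List.flatMap_singleton,
        exec_storeOps _ _ _ _ (by exact hm) (by exact hok) (by exact hp)]
      simp only [Mach.mk.injEq, Flags.mk.injEq, true_and, and_true]
      rw [Bool.eq_iff_iff]
      simp only [Bool.or_eq_true, decide_eq_true_eq, h2, Nat.lt_succ_iff_lt_or_eq, or_and_right, exists_or,
        exists_eq_left]
    · intro i
      rw [← h2]
      refine forall₂_congr fun t ht => ?_
      beta_reduce
      rw [if_neg]
      rintro ⟨-, h, -⟩
      omega
    · intro i hi hmi t ht
      simp only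
      by_cases hin : i = n
      · subst hin
        rw [if_pos ⟨(h2 i).2 hmi, by omega, by omega⟩]
        congr 2
        omega
      · rw [if_neg]
        · exact h3 i (by omega) hmi t ht
        · rintro ⟨h, -⟩
          exact hin (Matches.unique (by omega) (by omega) hmi ((h2 n).1 h))

open Classical in
-- Each block restores `ok` and the head position and leaves the tape unchanged, so the blocks are
-- independent and `acc` is the disjunction of their results.
theorem exec_compares (D n : ℕ) (B : ℕ → ℕ → Bool) (m : Mach) (hm : m.flags.hit = false)
    (hok : m.flags.ok = true) (hacc : m.flags.acc = false) (hp : m.pos = 0) :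
    exec ((List.range n).flatMap fun j => compareOps D (B j)) m =
      { m with flags := { m.flags with acc := decide (m.flags.found = true ∧
          ∃ j < n, ∀ t < D, B j t → (m.cell (D + t) == some true) = false) } } := by
  rcases m with ⟨⟨h, o, f, e⟩, p, c⟩
  simp only at hm hok hp hacc
  subst hm hok hp hacc
  induction n with
  | zero => simp [exec_nil]
  | succ n ih =>
    rw [List.range_succ, List.flatMap_append, exec_append, ih, List.flatMap_singleton]
    simp only [compareOps, exec_append, exec_rights, exec_orthOps, exec_lefts₂, exec_cons, exec_nil,
      exec_endFormula, Mach.mk.injEq, Flags.mk.injEq, true_and, and_true, zero_add, Bool.true_and]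
    refine ⟨?_, by ring⟩
    rw [Bool.eq_iff_iff]
    simp only [Bool.or_eq_true, Bool.and_eq_true, decide_eq_true_eq, Nat.lt_succ_iff_lt_or_eq, or_and_right,
      exists_or, exists_eq_left, and_or_left]
    exact or_congr_right and_comm

theorem exec_ovOps (N D : ℕ) (A B : ℕ → ℕ → Bool) (hN : N ≤ 2 ^ D) (w : List Bool) :
    (exec (ovOps N D A B) (Mach.init w)).flags.acc = true ↔
      ∃ i < N, Matches D (Mach.init w).cell i ∧ ∃ j < N, ∀ t < D, B j t → A i t = false := by
  classical
  obtain ⟨c, h1, -, h3⟩ := exec_stores D N A hN (Mach.init w) rfl rfl rfl rfl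
  rw [ovOps, exec_append, h1, exec_compares _ _ _ _ rfl rfl rfl rfl]
  simp only [decide_eq_true_eq]
  constructor
  · rintro ⟨⟨i, hi, hmi⟩, j, hj, h⟩
    refine ⟨i, hi, hmi, j, hj, fun t ht hb => ?_⟩
    have := h t ht hb
    rw [h3 i hi hmi t ht] at this
    simpa using this
  · rintro ⟨i, hi, hmi, j, hj, h⟩
    refine ⟨⟨i, hi, hmi⟩, j, hj, fun t ht hb => ?_⟩
    rw [h3 i hi hmi t ht, h t ht hb]
    rfl

/-- The hypothesis `hf` makes every index expressible by the oracle bits. There may be fewer than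
`D` of them, since missing digits read as zero. -/
theorem ovOps_mem_lang {f : ℕ → ℕ} {N D : ℕ} {A B : ℕ → ℕ → Bool} (hN : N ≤ 2 ^ D)
    (hf : N ≤ 2 ^ f ((ovOps N D A B).flatMap Op.code).length) :
    (ovOps N D A B).flatMap Op.code ∈ lang f ↔
      ∃ i < N, ∃ j < N, ∀ t < D, B j t → A i t = false := by
  rw [mem_lang_iff]
  simp only [exec_ovOps N D A B hN]
  constructor
  · rintro ⟨w, -, i, hi, -, h⟩
    exact ⟨i, hi, h⟩
  · rintro ⟨i, hi, h⟩
    refine ⟨(List.range _).map i.testBit, by rw [List.length_map, List.length_range], i, hi, fun t ht => ?_, h⟩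
    simp only [Mach.init, Int.natCast_nonneg, if_true, Int.toNat_natCast, List.getElem?_map]
    by_cases hl : t < f ((ovOps N D A B).flatMap Op.code).length
    · rw [List.getElem?_range hl]
      simp
    -- Behind the oracle bits the tape is blank, and the digits of `i` vanish as well.
    · rw [List.getElem?_eq_none (by simpa using hl), Nat.testBit_eq_false_of_lt]
      · rfl
      · exact (hi.trans_le hf).trans_le (Nat.pow_le_pow_right (by norm_num) (not_lt.1 hl))

end TapeCode

/-! ### The generator for orthogonal vectors -/

namespace LoopProg

open TapeCode

variable {M : MultiTapeTM} {X : List ℤ} {B : ℕ}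

/-- Write one of two sequences of operations, according to whether `x` is zero. -/
noncomputable def emitIf (M : MultiTapeTM) (x : ℕ) (l l' : List Op) : Cmd :=
  .ite true x (emits M l) (emits M l')

theorem GWp.emitIf {Q : Gen → Prop} {g : Gen} {x : ℕ} (hx : 0 < x ∧ x < 20) {l l' : List Op} {k : ℕ}
    (hl : l.length ≤ k) (hl' : l'.length ≤ k) (h : ∀ t ≤ g.clk + 18 * k + 1,
      Q { g with out := g.out ++ (if g.v x = 0 then l else l'), clk := t }) :
    GWp M X B (LoopProg.emitIf M x l l') Q g := by
  refine GWp.ite hx (fun h0 => GWp.emits _ fun t ht => ?_) (fun h0 => GWp.emits _ fun t ht => ?_)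
  · simp only [if_true] at h0
    have := h t (by simp only [Gen.tick] at ht; omega)
    rwa [if_pos h0] at this
  · simp only [if_true] at h0
    have := h t (by simp only [Gen.tick] at ht; omega)
    rwa [if_neg h0] at this

/-- The initial state of a generator. -/
def Gen.zero : Gen := ⟨fun _ => 0, fun _ => 0, 0, 0, []⟩

/-- The generator for the orthogonal vectors problem: `2`, `3` hold `N`, `D`; `4` is the index of the
vector, `5` its remaining digits, `6` a bit, `7` and `8` count. -/
noncomputable def ovGen (M : MultiTapeTM) : Cmd :=
  .seq (.atom (.read 2)) <| .seq (.atom (.read 3)) <|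
  .seq (.atom (.copy 8 2)) <| .seq (forLoop 8 <|
    .seq (.atom (.copy 5 4)) <|
    .seq (.atom (.copy 7 3)) <| .seq (forLoop 7 <|
      .seq (.atom (.parity 6 5)) <| .seq (.atom (.half 5)) <|
        emitIf M 6 [.test false, .endClause, .right] [.test true, .endClause, .right]) <|
    .seq (.atom (.copy 7 3)) <| .seq (forLoop 7 <|
      .seq (.atom (.read 6)) <| emitIf M 6 [.write false, .right] [.write true, .right]) <|
    .seq (.atom (.copy 7 3)) <| .seq (forLoop 7 <| emits M [.left, .left]) <|
    .seq (emits M [.enable]) <| .atom (.inc 4)) <|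
  .seq (.atom (.copy 8 2)) <| forLoop 8 <|
    .seq (.atom (.copy 7 3)) <| .seq (forLoop 7 <| emits M [.right]) <|
    .seq (.atom (.copy 7 3)) <| .seq (forLoop 7 <|
      .seq (.atom (.read 6)) <| emitIf M 6 [.right] [.test false, .endClause, .right]) <|
    .seq (.atom (.copy 7 3)) <| .seq (forLoop 7 <| emits M [.left, .left]) <|
    emits M [.endFormula]

theorem labelOps_succ (i D : ℕ) :
    labelOps i (D + 1) = labelOps i D ++ [.test (i.testBit D), .endClause, .right] := by
  simp [labelOps, List.range_succ]

theorem vecOps_succ (a : ℕ → Bool) (D : ℕ) : vecOps a (D + 1) = vecOps a D ++ [.write (a D), .right] := by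
  simp [vecOps, List.range_succ]

theorem orthOps_succ (b : ℕ → Bool) (D : ℕ) : orthOps b (D + 1) =
    orthOps b D ++ if b D then [.test false, .endClause, .right] else [.right] := by
  simp [orthOps, List.range_succ]

/-- Writing the comparison of the oracle bits with the digits of `i`. -/
theorem GWp.label {Q : Gen → Prop} {g : Gen} (i D : ℕ) (h5 : g.v 5 = i) (h7 : g.v 7 = D)
    (h : ∀ v' t, (∀ x, x ≠ 5 → x ≠ 6 → x ≠ 7 → v' x = g.v x) → t ≤ g.clk + D * 59 + 1 →
      Q { g with v := v', out := g.out ++ labelOps i D, clk := t }) :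
    GWp M X B (LoopProg.forLoop 7 <| .seq (.atom (.parity 6 5)) <| .seq (.atom (.half 5)) <|
        LoopProg.emitIf M 6 [.test false, .endClause, .right] [.test true, .endClause, .right]) Q g := by
  -- Variable `5` holds the quotient `i / 2 ^ j`, whose parity is the next digit. The time is two
  -- ticks for the digit and $18\cdot 3+1$ for writing.
  refine GWp.forLoop (by norm_num) D 57 (fun j g' => g'.v 5 = (i / 2 ^ j : ℕ) ∧
    ∃ v' t, (∀ x, x ≠ 5 → x ≠ 6 → x ≠ 7 → v' x = g.v x) ∧
      g' = { g with v := v', out := g.out ++ labelOps i j, clk := t }) ?_ ?_ ?_ h7 ?_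
  · rintro j _ u t ⟨h1, v', t', h2, rfl⟩
    refine ⟨by simpa using h1, _, t, fun x h5 h6 h7 => ?_, rfl⟩
    simp [h7, h2 x h5 h6 h7]
  · rintro j _ - ⟨h1, v', t', h2, rfl⟩
    simp only at h1
    refine GWp.seq (GWp.parity (by norm_num) (by norm_num) (GWp.seq (GWp.half (by norm_num)
      (GWp.emitIf (k := 3) (by norm_num) (by simp) (by simp) fun t ht =>
        ⟨⟨?_, Function.update (Function.update v' 6 (v' 5 % 2)) 5 (v' 5 / 2), t, ?_, ?_⟩, ?_, ?_⟩))))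
    · simp [Gen.set, h1, pow_succ, ← Nat.div_div_eq_div_mul]
    · intro x h5 h6 h7
      simp [h5, h6, h2 x h5 h6 h7]
    · simp only [Gen.set, List.append_assoc, labelOps_succ, Nat.testBit_eq_decide_div_mod_eq]
      have e : (v' 5 % 2 = 0) ↔ ¬ (i / 2 ^ j % 2 = 1) := by rw [h1]; omega
      by_cases hb : i / 2 ^ j % 2 = 1
      · simp [hb, e]
      · simp [hb, e]
    · simp [Gen.set]
    · simp only [Gen.set] at ht ⊢; omega
  · exact ⟨by simp [h5], g.v, g.clk, fun _ _ _ _ => rfl, by simp [labelOps]⟩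
  · rintro _ ⟨-, v', t, h2, rfl⟩ ht
    exact h v' t h2 ht

/-- Reading a vector and writing it on the oracle tape. -/
theorem GWp.vec {Q : Gen → Prop} {g : Gen} (a : ℕ → Bool) (D : ℕ) (h7 : g.v 7 = D)
    (hX : ∀ t < D, X.getD (g.rd + t) 0 = bitVal (a t))
    (h : ∀ v' t, (∀ x, x ≠ 6 → x ≠ 7 → v' x = g.v x) → t ≤ g.clk + D * 40 + 1 →
      Q { g with v := v', out := g.out ++ vecOps a D, rd := g.rd + D, clk := t }) :
    GWp M X B (LoopProg.forLoop 7 <| .seq (.atom (.read 6)) <|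
      LoopProg.emitIf M 6 [.write false, .right] [.write true, .right]) Q g := by
  refine GWp.forLoop (by norm_num) D 38 (fun j g' =>
    ∃ v' t, (∀ x, x ≠ 6 → x ≠ 7 → v' x = g.v x) ∧
      g' = { g with v := v', out := g.out ++ vecOps a j, rd := g.rd + j, clk := t }) ?_ ?_ ?_ h7 ?_
  · rintro j _ u t ⟨v', t', h2, rfl⟩
    refine ⟨_, t, fun x h6 h7 => ?_, rfl⟩
    simp [h7, h2 x h6 h7]
  · rintro j _ hj ⟨v', t', h2, rfl⟩
    refine GWp.seq (GWp.read (by norm_num)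
      (GWp.emitIf (k := 2) (by norm_num) (by simp) (by simp) fun t ht =>
        ⟨⟨Function.update v' 6 (X.getD (g.rd + j) 0), t, ?_, ?_⟩, ?_, ?_⟩))
    · intro x h6 h7
      simp [h6, h2 x h6 h7]
    · simp only [Gen.set, List.append_assoc, vecOps_succ, hX j hj, Function.update_self, Gen.mk.injEq, true_and,
        add_assoc]
      cases a j <;> simp [bitVal]
    · simp [Gen.set]
    · simp only [Gen.set] at ht ⊢; omega
  · exact ⟨g.v, g.clk, fun _ _ _ => rfl, by simp [vecOps]⟩
  · rintro _ ⟨v', t, h2, rfl⟩ ht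
    exact h v' t h2 ht

/-- Reading a vector and writing the test of orthogonality. -/
theorem GWp.orth {Q : Gen → Prop} {g : Gen} (b : ℕ → Bool) (D : ℕ) (h7 : g.v 7 = D)
    (hX : ∀ t < D, X.getD (g.rd + t) 0 = bitVal (b t))
    (h : ∀ v' t, (∀ x, x ≠ 6 → x ≠ 7 → v' x = g.v x) → t ≤ g.clk + D * 58 + 1 →
      Q { g with v := v', out := g.out ++ orthOps b D, rd := g.rd + D, clk := t }) :
    GWp M X B (LoopProg.forLoop 7 <| .seq (.atom (.read 6)) <|
      LoopProg.emitIf M 6 [.right] [.test false, .endClause, .right]) Q g := by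
  refine GWp.forLoop (by norm_num) D 56 (fun j g' =>
    ∃ v' t, (∀ x, x ≠ 6 → x ≠ 7 → v' x = g.v x) ∧
      g' = { g with v := v', out := g.out ++ orthOps b j, rd := g.rd + j, clk := t }) ?_ ?_ ?_ h7 ?_
  · rintro j _ u t ⟨v', t', h2, rfl⟩
    refine ⟨_, t, fun x h6 h7 => ?_, rfl⟩
    simp [h7, h2 x h6 h7]
  · rintro j _ hj ⟨v', t', h2, rfl⟩
    refine GWp.seq (GWp.read (by norm_num)
      (GWp.emitIf (k := 3) (by norm_num) (by simp) (by simp) fun t ht =>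
        ⟨⟨Function.update v' 6 (X.getD (g.rd + j) 0), t, ?_, ?_⟩, ?_, ?_⟩))
    · intro x h6 h7
      simp [h6, h2 x h6 h7]
    · simp only [Gen.set, List.append_assoc, orthOps_succ, hX j hj, Function.update_self, Gen.mk.injEq, true_and,
        add_assoc]
      cases b j <;> simp [bitVal]
    · simp [Gen.set]
    · simp only [Gen.set] at ht ⊢; omega
  · exact ⟨g.v, g.clk, fun _ _ _ => rfl, by simp [orthOps]⟩
  · rintro _ ⟨v', t, h2, rfl⟩ ht
    exact h v' t h2 ht

theorem gwp_ovGen (N D : ℕ) (A' B' : ℕ → ℕ → Bool) (h0 : X.getD 0 0 = N) (h1 : X.getD 1 0 = D)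
    (hA : ∀ i < N, ∀ t < D, X.getD (2 + i * D + t) 0 = bitVal (A' i t))
    (hB : ∀ j < N, ∀ t < D, X.getD (2 + N * D + j * D + t) 0 = bitVal (B' j t)) :
    GWp M X B (ovGen M) (fun g => g.out = ovOps N D A' B' ∧ g.clk ≤ 500 * (N + 1) * (D + 1)) Gen.zero := by
  -- Per coordinate, $137=59+40+38$: the label, the vector and the double move back.
  refine GWp.seq (GWp.read (by norm_num) (GWp.seq (GWp.read (by norm_num) (GWp.seq
    (GWp.copy (by norm_num) (by norm_num) (GWp.seq (GWp.forLoop (by norm_num) N (137 * D + 40)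
    (fun i g => g.v 2 = N ∧ g.v 3 = D ∧ g.v 4 = i ∧ g.rd = 2 + i * D ∧
      g.out = (List.range i).flatMap fun i => storeOps D i (A' i)) ?_ ?_ ?_ ?_ ?_)))))))
  · rintro i g u t h
    simpa using h
  · rintro i g hi ⟨h2, h3, h4, hrd, hout⟩
    refine GWp.seq (GWp.copy (by norm_num) (by norm_num) (GWp.seq (GWp.copy (by norm_num) (by norm_num)
      (GWp.seq (GWp.label i D (by simp [Gen.set, h4]) (by simp [Gen.set, h3]) fun v₁ t₁ hv₁ ht₁ => ?_)))))
    have hv₁' : ∀ x, x ≠ 5 → x ≠ 6 → x ≠ 7 → v₁ x = g.v x := fun x h5 h6 h7 => by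
      rw [hv₁ x h5 h6 h7]; simp [Gen.set, h5, h7]
    refine GWp.seq (GWp.copy (by norm_num) (by norm_num) (GWp.seq (GWp.vec (A' i) D
      (by simp [Gen.set, h3, hv₁']) (by simpa [Gen.set, hrd] using hA i hi)
      fun v₂ t₂ hv₂ ht₂ => ?_)))
    have hv₂' : ∀ x, x ≠ 5 → x ≠ 6 → x ≠ 7 → v₂ x = g.v x := fun x h5 h6 h7 => by
      rw [hv₂ x h6 h7]; simp [Gen.set, h7, hv₁' x h5 h6 h7]
    refine GWp.seq (GWp.copy (by norm_num) (by norm_num) (GWp.seq (GWp.forEmit (by norm_num) D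
      (by simp [Gen.set, h3, hv₂']) _ fun t₃ ht₃ => GWp.seq (GWp.emits _ fun t₄ ht₄ =>
        GWp.inc (by norm_num) ⟨⟨?_, ?_, ?_, ?_, ?_⟩, ?_, ?_⟩))))
    · simp [Gen.set, hv₂', h2]
    · simp [Gen.set, hv₂', h3]
    · simp [Gen.set, hv₂', h4]
    · simp only [Gen.set, hrd]; ring
    · simp [Gen.set, hout, List.range_succ, storeOps]
    · simp [Gen.set, hv₂']
    · simp only [Gen.set, List.length_cons, List.length_nil] at *
      omega
  · simpa [Gen.set, Gen.zero] using And.intro h0 h1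
  · simpa [Gen.set, Gen.zero] using h0
  rintro g ⟨h2, h3, -, hrd, hout⟩ hclk
  -- Per coordinate, $20+58+38\le 118$: the way to the stored vector, the test and the double move
  -- back.
  refine GWp.seq (GWp.copy (by norm_num) (by norm_num) (GWp.forLoop (by norm_num) N (118 * D + 40)
    (fun j g => g.v 2 = N ∧ g.v 3 = D ∧ g.rd = 2 + N * D + j * D ∧
      g.out = (List.range N).flatMap (fun i => storeOps D i (A' i)) ++
        (List.range j).flatMap fun j => compareOps D (B' j)) ?_ ?_ ?_ ?_ ?_))
  · rintro i g u t h
    simpa using h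
  · rintro j g hj ⟨h2, h3, hrd, hout⟩
    refine GWp.seq (GWp.copy (by norm_num) (by norm_num) (GWp.seq (GWp.forEmit (by norm_num) D
      (by simp [Gen.set, h3]) _ fun t₁ ht₁ => GWp.seq (GWp.copy (by norm_num) (by norm_num)
      (GWp.seq (GWp.orth (B' j) D (by simp [Gen.set, h3])
        (by simpa [Gen.set, hrd] using hB j hj)
      fun v₂ t₂ hv₂ ht₂ => ?_))))))
    have hv₂' : ∀ x, x ≠ 6 → x ≠ 7 → v₂ x = g.v x := fun x h6 h7 => by
      rw [hv₂ x h6 h7]; simp [Gen.set, h7]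
    refine GWp.seq (GWp.copy (by norm_num) (by norm_num) (GWp.seq (GWp.forEmit (by norm_num) D
      (by simp [Gen.set, h3, hv₂']) _ fun t₃ ht₃ => GWp.emits _ fun t₄ ht₄ =>
        ⟨⟨?_, ?_, ?_, ?_⟩, ?_, ?_⟩)))
    · simp [Gen.set, hv₂', h2]
    · simp [Gen.set, hv₂', h3]
    · simp only [Gen.set, hrd]; ring
    · simp [Gen.set, hout, List.range_succ, compareOps]
    · simp [Gen.set, hv₂']
    · simp only [Gen.set, List.length_cons, List.length_nil] at *
      omega
  · simpa [Gen.set, h2, h3, hout] using hrd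
  · simp [Gen.set, h2]
  · rintro g' ⟨-, -, -, hout'⟩ hclk'
    refine ⟨hout', ?_⟩
    simp only [Gen.set, Gen.zero] at hclk hclk'
    nlinarith [Nat.zero_le (N * D)]

end LoopProg

/-! ## Satisfiability -/

namespace TapeCode

/-- The operations for an entry of the encoding of a formula. -/
def intOps (z : ℤ) : List Op :=
  if z = 0 then [.endClause] else
    (List.replicate z.natAbs [Op.right]).flatten ++ [.test (decide (0 < z))] ++
      (List.replicate z.natAbs [Op.left]).flatten

/-- Write the first `h` digits of `b`. -/
def digitOps (b h : ℕ) : List Op := (List.range h).flatMap fun t => [.right, .write (b.testBit t)]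

/-- Evaluate a formula, when the first `h` variables are given by the digits of `b`. -/
def blockOps (h : ℕ) (Z : List ℤ) (b : ℕ) : List Op :=
  digitOps b h ++ (List.replicate h [Op.left]).flatten ++ Z.flatMap intOps ++ [.endFormula]

/-- Evaluate a formula for all values of the first `h` variables. -/
def satOps (h : ℕ) (Z : List ℤ) : List Op :=
  [.enable] ++ (List.replicate h [Op.left]).flatten ++ [.left] ++ (List.range (2 ^ h)).flatMap (blockOps h Z)

/-- The value of the variable `v`, if the first `h` variables are given by the digits of `b`, and the
others by a tape. -/
def value (h b : ℕ) (c : ℤ → Option Bool) (v : ℕ) : Bool :=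
  if v ≤ h then b.testBit (v - 1) else c (v - 1 - h : ℕ) == some true

/-- For each literal the head walks to the cell of its variable and back, so the tests accumulate in
`hit` from a fixed base position. -/
theorem exec_literals (C : List ℤ) (hC : ∀ z ∈ C, z ≠ 0) (m : Mach) : exec (C.flatMap intOps) m =
    { m with flags := { m.flags with hit := m.flags.hit ||
      (C.any fun z => (m.cell (m.pos + z.natAbs) == some true) == decide (0 < z)) } } := by
  induction C generalizing m with
  | nil => simp [exec_nil]
  | cons z C ih =>
    rw [List.flatMap_cons, exec_append, intOps, if_neg (hC z (by simp)), exec_append, exec_append, exec_rights,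
      exec_cons, exec_nil, exec_test, exec_lefts, ih fun z hz => hC z (by simp [hz])]
    simp [Bool.or_assoc]

theorem exec_clauses (l : List (List ℤ)) (hl : ∀ C ∈ l, ∀ z ∈ C, z ≠ 0) (m : Mach) (hm : m.flags.hit = false) :
    exec ((l.flatMap fun C => C ++ [0]).flatMap intOps) m =
    { m with flags := { m.flags with ok := m.flags.ok &&
      (l.all fun C => C.any fun z => (m.cell (m.pos + z.natAbs) == some true) == decide (0 < z)) } } := by
  induction l generalizing m with
  | nil => simp [exec_nil]
  | cons C l ih =>
    rw [List.flatMap_cons, List.flatMap_append, List.flatMap_append, exec_append, exec_append,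
      exec_literals C (hl C (by simp)), List.flatMap_singleton, intOps, if_pos rfl, exec_cons, exec_nil,
      exec_endClause, ih (fun C hC => hl C (by simp [hC])) _ rfl]
    simp [hm, Bool.and_assoc]

/-- Each digit is preceded by a move, so the digits fill the `h` cells to the right of the starting
position. The flag `ok` must be set for writing to take effect. -/
theorem exec_digitOps (b h : ℕ) (m : Mach) (hm : m.flags.ok = true) :
    exec (digitOps b h) m = { m with
      pos := m.pos + h
      cell := fun p => if m.pos < p ∧ p ≤ m.pos + h then some (b.testBit (p - m.pos - 1).toNat) else m.cell p } := by
  induction h with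
  | zero =>
    have : ∀ p, ¬ (m.pos < p ∧ p ≤ m.pos) := fun p => by omega
    simp [digitOps, exec_nil, this]
  | succ h ih =>
    have e : digitOps b (h + 1) = digitOps b h ++ [.right, .write (b.testBit h)] := by
      simp [digitOps, List.range_succ]
    rw [e, exec_append, ih, exec_cons, exec_cons, exec_nil, exec_right, exec_write]
    simp only [hm, if_true, Mach.mk.injEq, true_and]
    refine ⟨by push_cast; ring, funext fun p => ?_⟩
    rw [Function.update_apply]
    by_cases h1 : p = m.pos + h + 1
    · subst h1
      have : (m.pos + h + 1 - m.pos - 1).toNat = h := by omega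
      rw [if_pos rfl, if_pos (by push_cast; omega), this]
    · rw [if_neg h1]
      refine if_congr ?_ rfl rfl
      push_cast; omega

/-- With the base at $-h-1$, variable $v$ is found in cell $v-h-1$: the first `h` variables occupy
the negative cells, which the block overwrites, and the others are the oracle bits, which it does
not touch. -/
theorem exec_blockOps (h b : ℕ) (l : List (List ℤ)) (hl : ∀ C ∈ l, ∀ z ∈ C, z ≠ 0) (m : Mach) (a : Bool)
    (hm : m.flags = ⟨false, true, true, a⟩) (hp : m.pos = -h - 1) :
    (exec (blockOps h (l.flatMap fun C => C ++ [0]) b) m).flags = ⟨false, true, true, a ||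
      l.all fun C => C.any fun z => value h b m.cell z.natAbs == decide (0 < z)⟩ ∧
    (exec (blockOps h (l.flatMap fun C => C ++ [0]) b) m).pos = -h - 1 ∧
    ∀ p : ℤ, 0 ≤ p → (exec (blockOps h (l.flatMap fun C => C ++ [0]) b) m).cell p = m.cell p := by
  rw [blockOps, exec_append, exec_append, exec_append, exec_digitOps b h m (by rw [hm]), exec_lefts,
    exec_clauses l hl _ (by simp [hm]), exec_cons, exec_nil, exec_endFormula]
  simp only [hm, hp, Bool.true_and, Bool.and_true]
  refine ⟨?_, by ring, fun p hp' => if_neg (by omega)⟩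
  congr 2
  rw [Bool.eq_iff_iff, List.all_eq_true, List.all_eq_true]
  refine forall₂_congr fun C hC => ?_
  rw [List.any_eq_true, List.any_eq_true]
  refine exists_congr fun z => and_congr_right fun hz => ?_
  have h0 := hl C hC z hz
  have e : -(h : ℤ) - 1 + h - h + z.natAbs = z.natAbs - h - 1 := by ring
  rw [e, value]
  by_cases hv : z.natAbs ≤ h
  · rw [if_pos (by omega), if_pos hv]
    have : ((z.natAbs : ℤ) - h - 1 - (-h - 1) - 1).toNat = z.natAbs - 1 := by omega
    rw [this]
    cases b.testBit (z.natAbs - 1) <;> simp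
  · rw [if_neg (by omega), if_neg hv]
    have : ((z.natAbs : ℤ) - h - 1) = (z.natAbs - 1 - h : ℕ) := by omega
    rw [this]

/-- The result of a block depends on the previous tape only through its nonnegative cells. These are
preserved, so all blocks see the same oracle bits. -/
theorem exec_blocks (h n : ℕ) (l : List (List ℤ)) (hl : ∀ C ∈ l, ∀ z ∈ C, z ≠ 0) (m : Mach)
    (hm : m.flags = ⟨false, true, true, false⟩) (hp : m.pos = -h - 1) :
    (exec ((List.range n).flatMap (blockOps h (l.flatMap fun C => C ++ [0]))) m).flags = ⟨false, true, true,
      (List.range n).any fun b => l.all fun C => C.any fun z => value h b m.cell z.natAbs == decide (0 < z)⟩ ∧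
    (exec ((List.range n).flatMap (blockOps h (l.flatMap fun C => C ++ [0]))) m).pos = -h - 1 ∧
    ∀ p : ℤ, 0 ≤ p →
      (exec ((List.range n).flatMap (blockOps h (l.flatMap fun C => C ++ [0]))) m).cell p = m.cell p := by
  induction n with
  | zero => simp [exec_nil, hm, hp]
  | succ n ih =>
    obtain ⟨h1, h2, h3⟩ := ih
    rw [List.range_succ, List.flatMap_append, exec_append, List.flatMap_singleton, List.any_append]
    obtain ⟨k1, k2, k3⟩ := exec_blockOps h n l hl _ _ h1 h2
    refine ⟨?_, k2, fun p hp => (k3 p hp).trans (h3 p hp)⟩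
    rw [k1]
    simp only [value, List.any_cons, List.any_nil, Bool.or_false]
    simp only [h3 _ (Int.natCast_nonneg _)]

/-- The initial `enable` sets `found`, because `ok` is true at the start; without it `endFormula`
could never accept. -/
theorem exec_satOps (h : ℕ) (l : List (List ℤ)) (hl : ∀ C ∈ l, ∀ z ∈ C, z ≠ 0) (w : List Bool) :
    (exec (satOps h (l.flatMap fun C => C ++ [0])) (Mach.init w)).flags.acc = true ↔
      ∃ b < 2 ^ h, ∀ C ∈ l, ∃ z ∈ C, value h b (Mach.init w).cell z.natAbs = decide (0 < z) := by
  rw [satOps, exec_append, exec_append, exec_append, exec_lefts, exec_cons, exec_nil, exec_left, exec_cons,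
    exec_nil, exec_enable, (exec_blocks h (2 ^ h) l hl _ rfl ?_).1]
  · simp
  · simp [Mach.init]

theorem satOps_mem_lang {f : ℕ → ℕ} {ℓ h k : ℕ} (φ : KCNF k ℓ) (hh : ℓ ≤ 2 * h)
    (hf : h ≤ f ((satOps h (φ.clauses.flatMap fun C => C.map encodeLiteral ++ [0])).flatMap Op.code).length) :
    (satOps h (φ.clauses.flatMap fun C => C.map encodeLiteral ++ [0])).flatMap Op.code ∈ lang f ↔
      φ.Satisfiable := by
  have e : (φ.clauses.flatMap fun C => C.map encodeLiteral ++ [0]) =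
      (φ.clauses.map fun C => C.map encodeLiteral).flatMap fun C => C ++ [0] := by
    rw [List.flatMap_map]
  rw [mem_lang_iff]
  set n := f ((satOps h (φ.clauses.flatMap fun C => C.map encodeLiteral ++ [0])).flatMap Op.code).length
  have hl : ∀ C ∈ φ.clauses.map fun C => C.map encodeLiteral, ∀ z ∈ C, z ≠ 0 := by
    simp only [List.mem_map]
    rintro _ ⟨C, -, rfl⟩ z hz
    obtain ⟨p, -, rfl⟩ := List.mem_map.1 hz
    unfold encodeLiteral
    split_ifs <;> omega
  have hpos : ∀ p : Fin ℓ × Bool, decide (0 < encodeLiteral p) = p.2 := by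
    rintro ⟨i, _ | _⟩ <;> simp [encodeLiteral]
  have habs : ∀ p : Fin ℓ × Bool, (encodeLiteral p).natAbs = p.1 + 1 := by
    rintro ⟨i, _ | _⟩ <;> simp [encodeLiteral] <;> omega
  have hex : ∀ (C : List (Fin ℓ × Bool)) (P : ℤ → Prop),
      (∃ z ∈ C.map encodeLiteral, P z) ↔ ∃ p ∈ C, P (encodeLiteral p) := fun C P => by
    simp only [List.mem_map, exists_exists_and_eq_and]
  simp only [e, exec_satOps h _ hl, List.forall_mem_map, hex, hpos, habs]
  constructor
  · rintro ⟨w, -, b, -, h2⟩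
    exact ⟨fun i => value h b (Mach.init w).cell (i + 1), h2⟩
  · rintro ⟨a, ha⟩
    let a' : ℕ → Bool := fun i => if hi : i < ℓ then a ⟨i, hi⟩ else false
    -- A satisfying assignment is cut at `h`: its first part selects the block, the rest gives the
    -- oracle bits.
    refine ⟨(List.range n).map fun i => a' (h + i), by simp, Nat.ofBits fun i : Fin h => a' i,
      Nat.ofBits_lt_two_pow _, fun C hC => ?_⟩
    obtain ⟨p, hp, hap⟩ := ha C hC
    refine ⟨p, hp, ?_⟩
    have hi := p.1.isLt
    rw [← hap, value, Nat.add_sub_cancel]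
    split_ifs with hv
    · rw [Nat.testBit_ofBits_lt _ _ (by omega)]
      simp [a']
    -- At most `ℓ - h ≤ h ≤ n` variables are left to the oracle.
    · have : (p.1 : ℕ) - h < n := by omega
      have e' : h + ((p.1 : ℕ) - h) = p.1 := by omega
      simp [Mach.init, a', this, e']

end TapeCode

/-! ### The generator for satisfiability -/

namespace LoopProg

open TapeCode

variable {M : MultiTapeTM} {X : List ℤ} {B : ℕ}

/-- Write the operations for the entry of a formula given by the variable `6`, with counter `12`. -/
noncomputable def intGen (M : MultiTapeTM) : Cmd :=
  .ite true 6 (emits M [.endClause]) <| .ite false 6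
    (.seq (.atom (.copy 12 6)) <| .seq (forLoop 12 <| emits M [.right]) <| .seq (emits M [.test true]) <|
      .seq (.atom (.copy 12 6)) <| forLoop 12 <| emits M [.left])
    (.seq (.atom (.neg 6)) <|
      .seq (.atom (.copy 12 6)) <| .seq (forLoop 12 <| emits M [.right]) <| .seq (emits M [.test false]) <|
      .seq (.atom (.copy 12 6)) <| forLoop 12 <| emits M [.left])

/-- The generator for satisfiability: `2` holds the number of variables, `3` the number of clauses not
yet read, `4` the length of the formula, `8` the number of blocks, `9` the number of variables given
by digits, `10` the index of the block, `11` the position in the formula, `5` the remaining digits,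
`6` an entry or digit, `7` and `12` count. -/
noncomputable def satGen (M : MultiTapeTM) : Cmd :=
  .seq (.atom (.read 2)) <| .seq (.atom (.read 3)) <|
  .seq (.while 3 <| .seq (.atom (.read 6)) <| .seq (.atom (.put (M.work + 2) 4 6)) <|
    .seq (.atom (.inc 4)) <| .ite true 6 (.atom (.dec 3)) .skip) <|
  .seq (.atom (.copy 9 2)) <| .seq (.atom (.inc 9)) <| .seq (.atom (.half 9)) <|
  .seq (.atom (.lit 8 1)) <| .seq (.atom (.copy 7 9)) <| .seq (forLoop 7 <| .atom (.double 8)) <|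
  .seq (emits M [.enable]) <|
  .seq (.atom (.copy 7 9)) <| .seq (forLoop 7 <| emits M [.left]) <| .seq (emits M [.left]) <|
  forLoop 8 <|
    .seq (.atom (.copy 5 10)) <| .seq (.atom (.copy 7 9)) <| .seq (forLoop 7 <|
      .seq (.atom (.parity 6 5)) <| .seq (.atom (.half 5)) <|
        emitIf M 6 [.right, .write false] [.right, .write true]) <|
    .seq (.atom (.copy 7 9)) <| .seq (forLoop 7 <| emits M [.left]) <|
    .seq (.atom (.lit 11 0)) <| .seq (.atom (.copy 7 4)) <| .seq (forLoop 7 <|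
      .seq (.atom (.get 6 (M.work + 2) 11)) <| .seq (.atom (.inc 11)) <| intGen M) <|
    .seq (emits M [.endFormula]) <| .atom (.inc 10)

/-- The two walks take $20$ ticks per cell each, whence $40n$. -/
theorem GWp.int {Q : Gen → Prop} {g : Gen} (z : ℤ) (n : ℕ) (hz : z.natAbs ≤ n) (h6 : g.v 6 = z)
    (h : ∀ v' t, (∀ x, x ≠ 6 → x ≠ 12 → v' x = g.v x) → t ≤ g.clk + 40 * n + 30 →
      Q { g with v := v', out := g.out ++ intOps z, clk := t }) :
    GWp M X B (intGen M) Q g := by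
  refine GWp.ite (by norm_num) (fun h0 => GWp.emits _ fun t ht => ?_) (fun h0 =>
    GWp.ite (by norm_num) (fun h1 => ?_) (fun h1 => ?_))
  · simp only [if_true] at h0
    simp only [Gen.tick, List.length_singleton] at ht
    have := h g.v t (fun _ _ _ => rfl) (by omega)
    rwa [intOps, if_pos (h6 ▸ h0)] at this
  · simp only [if_true, Gen.tick, h6, Bool.false_eq_true, if_false] at h0 h1
    have hn : (z.natAbs : ℤ) = z := by omega
    refine GWp.seq (GWp.copy (by norm_num) (by norm_num) (GWp.seq (GWp.forEmit (by norm_num) z.natAbs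
      (by simp [Gen.set, Gen.tick, h6, hn]) _ fun t₁ ht₁ => GWp.seq (GWp.emits _ fun t₂ ht₂ => GWp.seq
      (GWp.copy (by norm_num) (by norm_num) (GWp.forEmit (by norm_num) z.natAbs
      (by simp [Gen.set, Gen.tick, h6, hn]) _ fun t₃ ht₃ => ?_))))))
    simp only [Gen.set, Gen.tick, List.length_singleton] at ht₁ ht₂ ht₃
    simp only [Gen.set, Gen.tick, List.append_assoc]
    convert h _ t₃ _ _ using 4
    · simp [intOps, h0, h1]
    · intro x hx hx'
      simp [hx']
    · omega
  · simp only [if_true, Gen.tick, h6, Bool.false_eq_true, if_false] at h0 h1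
    have hn : (z.natAbs : ℤ) = -z := by omega
    refine GWp.seq (GWp.neg (by norm_num) (GWp.seq (GWp.copy (by norm_num) (by norm_num) (GWp.seq
      (GWp.forEmit (by norm_num) z.natAbs
      (by simp [Gen.set, Gen.tick, h6, hn]) _ fun t₁ ht₁ => GWp.seq (GWp.emits _ fun t₂ ht₂ => GWp.seq
      (GWp.copy (by norm_num) (by norm_num) (GWp.forEmit (by norm_num) z.natAbs
      (by simp [Gen.set, Gen.tick, h6, hn]) _ fun t₃ ht₃ => ?_))))))))
    simp only [Gen.set, Gen.tick, List.length_singleton] at ht₁ ht₂ ht₃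
    simp only [Gen.set, Gen.tick, List.append_assoc]
    convert h _ t₃ _ _ using 4
    · simp [intOps, h0, h1]
    · intro x hx hx'
      simp [hx, hx']
    · omega

theorem GWp.ints {Q : Gen → Prop} {g : Gen} (Z : List ℤ) (n : ℕ) (hZ : ∀ z ∈ Z, z.natAbs ≤ n)
    (hfm : ∀ i < Z.length, g.fm i = Z.getD i 0) (h7 : g.v 7 = Z.length) (h11 : g.v 11 = 0)
    (h : ∀ v' t, (∀ x, x ≠ 6 → x ≠ 7 → x ≠ 11 → x ≠ 12 → v' x = g.v x) →
      t ≤ g.clk + Z.length * (40 * n + 34) + 1 →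
      Q { g with v := v', out := g.out ++ Z.flatMap intOps, clk := t }) :
    GWp M X B (LoopProg.forLoop 7 <|
      .seq (.atom (.get 6 (M.work + 2) 11)) <| .seq (.atom (.inc 11)) <| intGen M) Q g := by
  refine GWp.forLoop (by norm_num) Z.length (40 * n + 32) (fun j g' => ∃ (v' : ℕ → ℤ) (t : ℕ), v' 11 = j ∧
    (∀ x, x ≠ 6 → x ≠ 7 → x ≠ 11 → x ≠ 12 → v' x = g.v x) ∧
      g' = { g with v := v', out := g.out ++ (Z.take j).flatMap intOps, clk := t }) ?_ ?_ ?_ h7 ?_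
  · rintro j _ u t ⟨v', t', h1, h2, rfl⟩
    refine ⟨Function.update v' 7 u, t, by simpa using h1, fun x h6 h7 h11 h12 => ?_, rfl⟩
    simp [h7, h2 x h6 h7 h11 h12]
  · rintro j _ hj ⟨v', t', h1, h2, rfl⟩
    have hg : Z.getD j 0 = Z[j] := by simp [hj]
    refine GWp.seq (GWp.get (by norm_num) (by norm_num) (GWp.seq (GWp.inc (by norm_num)
      (GWp.int Z[j] n (hZ _ (List.getElem_mem hj)) ?_ fun v₁ t₁ hv₁ ht₁ => ⟨⟨v₁, t₁, ?_, ?_, ?_⟩, ?_, ?_⟩))))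
    · simp only [Gen.set, h1, hfm j hj, hg]
      simp
    · rw [hv₁ 11 (by norm_num) (by norm_num)]
      simp [Gen.set, h1]
    · intro x h6 h7 h11 h12
      rw [hv₁ x h6 h12]
      simp [Gen.set, h6, h11, h2 x h6 h7 h11 h12]
    · simp only [Gen.set, ← List.take_append_getElem hj, List.flatMap_append, List.flatMap_singleton,
        List.append_assoc]
    · refine (hv₁ 7 (by norm_num) (by norm_num)).trans ?_
      simp [Gen.set]
    · simp only [Gen.set] at ht₁ ⊢; omega
  · exact ⟨g.v, g.clk, h11, fun _ _ _ _ _ => rfl, by simp⟩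
  · rintro _ ⟨v', t, h1, h2, rfl⟩ ht
    rw [List.take_length]
    exact h v' t h2 ht

theorem digitOps_succ (b h : ℕ) : digitOps b (h + 1) = digitOps b h ++ [.right, .write (b.testBit h)] := by
  simp [digitOps, List.range_succ]

theorem GWp.digit {Q : Gen → Prop} {g : Gen} (b n : ℕ) (h5 : g.v 5 = b) (h7 : g.v 7 = n)
    (h : ∀ v' t, (∀ x, x ≠ 5 → x ≠ 6 → x ≠ 7 → v' x = g.v x) → t ≤ g.clk + n * 41 + 1 →
      Q { g with v := v', out := g.out ++ digitOps b n, clk := t }) :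
    GWp M X B (LoopProg.forLoop 7 <| .seq (.atom (.parity 6 5)) <| .seq (.atom (.half 5)) <|
        LoopProg.emitIf M 6 [.right, .write false] [.right, .write true]) Q g := by
  refine GWp.forLoop (by norm_num) n 39 (fun j g' => g'.v 5 = (b / 2 ^ j : ℕ) ∧
    ∃ v' t, (∀ x, x ≠ 5 → x ≠ 6 → x ≠ 7 → v' x = g.v x) ∧
      g' = { g with v := v', out := g.out ++ digitOps b j, clk := t }) ?_ ?_ ?_ h7 ?_
  · rintro j _ u t ⟨h1, v', t', h2, rfl⟩
    refine ⟨by simpa using h1, _, t, fun x h5 h6 h7 => ?_, rfl⟩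
    simp [h7, h2 x h5 h6 h7]
  · rintro j _ - ⟨h1, v', t', h2, rfl⟩
    simp only at h1
    refine GWp.seq (GWp.parity (by norm_num) (by norm_num) (GWp.seq (GWp.half (by norm_num)
      (GWp.emitIf (k := 2) (by norm_num) (by simp) (by simp) fun t ht =>
        ⟨⟨?_, Function.update (Function.update v' 6 (v' 5 % 2)) 5 (v' 5 / 2), t, ?_, ?_⟩, ?_, ?_⟩))))
    · simp [Gen.set, h1, pow_succ, ← Nat.div_div_eq_div_mul]
    · intro x h5 h6 h7
      simp [h5, h6, h2 x h5 h6 h7]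
    · simp only [Gen.set, List.append_assoc, digitOps_succ, Nat.testBit_eq_decide_div_mod_eq]
      have e : (v' 5 % 2 = 0) ↔ ¬ (b / 2 ^ j % 2 = 1) := by rw [h1]; omega
      by_cases hb : b / 2 ^ j % 2 = 1
      · simp [hb, e]
      · simp [hb, e]
    · simp [Gen.set]
    · simp only [Gen.set] at ht ⊢; omega
  · exact ⟨by simp [h5], g.v, g.clk, fun _ _ _ _ => rfl, by simp [digitOps]⟩
  · rintro _ ⟨-, v', t, h2, rfl⟩ ht
    exact h v' t h2 ht

/-- The formula must be copied into an array, since it is written once per block while the input can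
be read only once. By `hm`, the number of clauses not yet terminated is positive exactly while
entries remain. By `hB`, the computation of $2^h$, the only use of doubling, stays in bounds. -/
theorem gwp_satGen (n m : ℕ) (Z : List ℤ) (h0 : X.getD 0 0 = n) (h1 : X.getD 1 0 = m)
    (hX : ∀ i < Z.length, X.getD (2 + i) 0 = Z.getD i 0) (hZ : ∀ z ∈ Z, z.natAbs ≤ n)
    (hm : ∀ i ≤ Z.length, (Z.take i).count 0 < m ↔ i < Z.length) (hB : 2 ^ ((n + 1) / 2) ≤ B) :
    GWp M X B (satGen M) (fun g => g.out = satOps ((n + 1) / 2) Z ∧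
      g.clk ≤ 300 * (Z.length + 1) * (n + 2) * 2 ^ ((n + 1) / 2)) Gen.zero := by
  set h := (n + 1) / 2 with hh
  refine GWp.seq (GWp.read (by norm_num) (GWp.seq (GWp.read (by norm_num) (GWp.seq
    (GWp.while (by norm_num) Z.length 5
    (fun i g => i ≤ Z.length ∧ g.v 2 = n ∧ g.v 3 = m - (Z.take i).count 0 ∧ g.v 4 = i ∧ g.v 10 = 0 ∧ g.rd = 2 + i ∧
      g.out = [] ∧ ∀ j < i, g.fm j = Z.getD j 0) ?_ ?_ ?_ ?_ ?_)))))
  · rintro i g t h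
    exact h
  · rintro i g ⟨hi, h2, h3, -⟩
    rw [h3, ← hm i hi]
    omega
  · rintro i g hi ⟨-, h2, h3, h4, h10, hrd, hout, hfm⟩
    have hg : Z.getD i 0 = Z[i] := by simp [hi]
    have hr : X.getD g.rd 0 = Z[i] := by rw [hrd, hX i hi, hg]
    have hfm' : ∀ j < i + 1, Function.update g.fm i (X.getD g.rd 0) j = Z.getD j 0 := fun j hj => by
      rcases Nat.lt_succ_iff_lt_or_eq.1 hj with hj | rfl
      · rw [Function.update_of_ne (by exact_mod_cast hj.ne), hfm j hj]
      · rw [Function.update_self, hr, hg]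
    have hc : (Z.take (i + 1)).count 0 = (Z.take i).count 0 + if X.getD g.rd 0 = 0 then 1 else 0 := by
      rw [← List.take_append_getElem hi, List.count_append, List.count_singleton, hr]
      simp
    refine GWp.seq (GWp.read (by norm_num) (GWp.seq (GWp.put (by norm_num) (by norm_num) (GWp.seq
      (GWp.inc (by norm_num) (GWp.ite (by norm_num) (fun h6 => GWp.dec (by norm_num)
        ⟨⟨hi, ?_, ?_, ?_, ?_, ?_, ?_, ?_⟩, ?_⟩) (fun h6 => GWp.skip ⟨⟨hi, ?_, ?_, ?_, ?_, ?_, ?_, ?_⟩, ?_⟩)))))))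
    all_goals
      simp only [Gen.set, if_true, Function.update_self, ne_eq, Nat.reduceEqDiff,
        not_false_eq_true, Function.update_of_ne] at h6
      simp only [h6, if_true, if_false] at hc
    all_goals first
      | simp [Gen.set, Gen.tick, h2, h4, h10, hout]; done
      | simp only [Gen.set, Gen.tick, hrd]; omega
      | simp [Gen.set, Gen.tick, h3, hc]; done
      | simp [Gen.set, Gen.tick, h3, hc]; omega
      | simpa [Gen.set, Gen.tick, h4, Nat.lt_succ_iff] using hfm'
  · simpa [Gen.set, Gen.zero] using And.intro h0 h1
  rintro g ⟨-, h2, h3, h4, h10, hrd, hout, hfm⟩ hclk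
  simp only [Gen.set, Gen.zero] at hclk
  have h9 : ((n : ℤ) + 1) / 2 = h := by omega
  refine GWp.seq (GWp.copy (by norm_num) (by norm_num) (GWp.seq (GWp.inc (by norm_num) (GWp.seq
    (GWp.half (by norm_num) (GWp.seq (GWp.lit (by norm_num) (GWp.seq (GWp.copy (by norm_num) (by norm_num)
    (GWp.seq (GWp.forLoop (by norm_num) h 1 (fun i g' => g'.v 2 = n ∧ g'.v 4 = Z.length ∧ g'.v 10 = 0 ∧
      g'.v 9 = h ∧ g'.v 8 = 2 ^ i ∧ g'.out = [] ∧ g'.fm = g.fm) ?_ ?_ ?_ ?_ ?_)))))))))))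
  · rintro i g u t h
    simpa using h
  · rintro i g hi ⟨k2, k4, k10, k9, k8, kout, kfm⟩
    refine GWp.double (by norm_num) ?_ ⟨⟨?_, ?_, ?_, ?_, ?_, ?_, ?_⟩, ?_, ?_⟩
    · rw [k8, ← pow_succ', abs_of_nonneg (by positivity)]
      exact_mod_cast (Nat.pow_le_pow_right (by norm_num) hi).trans hB
    all_goals simp [Gen.set, k2, k4, k10, k9, k8, kout, kfm, pow_succ']
  · simp [Gen.set, h2, h4, h10, hout, h9]
  · simp [Gen.set, h2, h9]
  rintro g₁ ⟨k2, k4, k10, k9, k8, kout, kfm⟩ kclk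
  rw [← kfm] at hfm
  simp only [Gen.set] at kclk
  -- Per block, $61=41+20$ ticks for each digit and the move back over it, and $40n+34$ for each
  -- entry of the formula.
  refine GWp.seq (GWp.emits _ fun t₁ ht₁ => GWp.seq (GWp.copy (by norm_num) (by norm_num) (GWp.seq
    (GWp.forEmit (by norm_num) h (by simp [Gen.set, k9]) _ fun t₂ ht₂ => GWp.seq (GWp.emits _ fun t₃ ht₃ =>
    GWp.forLoop (by norm_num) (2 ^ h) (61 * h + Z.length * (40 * n + 34) + 40) (fun i g' =>
      g'.v 4 = Z.length ∧ g'.v 9 = h ∧ g'.v 10 = i ∧ g'.fm = g₁.fm ∧ g'.out =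
        [.enable] ++ (List.replicate h [Op.left]).flatten ++ [.left] ++ (List.range i).flatMap (blockOps h Z))
      ?_ ?_ ?_ ?_ ?_)))))
  · rintro i g u t h
    simpa using h
  · rintro i g hi ⟨l4, l9, l10, lfm, lout⟩
    refine GWp.seq (GWp.copy (by norm_num) (by norm_num) (GWp.seq (GWp.copy (by norm_num) (by norm_num)
      (GWp.seq (GWp.digit i h (by simp [Gen.set, l10]) (by simp [Gen.set, l9]) fun v₁ t₁ hv₁ ht₁ => ?_)))))
    have hv₁' : ∀ x, x ≠ 5 → x ≠ 6 → x ≠ 7 → v₁ x = g.v x := fun x h5 h6 h7 => by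
      rw [hv₁ x h5 h6 h7]; simp [Gen.set, h5, h7]
    refine GWp.seq (GWp.copy (by norm_num) (by norm_num) (GWp.seq (GWp.forEmit (by norm_num) h
      (by simp [Gen.set, l9, hv₁']) _ fun t₂ ht₂ => GWp.seq (GWp.lit (by norm_num) (GWp.seq
      (GWp.copy (by norm_num) (by norm_num) (GWp.seq (GWp.ints Z n hZ ?_ (by simp [Gen.set, l4, hv₁'])
      (by simp [Gen.set]) fun v₃ t₃ hv₃ ht₃ => GWp.seq (GWp.emits _ fun t₄ ht₄ => GWp.inc (by norm_num)
      ⟨⟨?_, ?_, ?_, ?_, ?_⟩, ?_, ?_⟩)))))))))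
    · simpa [Gen.set, lfm] using hfm
    · simp [Gen.set, hv₃, hv₁', l4]
    · simp [Gen.set, hv₃, hv₁', l9]
    · simp [Gen.set, hv₃, hv₁', l10]
    · exact lfm
    · simp [Gen.set, lout, List.range_succ, blockOps]
    · simp [Gen.set, hv₃, hv₁']
    · simp only [Gen.set, List.length_singleton] at *
      omega
  · simp [Gen.set, k4, k9, k10, kout]
  · simp [Gen.set, k8]
  rintro g₂ ⟨-, -, -, -, lout⟩ lclk
  refine ⟨lout, ?_⟩
  simp only [Gen.set, List.length_singleton] at *
  have hh' : h ≤ n + 1 := by omega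
  have hp : 1 ≤ 2 ^ h := Nat.one_le_two_pow
  set p := 2 ^ h
  have e1 : Z.length ≤ p * Z.length := Nat.le_mul_of_pos_left _ hp
  have e2 : h ≤ p * h := Nat.le_mul_of_pos_left _ hp
  have e3 : p * h ≤ p * (n + 1) := Nat.mul_le_mul_left _ hh'
  nlinarith [Nat.zero_le (p * Z.length * n), Nat.zero_le (p * n)]

end LoopProg

/-! ## Running times -/

namespace LoopProg

open TapeCode

theorem exists_natLog_le_rpow {η : ℝ} (hη : 0 < η) :
    ∃ C : ℝ, 0 < C ∧ ∀ n : ℕ, (Nat.log 2 n + 1 : ℝ) ≤ C * (n + 1 : ℝ) ^ η := by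
  have h2 : 0 < Real.log 2 := Real.log_pos one_lt_two
  refine ⟨1 / η / Real.log 2 + 1, by positivity, fun n => ?_⟩
  have hn : (1 : ℝ) ≤ (n + 1 : ℝ) ^ η := Real.one_le_rpow (by simp) hη.le
  have h3 : (Nat.log 2 n : ℝ) ≤ Real.log (n + 1) / Real.log 2 := by
    rw [le_div_iff₀ h2, ← Real.log_pow]
    refine Real.log_le_log (by positivity) ?_
    have : 2 ^ Nat.log 2 n ≤ n + 1 := by
      rcases Nat.eq_zero_or_pos n with rfl | hn
      · simp
      · exact (Nat.pow_log_le_self 2 hn.ne').trans (Nat.le_succ n)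
    exact_mod_cast this
  have h4 : Real.log (n + 1) / Real.log 2 ≤ 1 / η / Real.log 2 * (n + 1 : ℝ) ^ η := by
    have := Real.log_le_rpow_div (x := n + 1) (by positivity) hη
    rw [div_mul_eq_mul_div, div_mul_eq_mul_div, one_mul]
    gcongr
  rw [add_mul, one_mul]
  linarith

/-- As `bigBound` is cubic, the logarithm is compared with the power $\eta/3$. -/
theorem exists_tickCost_le_rpow {η : ℝ} (hη : 0 < η) :
    ∃ C : ℝ, 0 < C ∧ ∀ n : ℕ, (tickCost n : ℝ) ≤ C * (n + 1 : ℝ) ^ η := by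
  obtain ⟨C, hC, h⟩ := exists_natLog_le_rpow (η := η / 3) (by positivity)
  refine ⟨40 * C * 13 ^ (η / 3), by positivity, fun n => ?_⟩
  have h1 := h (bigBound n)
  have h2 : (bigBound n + 1 : ℝ) ≤ 13 * (n + 1 : ℝ) ^ 3 := by
    have : (1 : ℝ) ≤ (n + 1 : ℝ) ^ 3 := one_le_pow₀ (by simp)
    rw [bigBound]; push_cast
    linarith
  have h3 : (bigBound n + 1 : ℝ) ^ (η / 3) ≤ 13 ^ (η / 3) * (n + 1 : ℝ) ^ η := by
    refine (Real.rpow_le_rpow (by positivity) h2 (by positivity)).trans_eq ?_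
    rw [Real.mul_rpow (by norm_num) (by positivity), ← Real.rpow_natCast, ← Real.rpow_mul (by positivity)]
    congr 2
    push_cast; ring
  have h4 : (tickCost n : ℝ) = 40 * (Nat.log 2 (bigBound n) + 1) := by rw [tickCost]; push_cast; ring
  rw [h4]
  calc 40 * (Nat.log 2 (bigBound n) + 1 : ℝ) ≤ 40 * (C * (13 ^ (η / 3) * (n + 1 : ℝ) ^ η)) := by
        refine mul_le_mul_of_nonneg_left (h1.trans ?_) (by norm_num)
        gcongr
    _ = _ := by ring

/-- The length of the generated input is only bounded from above, so the time bound has to be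
monotone and valid for all lengths. The sum of the first values and the shift to $n+1$ take care of
small `n`. -/
theorem exists_bound_of_isBigO {T : ℕ → ℕ} {r s : ℝ} (hrs : r ≤ s) (hs : 0 ≤ s)
    (h : (fun n => (T n : ℝ)) =O[atTop] fun n : ℕ => (n : ℝ) ^ r) :
    ∃ C : ℝ, 0 < C ∧ ∀ n, (T n : ℝ) ≤ C * (n + 1 : ℝ) ^ s := by
  obtain ⟨c, hc⟩ := h.bound
  obtain ⟨m, hm⟩ := eventually_atTop.1 hc
  refine ⟨|c| + 1 + ∑ i ∈ Finset.range (m + 1), (T i : ℝ), by positivity, fun n => ?_⟩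
  have h1 : (1 : ℝ) ≤ (n + 1 : ℝ) ^ s := Real.one_le_rpow (by simp) hs
  have hsum : (0 : ℝ) ≤ ∑ i ∈ Finset.range (m + 1), (T i : ℝ) := by positivity
  rcases le_or_gt n m with hn | hn
  · have h2 : (T n : ℝ) ≤ ∑ i ∈ Finset.range (m + 1), (T i : ℝ) :=
      Finset.single_le_sum (f := fun i => (T i : ℝ)) (fun i _ => Nat.cast_nonneg _) (Finset.mem_range.2 (by omega))
    nlinarith [abs_nonneg c]
  · have h2 := hm n hn.le
    have hn1 : (1 : ℝ) ≤ n := by exact_mod_cast (by omega : 1 ≤ n)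
    have h3 : (n : ℝ) ^ r ≤ (n + 1 : ℝ) ^ s :=
      (Real.rpow_le_rpow_of_exponent_le hn1 hrs).trans (Real.rpow_le_rpow (by positivity) (by simp) hs)
    rw [Real.norm_of_nonneg (Nat.cast_nonneg _), Real.norm_of_nonneg (by positivity)] at h2
    have h4 : c * (n : ℝ) ^ r ≤ |c| * (n + 1 : ℝ) ^ s :=
      mul_le_mul (le_abs_self c) h3 (by positivity) (abs_nonneg c)
    nlinarith

/-- The initial states correspond to each other. -/
theorem Gen.conc_zero (M : MultiTapeTM) : Gen.zero.conc M = St.zero := by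
  have : ∀ p, bitCell M [] p = 0 := fun p => by
    simp [bitCell, symCode]
  ext a p
  · simp [Gen.conc, Gen.zero, St.zero, Gen.bits]
  · simp only [Gen.conc, Gen.zero, St.zero, Gen.bits, List.flatMap_nil]
    split_ifs
    · exact this p
    · rfl
    · rfl
  · rfl
  · rfl

open Classical in
/-- Generating an input for a machine and simulating it. -/
theorem computesWithin_simulation {M : MultiTapeTM} {gen : Cmd} {X : List ℤ} {p : Prop} {L : Language Bool}
    {T : ℕ → ℕ} {Y B : ℕ} (hT : ∀ x, M.HaltsWithin x [] (T x.length)) (hL : ∀ x, x ∈ L ↔ M.Accepts x [])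
    (hX : ∀ v ∈ X, |v| ≤ Y) (hB : Y + ((Cmd.seq gen (simCode M)).size + 21) ≤ B)
    (hgen : GWp M X B gen (fun g => (g.bits ∈ L ↔ p) ∧ g.clk ≤ Y) Gen.zero) :
    ∃ n t, n ≤ B + Y ∧ t ≤ Y + (T n + 2) * stepCost M ∧
      RAM.ComputesWithin ((Cmd.seq gen (simCode M)).program 21) X [if p then 1 else 0]
        (tickCost (B + t) * (t + 1)) := by
  have hX' : ∀ v ∈ X, |v| ≤ B := fun v hv => (hX v hv).trans (by exact_mod_cast (by omega : Y ≤ B))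
  obtain ⟨g, hg, hyes, hclk⟩ := hgen
  rw [Gen.conc_zero] at hg
  -- The length of the output is the value of variable `0` and is therefore bounded like any other
  -- value.
  have hn : g.bits.length ≤ B + Y := by
    have := (hg.bdd hX' (by simp only [Cmd.size] at hB; omega)
      ⟨fun _ => by simp [St.zero], fun _ _ => by simp [St.zero]⟩).1 0
    simp only [Gen.conc, if_true, Nat.abs_cast] at this
    omega
  obtain ⟨s, hs, hsclk, h1, h0⟩ := wp_simCode (M := M) (X := X) (B := B) g.bits (T g.bits.length) (hT _) (g.conc M)
    (by simp [Gen.conc]) (fun i hi hi' => by simp [Gen.conc, hi.ne', hi'.ne])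
    (fun i => by simp [Gen.conc]; omega)
  have hc : (g.conc M).clk = g.clk := rfl
  refine ⟨g.bits.length, s.clk, hn, by omega, ?_⟩
  have := Cmd.computesWithin hX' (.seq hg hs) (x := 21) (by omega) le_rfl
  rw [← hL, hyes] at h1 h0
  split_ifs with hp
  · rwa [h1.2 hp] at this
  · rwa [h0.2 hp] at this

/-- A problem is solved by generating an input for a machine and simulating the machine. -/
theorem solvableInTime_of_generator {Q : DecisionProblem} {M : MultiTapeTM} {gen : Cmd} {L : Language Bool}
    {T Y : ℕ → ℕ} {g : ℕ → ℝ} {r C η : ℝ} (hr : 1 ≤ r) (hr2 : r ≤ 2) (hη : 0 < η) (hC : 0 < C)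
    (hTC : ∀ n, (T n : ℝ) ≤ C * (n + 1 : ℝ) ^ r)
    (hT : ∀ x, M.HaltsWithin x [] (T x.length)) (hL : ∀ x, x ∈ L ↔ M.Accepts x [])
    (hX : ∀ x, ∀ v ∈ Q.encode x, |v| ≤ Y (Q.param x))
    (hgen : ∀ x B, Y (Q.param x) ≤ B → GWp M (Q.encode x) B gen
      (fun g => (g.bits ∈ L ↔ Q.Yes x) ∧ g.clk ≤ Y (Q.param x)) Gen.zero)
    (hg : (fun p => (Y p + 1 : ℝ) ^ (r + η)) =O[atTop] g) : Q.SolvableInTime g := by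
  obtain ⟨C₃, hC₃, htick⟩ := exists_tickCost_le_rpow (η := η / 2) (by positivity)
  set K := (Cmd.seq gen (simCode M)).size + 21
  set S := stepCost M
  set C₁ : ℝ := 1 + (C * (K + 2 : ℝ) ^ r + 2) * S
  have hC₁ : 0 < C₁ := by positivity
  set C₂ : ℝ := K + 1 + C₁
  have hC₂ : 0 < C₂ := by positivity
  set C₄ : ℝ := C₃ * C₂ ^ (η / 2) * C₁
  have hC₄ : 0 < C₄ := by positivity
  refine ⟨(Cmd.seq gen (simCode M)).program 21, fun p => ⌊C₄ * (Y p + 1 : ℝ) ^ (r + η)⌋₊, ?_, fun x => ?_⟩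
  · refine IsBigO.trans (.of_bound C₄ (.of_forall fun p => ?_)) hg
    rw [Real.norm_of_nonneg (Nat.cast_nonneg _), Real.norm_of_nonneg (by positivity)]
    exact Nat.floor_le (by positivity)
  · set p := Q.param x
    obtain ⟨n, t, hn, ht, t', h1, h2, h3⟩ := computesWithin_simulation hT hL (hX x) (B := Y p + K) le_rfl
      (hgen x _ (Nat.le_add_right _ _))
    refine ⟨t', h1, h2, h3.trans (Nat.le_floor ?_)⟩
    set y : ℝ := Y p + 1 with hy
    have hy1 : 1 ≤ y := by simp [hy]
    -- As $r\ge 1$, the time of the generator is absorbed by that of the simulation.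
    have hyr : y ≤ y ^ r := by
      simpa using Real.rpow_le_rpow_of_exponent_le hy1 hr
    have hyr2 : y ^ r ≤ y ^ 2 := by
      simpa using Real.rpow_le_rpow_of_exponent_le hy1 hr2
    have hn' : (n + 1 : ℝ) ≤ (K + 2) * y := by
      have : (n : ℝ) ≤ Y p + K + Y p := by exact_mod_cast hn
      have hK : (0 : ℝ) ≤ K := Nat.cast_nonneg _
      nlinarith
    have hTn : (T n : ℝ) ≤ C * (K + 2 : ℝ) ^ r * y ^ r := by
      rw [mul_assoc, ← Real.mul_rpow (by positivity) (by positivity)]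
      exact (hTC n).trans (by gcongr)
    have ht' : (t + 1 : ℝ) ≤ C₁ * y ^ r := by
      have h4 : (t : ℝ) ≤ Y p + (T n + 2) * S := by exact_mod_cast ht
      have h5 : (T n + 2 : ℝ) * S ≤ (C * (K + 2 : ℝ) ^ r * y ^ r + 2 * y ^ r) * S := by
        gcongr
        linarith
      calc (t + 1 : ℝ) ≤ y ^ r + (C * (K + 2 : ℝ) ^ r * y ^ r + 2 * y ^ r) * S := by linarith
        _ = C₁ * y ^ r := by ring
    -- As $r\le 2$, all values are $O(y^2)$; with the exponent $\eta/2$ for the cost of a tick this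
    -- gives the factor $y^{\eta}$.
    have hA : ((Y p + K + t : ℕ) + 1 : ℝ) ≤ C₂ * y ^ 2 := by
      push_cast
      have h4 : C₁ * y ^ r ≤ C₁ * y ^ 2 := by gcongr
      have h5 : y ≤ y ^ 2 := hyr.trans hyr2
      have h6 : (K : ℝ) ≤ K * y ^ 2 := le_mul_of_one_le_right (Nat.cast_nonneg _) (hy1.trans h5)
      calc (Y p + K + t + 1 : ℝ) ≤ K * y ^ 2 + y ^ 2 + C₁ * y ^ 2 := by linarith
        _ = C₂ * y ^ 2 := by ring
    have hcost : (tickCost (Y p + K + t) : ℝ) ≤ C₃ * (C₂ ^ (η / 2) * y ^ η) := by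
      refine (htick _).trans (mul_le_mul_of_nonneg_left ?_ hC₃.le)
      refine (Real.rpow_le_rpow (by positivity) hA (by positivity)).trans_eq ?_
      rw [Real.mul_rpow hC₂.le (by positivity), ← Real.rpow_natCast, ← Real.rpow_mul (by positivity)]
      congr 2
      push_cast; ring
    push_cast
    calc (tickCost (Y p + K + t) : ℝ) * (t + 1) ≤ C₃ * (C₂ ^ (η / 2) * y ^ η) * (C₁ * y ^ r) := by
          gcongr
      _ = C₄ * y ^ (r + η) := by
          rw [Real.rpow_add (by positivity)]; ring

theorem le_two_pow_ceil_logb (n : ℕ) : n ≤ 2 ^ ⌈Real.logb 2 n⌉₊ := by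
  rcases Nat.eq_zero_or_pos n with rfl | hn
  · simp
  have h := Nat.le_ceil (Real.logb 2 n)
  have h0 : (0 : ℝ) < n := by exact_mod_cast hn
  rw [Real.logb_le_iff_le_rpow one_lt_two h0, Real.rpow_natCast] at h
  exact_mod_cast h

/-! ## The two problems -/

theorem length_le_length_code (l : List Op) : l.length ≤ (l.flatMap Op.code).length := by
  induction l with
  | nil => simp
  | cons o l ih =>
    rw [List.flatMap_cons, List.length_append, List.length_cons]
    have : 1 ≤ o.code.length := by simp [Op.code]
    omega

theorem length_le_length_flatMap {α β : Type*} (l : List α) (F : α → List β) (hF : ∀ a ∈ l, 1 ≤ (F a).length) :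
    l.length ≤ (l.flatMap F).length := by
  induction l with
  | nil => simp
  | cons a l ih =>
    have h1 := hF a (by simp)
    have h2 := ih fun b hb => hF b (by simp [hb])
    rw [List.flatMap_cons, List.length_append, List.length_cons]
    omega

theorem isBigO_atTop_of_le {u v : ℕ → ℝ} (C : ℝ) (hu : ∀ n, 0 ≤ u n) (hv : ∀ n, 0 ≤ v n)
    (h : ∀ n, 1 ≤ n → u n ≤ C * v n) : u =O[atTop] v := by
  refine .of_bound C (eventually_atTop.2 ⟨1, fun n hn => ?_⟩)
  rw [Real.norm_of_nonneg (hu n), Real.norm_of_nonneg (hv n)]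
  exact h n hn

/-! ### Orthogonal vectors -/

/-- The entries of a matrix, extended by `false`. -/
def extend {N d : ℕ} (A : Fin N → Fin d → Bool) (i t : ℕ) : Bool :=
  if h : i < N ∧ t < d then A ⟨i, h.1⟩ ⟨t, h.2⟩ else false

theorem entries_eq {N d : ℕ} (A : Fin N → Fin d → Bool) :
    entries A = List.ofFn fun p : Fin (N * d) => bitVal (extend A (p / d) (p % d)) := by
  rw [List.ofFn_mul, entries]
  congr 2
  funext i
  congr 1
  funext t
  have hd : 0 < d := t.pos
  have h1 : (i * d + t : ℕ) / d = i := by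
    rw [mul_comm, Nat.mul_add_div hd, Nat.div_eq_of_lt t.2, add_zero]
  have h2 : (i * d + t : ℕ) % d = t := by
    rw [mul_comm, Nat.mul_add_mod, Nat.mod_eq_of_lt t.2]
  simp [h1, h2, extend]

theorem getD_entries {N d : ℕ} (A : Fin N → Fin d → Bool) {i t : ℕ} (hi : i < N) (ht : t < d) :
    (entries A)[i * d + t]? = some (bitVal (extend A i t)) := by
  have hd : 0 < d := by omega
  have h1 : (i * d + t : ℕ) / d = i := by
    rw [mul_comm, Nat.mul_add_div hd, Nat.div_eq_of_lt ht, add_zero]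
  have h2 : (i * d + t : ℕ) % d = t := by
    rw [mul_comm, Nat.mul_add_mod, Nat.mod_eq_of_lt ht]
  have h3 : i * d + t < N * d := by
    calc i * d + t < i * d + d := by omega
      _ = (i + 1) * d := by ring
      _ ≤ N * d := Nat.mul_le_mul_right _ hi
  rw [entries_eq, List.getElem?_ofFn, dif_pos h3]
  simp only [h1, h2]

theorem length_entries {N d : ℕ} (A : Fin N → Fin d → Bool) : (entries A).length = N * d := by
  rw [entries_eq, List.length_ofFn]

theorem mem_entries {N d : ℕ} {A : Fin N → Fin d → Bool} {v : ℤ} (h : v ∈ entries A) : |v| ≤ 1 := by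
  rw [entries_eq, List.mem_ofFn] at h
  obtain ⟨p, rfl⟩ := h
  simp only [bitVal]
  split_ifs <;> simp

/-- A sum of nonnegative products vanishes only if every product does. -/
theorem OV_yes_iff {d : ℕ → ℕ} (x : OVInstance d) : (OV d).Yes x ↔
    ∃ i < x.N, ∃ j < x.N, ∀ t < d x.N, extend x.B j t → extend x.A i t = false := by
  have key : ∀ i j : Fin x.N, ∑ t, bitVal (x.A i t) * bitVal (x.B j t) = 0 ↔
      ∀ t < d x.N, extend x.B j t → extend x.A i t = false := fun i j => by
    rw [Finset.sum_eq_zero_iff_of_nonneg fun t _ => by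
      simp only [bitVal]; split_ifs <;> simp]
    constructor
    · intro h t ht hb
      have := h ⟨t, ht⟩ (Finset.mem_univ _)
      simp only [extend, i.2, j.2, ht, and_self, dif_pos] at hb ⊢
      simpa [hb, bitVal] using this
    · intro h t _
      have := h t t.2
      simp only [extend, i.2, j.2, t.2, and_self, dif_pos] at this
      cases hb : x.B j t
      · simp [bitVal]
      · simp [this hb, bitVal]
  constructor
  · rintro ⟨i, j, h⟩
    exact ⟨i, i.2, j, j.2, (key i j).1 h⟩
  · rintro ⟨i, hi, j, hj, h⟩
    exact ⟨⟨i, hi⟩, ⟨j, hj⟩, (key ⟨i, hi⟩ ⟨j, hj⟩).2 h⟩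

/-- There is at least one operation per vector. Hence $\lceil\log_2 n\rceil$ oracle bits can name
every index. -/
theorem le_length_ovOps (N D : ℕ) (A B : ℕ → ℕ → Bool) : N ≤ ((ovOps N D A B).flatMap Op.code).length := by
  refine le_trans ?_ (length_le_length_code _)
  have := length_le_length_flatMap (List.range N) (fun i => storeOps D i (A i)) fun i _ => by
    simp [storeOps]; omega
  rw [List.length_range] at this
  rw [ovOps, List.length_append]
  omega

/-- The operations have length $N$ up to logarithmic factors, so the assumed decider saves a power
of $N$ over $N^2$; part of the saving pays for these factors and for the cost of ticks. -/
theorem OV_solvable {M : MultiTapeTM} {T : ℕ → ℕ} {ε C : ℝ} (hε : 0 < ε) (hε' : ε ≤ 1 / 2) (hC : 0 < C)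
    (hTC : ∀ n, (T n : ℝ) ≤ C * (n + 1 : ℝ) ^ (2 - ε))
    (hT : ∀ x, M.HaltsWithin x [] (T x.length))
    (hL : ∀ x, x ∈ lang (fun n : ℕ => ⌈Real.logb 2 n⌉₊) ↔ M.Accepts x []) :
    (OV fun N => (Nat.log 2 N + 1) ^ 2).SolvableInTime fun N => (N : ℝ) ^ (2 - ε / 4) := by
  set d : ℕ → ℕ := fun N => (Nat.log 2 N + 1) ^ 2 with hd
  refine solvableInTime_of_generator (Y := fun N => 500 * (N + 1) * (d N + 1)) (gen := ovGen M) (η := ε / 2)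
    (by linarith) (by linarith) (by linarith) hC hTC hT hL ?_ ?_ ?_
  · have hb : ∀ a b : ℕ, a ≤ 500 * (a + 1) * (b + 1) ∧ b ≤ 500 * (a + 1) * (b + 1) := fun a b => by
      constructor <;> nlinarith [Nat.zero_le (a * b)]
    rintro (x : OVInstance d) v hv
    have h1 : (1 : ℤ) ≤ (500 * (x.N + 1) * (d x.N + 1) : ℕ) := by
      exact_mod_cast Nat.succ_le_of_lt (by positivity)
    have hv' : v ∈ [(x.N : ℤ), (d x.N : ℤ)] ++ entries x.A ++ entries x.B := hv
    simp only [List.mem_append, List.mem_cons, List.not_mem_nil, or_false] at hv'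
    rcases hv' with ((rfl | rfl) | h) | h
    · rw [Nat.abs_cast]
      exact_mod_cast (hb _ _).1
    · rw [Nat.abs_cast]
      exact_mod_cast (hb _ _).2
    · exact (mem_entries h).trans h1
    · exact (mem_entries h).trans h1
  · rintro (x : OVInstance d) B -
    refine (gwp_ovGen x.N (d x.N) (extend x.A) (extend x.B) rfl rfl ?_ ?_).mono fun g ⟨h1, h2⟩ => ⟨?_, h2⟩
    · intro i hi t ht
      have e := getD_entries x.A hi ht
      change ([(x.N : ℤ), (d x.N : ℤ)] ++ entries x.A ++ entries x.B).getD _ _ = _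
      have hl := (List.getElem?_eq_some_iff.1 e).1
      rw [List.getD_eq_getElem?_getD, List.append_assoc, List.getElem?_append_right (by simp; omega),
        List.getElem?_append_left (by simp; omega)]
      have : 2 + i * d x.N + t - [(x.N : ℤ), (d x.N : ℤ)].length = i * d x.N + t := by simp; omega
      rw [this, e]
      rfl
    · intro j hj t ht
      have e := getD_entries x.B hj ht
      change ([(x.N : ℤ), (d x.N : ℤ)] ++ entries x.A ++ entries x.B).getD _ _ = _
      rw [List.getD_eq_getElem?_getD, List.getElem?_append_right (by simp [length_entries]; omega)]
      have : 2 + x.N * d x.N + j * d x.N + t - ([(x.N : ℤ), (d x.N : ℤ)] ++ entries x.A).length =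
          j * d x.N + t := by simp [length_entries]; omega
      rw [this, e]
      rfl
    · rw [Gen.bits, h1, OV_yes_iff]
      refine ovOps_mem_lang ?_ ?_
      · refine (Nat.lt_pow_succ_log_self one_lt_two x.N).le.trans (Nat.pow_le_pow_right two_pos ?_)
        exact Nat.le_self_pow two_ne_zero _
      · exact (le_length_ovOps _ _ _ _).trans (le_two_pow_ceil_logb _)
  -- The dimension is the square of the logarithm, so it is at most of order $n^{\epsilon/8}$.
  · obtain ⟨c, hc, hlog⟩ := exists_natLog_le_rpow (η := ε / 16) (by positivity)
    refine isBigO_atTop_of_le ((2000 * (c ^ 2 + 1) * 2 ^ (ε / 8)) ^ (2 - ε / 2)) (fun n => by positivity)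
      (fun n => by positivity) fun n hn => ?_
    have hn1 : (1 : ℝ) ≤ n := by exact_mod_cast hn
    have h1 : (1 : ℝ) ≤ (n + 1 : ℝ) ^ (ε / 8) := Real.one_le_rpow (by linarith) (by positivity)
    have h2 : (d n + 1 : ℝ) ≤ (c ^ 2 + 1) * (n + 1 : ℝ) ^ (ε / 8) := by
      have h3 : (d n : ℝ) = (Nat.log 2 n + 1 : ℝ) ^ 2 := by simp [hd]
      have h4 : (Nat.log 2 n + 1 : ℝ) ^ 2 ≤ (c * (n + 1 : ℝ) ^ (ε / 16)) ^ 2 :=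
        pow_le_pow_left₀ (by positivity) (hlog n) 2
      have h5 : ((n + 1 : ℝ) ^ (ε / 16)) ^ 2 = (n + 1 : ℝ) ^ (ε / 8) := by
        rw [← Real.rpow_natCast, ← Real.rpow_mul (by positivity)]
        congr 1; push_cast; ring
      rw [mul_pow, h5] at h4
      rw [h3]; linarith
    have h6 : (n + 1 : ℝ) ^ (ε / 8) ≤ 2 ^ (ε / 8) * (n : ℝ) ^ (ε / 8) := by
      rw [← Real.mul_rpow (by norm_num) (by positivity)]
      exact Real.rpow_le_rpow (by positivity) (by linarith) (by positivity)
    have h7 : (1 : ℝ) ≤ (n : ℝ) ^ (ε / 8) := Real.one_le_rpow hn1 (by positivity)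
    have h8 : ((500 * (n + 1) * (d n + 1) : ℕ) + 1 : ℝ) ≤
        2000 * (c ^ 2 + 1) * 2 ^ (ε / 8) * (n : ℝ) ^ (1 + ε / 8) := by
      push_cast
      have h9 : (d n + 1 : ℝ) ≤ (c ^ 2 + 1) * (2 ^ (ε / 8) * (n : ℝ) ^ (ε / 8)) := h2.trans (by gcongr)
      have h10 : (1 : ℝ) ≤ d n + 1 := by simp
      have h11 : (500 * (n + 1) * (d n + 1) + 1 : ℝ) ≤ 2000 * n * (d n + 1) := by nlinarith
      refine h11.trans ?_
      rw [Real.rpow_add (by linarith), Real.rpow_one]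
      calc 2000 * (n : ℝ) * (d n + 1) ≤ 2000 * n * ((c ^ 2 + 1) * (2 ^ (ε / 8) * (n : ℝ) ^ (ε / 8))) := by gcongr
        _ = _ := by ring
    have h12 : (2 : ℝ) - ε + ε / 2 = 2 - ε / 2 := by ring
    rw [h12]
    refine (Real.rpow_le_rpow (by positivity) h8 (by linarith)).trans ?_
    rw [Real.mul_rpow (by positivity) (by positivity), ← Real.rpow_mul (by positivity)]
    refine mul_le_mul_of_nonneg_left (Real.rpow_le_rpow_of_exponent_le hn1 ?_) (by positivity)
    -- $(1+\epsilon/8)(2-\epsilon/2)=2-\epsilon/4-\epsilon^2/16$.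
    nlinarith

/-- The squared logarithm is large enough for the conjecture to apply and small enough to disappear
in any power of $N$. -/
theorem log_isLittleO_dimension :
    (fun N : ℕ => Real.log N) =o[atTop] fun N : ℕ => (((Nat.log 2 N + 1) ^ 2 : ℕ) : ℝ) := by
  have ht : Tendsto (fun N : ℕ => Real.log N) atTop atTop :=
    Real.tendsto_log_atTop.comp tendsto_natCast_atTop_atTop
  have h1 : (fun N : ℕ => Real.log N) =o[atTop] fun N : ℕ => Real.log N ^ 2 := by
    have := (isLittleO_pow_pow_atTop_of_lt (𝕜 := ℝ) (by norm_num : 1 < 2)).comp_tendsto ht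
    simpa [Function.comp_def] using this
  refine h1.trans_isBigO (isBigO_atTop_of_le 1 (fun n => by positivity) (fun n => by positivity) fun n hn => ?_)
  have hn1 : (1 : ℝ) ≤ n := by exact_mod_cast hn
  rw [one_mul]
  push_cast
  refine pow_le_pow_left₀ (Real.log_nonneg hn1) ?_ 2
  have h2 : (n : ℝ) ≤ 2 ^ (Nat.log 2 n + 1) := by exact_mod_cast (Nat.lt_pow_succ_log_self one_lt_two n).le
  have h3 := Real.log_le_log (by linarith) h2
  rw [Real.log_pow] at h3
  have h4 : Real.log 2 ≤ 1 := by linarith [Real.log_two_lt_d9]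
  refine h3.trans ?_
  push_cast
  exact mul_le_of_le_one_right (by positivity) h4

/-! ### Satisfiability -/

theorem encodeLiteral_ne_zero {ℓ : ℕ} (p : Fin ℓ × Bool) : encodeLiteral p ≠ 0 := by
  unfold encodeLiteral
  split_ifs <;> omega

theorem natAbs_encodeLiteral_le {ℓ : ℕ} (p : Fin ℓ × Bool) : (encodeLiteral p).natAbs ≤ ℓ := by
  unfold encodeLiteral
  have := p.1.isLt
  split_ifs <;> omega

/-- The encoding of a list of clauses. -/
def encodeClauses {ℓ : ℕ} (l : List (List (Fin ℓ × Bool))) : List ℤ :=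
  l.flatMap fun C => C.map encodeLiteral ++ [0]

theorem count_encodeClauses {ℓ : ℕ} (l : List (List (Fin ℓ × Bool))) : (encodeClauses l).count 0 = l.length := by
  induction l with
  | nil => rfl
  | cons C l ih =>
    rw [encodeClauses] at ih ⊢
    rw [List.flatMap_cons, List.count_append, List.count_append, ih, List.count_eq_zero_of_not_mem (by
      simp only [List.mem_map, not_exists, not_and]
      exact fun p _ => encodeLiteral_ne_zero p)]
    simp [add_comm]

theorem length_encodeClauses_le {ℓ k : ℕ} (l : List (List (Fin ℓ × Bool))) (hl : ∀ C ∈ l, C.length ≤ k) :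
    (encodeClauses l).length ≤ (k + 1) * l.length := by
  induction l with
  | nil => simp [encodeClauses]
  | cons C l ih =>
    have h1 := ih fun C hC => hl C (by simp [hC])
    have h2 := hl C (by simp)
    rw [encodeClauses] at h1 ⊢
    simp only [List.flatMap_cons, List.length_append, List.length_map, List.length_cons, List.length_nil]
    rw [mul_add]
    omega

theorem mem_encodeClauses {ℓ : ℕ} {l : List (List (Fin ℓ × Bool))} {z : ℤ} (hz : z ∈ encodeClauses l) :
    z.natAbs ≤ ℓ := by
  simp only [encodeClauses, List.mem_flatMap, List.mem_append, List.mem_map, List.mem_singleton] at hz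
  obtain ⟨C, -, ⟨p, -, rfl⟩ | rfl⟩ := hz
  · exact natAbs_encodeLiteral_le p
  · simp

/-- The last entry of the encoding is a terminator, so every proper prefix misses at least one zero.
-/
theorem count_take_encodeClauses {ℓ : ℕ} (l : List (List (Fin ℓ × Bool))) (i : ℕ)
    (hi : i ≤ (encodeClauses l).length) :
    ((encodeClauses l).take i).count 0 < l.length ↔ i < (encodeClauses l).length := by
  have hc := count_encodeClauses l
  have hs : ((encodeClauses l).take i).count 0 + ((encodeClauses l).drop i).count 0 = l.length := by
    rw [← List.count_append, List.take_append_drop, hc]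
  constructor
  · intro h
    by_contra hcon
    rw [List.drop_eq_nil_of_le (by omega), List.count_nil] at hs
    omega
  · intro h
    have hmem : 0 ∈ (encodeClauses l).drop i := by
      rcases List.eq_nil_or_concat l with rfl | ⟨l', C, rfl⟩
      · simp [encodeClauses] at h
      · have e : encodeClauses (l' ++ [C]) = (encodeClauses l' ++ C.map encodeLiteral) ++ [0] := by
          simp [encodeClauses]
        rw [List.concat_eq_append, e] at h ⊢
        rw [List.length_append, List.length_singleton] at h
        rw [List.drop_append_of_le_length (by omega)]
        simp
    have := List.count_pos_iff.2 hmem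
    omega

/-- The number of clauses of a formula. -/
theorem length_clauses_le {k ℓ : ℕ} (φ : KCNF k ℓ) : φ.clauses.length ≤ (2 * ℓ + 1) ^ k := by
  classical
  -- The set of literals of a clause is the range of a function from `Fin k` to the literals, with
  -- `none` as padding; distinct clauses have distinct sets.
  let F : (Fin k → Option (Fin ℓ × Bool)) → Finset (Fin ℓ × Bool) := fun u =>
    Finset.univ.filter fun p => ∃ i, u i = some p
  have hsub : (φ.clauses.map List.toFinset).toFinset ⊆ Finset.univ.image F := by
    intro s hs
    obtain ⟨C, hC, rfl⟩ := List.mem_map.1 (List.mem_toFinset.1 hs)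
    refine Finset.mem_image.2 ⟨fun i => C[(i : ℕ)]?, Finset.mem_univ _, ?_⟩
    ext p
    simp only [F, Finset.mem_filter, Finset.mem_univ, true_and, List.mem_toFinset, List.mem_iff_getElem?]
    constructor
    · rintro ⟨i, hi⟩
      exact ⟨i, hi⟩
    · rintro ⟨i, hi⟩
      have := (List.getElem?_eq_some_iff.1 hi).1
      exact ⟨⟨i, this.trans_le (φ.width C hC)⟩, hi⟩
  have h1 := (Finset.card_le_card hsub).trans Finset.card_image_le
  rw [List.toFinset_card_of_nodup φ.distinct, List.length_map] at h1
  refine h1.trans_eq ?_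
  simp [mul_comm]

/-- There are $2^h$ blocks, so the logarithm of the input length provides the `h` oracle bits
needed. -/
theorem le_length_satOps (h : ℕ) (Z : List ℤ) : 2 ^ h ≤ ((satOps h Z).flatMap Op.code).length := by
  refine le_trans ?_ (length_le_length_code _)
  have := length_le_length_flatMap (List.range (2 ^ h)) (blockOps h Z) fun i _ => by
    simp [blockOps]; omega
  rw [List.length_range] at this
  rw [satOps, List.length_append]
  omega

theorem eventually_pow_le (k : ℕ) {η : ℝ} (hη : 0 < η) :
    ∀ᶠ n : ℕ in atTop, (n + 2 : ℝ) ^ k ≤ 2 ^ (2 * η) * (2 : ℝ) ^ (η * n) := by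
  have h1 : (1 : ℝ) < 2 ^ η := Real.one_lt_rpow one_lt_two hη
  have h2 := (isLittleO_pow_const_const_pow_of_one_lt (R := ℝ) k h1).bound one_pos
  filter_upwards [(tendsto_add_atTop_nat 2).eventually h2] with n hn
  rw [Real.norm_of_nonneg (by positivity), Real.norm_of_nonneg (by positivity), one_mul] at hn
  rw [← Real.rpow_add two_pos]
  push_cast at hn
  refine hn.trans_eq ?_
  rw [← Real.rpow_natCast, ← Real.rpow_mul two_pos.le]
  congr 1
  push_cast; ring

/-- The input has length $2^{\ell/2}$ up to polynomial factors for fixed `k`, so a running time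
below the square of the length is below $2^{\ell}$ by an exponential factor. -/
theorem kSAT_solvable {M : MultiTapeTM} {T : ℕ → ℕ} {ε C : ℝ} (hε : 0 < ε) (hε' : ε ≤ 1 / 2) (hC : 0 < C)
    (hTC : ∀ n, (T n : ℝ) ≤ C * (n + 1 : ℝ) ^ (2 - ε))
    (hT : ∀ x, M.HaltsWithin x [] (T x.length))
    (hL : ∀ x, x ∈ lang (fun n : ℕ => ⌈Real.logb 2 n⌉₊) ↔ M.Accepts x []) (k : ℕ) :
    (kSAT k).SolvableInTime fun ℓ => (2 : ℝ) ^ ((1 - ε / 8) * (ℓ : ℝ)) := by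
  set S : ℕ → ℕ := fun ℓ => (k + 1) * (2 * ℓ + 1) ^ k with hS
  have hY : ∀ a b c : ℕ, 1 ≤ c → a ≤ 300 * (a + 1) * (b + 2) * c ∧ b ≤ 300 * (a + 1) * (b + 2) * c ∧
      c ≤ 300 * (a + 1) * (b + 2) * c := fun a b c hc => by
    refine ⟨?_, ?_, Nat.le_mul_of_pos_left _ (by positivity)⟩
    all_goals
      refine le_trans ?_ (Nat.le_mul_of_pos_right _ hc)
      nlinarith [Nat.zero_le (a * b)]
  refine solvableInTime_of_generator (Y := fun ℓ => 300 * (S ℓ + 1) * (ℓ + 2) * 2 ^ ((ℓ + 1) / 2))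
    (gen := satGen M) (η := ε / 2) (by linarith) (by linarith) (by linarith) hC hTC hT hL ?_ ?_ ?_
  · rintro (⟨ℓ, φ⟩ : Σ ℓ : ℕ, KCNF k ℓ) v hv
    obtain ⟨h1, h2, -⟩ := hY (S ℓ) ℓ (2 ^ ((ℓ + 1) / 2)) Nat.one_le_two_pow
    have hv' : v ∈ [(ℓ : ℤ), (φ.clauses.length : ℤ)] ++ encodeClauses φ.clauses := hv
    simp only [List.mem_append, List.mem_cons, List.not_mem_nil, or_false] at hv'
    rw [Int.abs_eq_natAbs]
    refine Int.ofNat_le.2 ?_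
    change v.natAbs ≤ 300 * (S ℓ + 1) * (ℓ + 2) * 2 ^ ((ℓ + 1) / 2)
    rcases hv' with (rfl | rfl) | h
    · exact h2
    · rw [Int.natAbs_natCast]
      refine le_trans (length_clauses_le φ) (le_trans ?_ h1)
      exact Nat.le_mul_of_pos_left _ (Nat.succ_pos k)
    · exact (mem_encodeClauses h).trans h2
  · rintro (⟨ℓ, φ⟩ : Σ ℓ : ℕ, KCNF k ℓ) B hB
    obtain ⟨-, -, h3⟩ := hY (S ℓ) ℓ (2 ^ ((ℓ + 1) / 2)) Nat.one_le_two_pow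
    have hlen : (encodeClauses φ.clauses).length ≤ S ℓ :=
      (length_encodeClauses_le _ φ.width).trans (Nat.mul_le_mul_left _ (length_clauses_le φ))
    refine (gwp_satGen ℓ φ.clauses.length (encodeClauses φ.clauses) rfl rfl (fun i hi => ?_)
      (fun z hz => mem_encodeClauses hz) (count_take_encodeClauses _) (h3.trans hB)).mono
      fun g ⟨h1, h2⟩ => ⟨?_, h2.trans ?_⟩
    · change ([(ℓ : ℤ), (φ.clauses.length : ℤ)] ++ encodeClauses φ.clauses).getD _ _ = _
      rw [List.getD_append_right _ _ _ _ (by simp)]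
      simp
    · rw [Gen.bits, h1]
      refine satOps_mem_lang φ (by omega) ?_
      exact (Nat.pow_le_pow_iff_right one_lt_two).1
        ((le_length_satOps _ _).trans (le_two_pow_ceil_logb _))
    · change _ ≤ 300 * (S ℓ + 1) * (ℓ + 2) * 2 ^ ((ℓ + 1) / 2)
      gcongr
  -- In $1200=2\cdot 300\cdot 2$, one factor $2$ absorbs the summand $1$ and the other the rounding
  -- of $\ell/2$.
  · set D : ℝ := 1200 * (k + 2) * 2 ^ k * 2 ^ (2 * (ε / 16)) with hD
    refine .of_bound (D ^ (2 - ε / 2)) ?_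
    filter_upwards [eventually_pow_le (k + 1) (η := ε / 16) (by positivity)] with ℓ hℓ
    rw [Real.norm_of_nonneg (by positivity), Real.norm_of_nonneg (by positivity)]
    have h1 : ((2 ^ ((ℓ + 1) / 2) : ℕ) : ℝ) ≤ 2 * (2 : ℝ) ^ (1 / 2 * (ℓ : ℝ)) := by
      have : (((ℓ + 1) / 2 : ℕ) : ℝ) ≤ 1 + 1 / 2 * ℓ := by
        have h : ((2 * ((ℓ + 1) / 2) : ℕ) : ℝ) ≤ (ℓ + 1 : ℕ) := by exact_mod_cast (by omega)
        push_cast at h ⊢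
        linarith
      push_cast
      rw [← Real.rpow_natCast]
      refine (Real.rpow_le_rpow_of_exponent_le one_le_two this).trans_eq ?_
      rw [Real.rpow_add two_pos, Real.rpow_one]
    have h2 : ((S ℓ + 1 : ℕ) : ℝ) ≤ (k + 2) * 2 ^ k * (ℓ + 2 : ℝ) ^ k := by
      have h3 : (2 * ℓ + 1 : ℝ) ^ k ≤ 2 ^ k * (ℓ + 2 : ℝ) ^ k := by
        rw [← mul_pow]
        exact pow_le_pow_left₀ (by positivity) (by linarith) k
      have h4 : (1 : ℝ) ≤ (2 * ℓ + 1 : ℝ) ^ k := one_le_pow₀ (by simp)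
      simp only [hS]
      push_cast
      calc ((k + 1) * (2 * ℓ + 1) ^ k + 1 : ℝ) ≤ (k + 2) * (2 * ℓ + 1 : ℝ) ^ k := by linarith
        _ ≤ (k + 2) * (2 ^ k * (ℓ + 2 : ℝ) ^ k) := by gcongr
        _ = _ := by ring
    have h5 : ((300 * (S ℓ + 1) * (ℓ + 2) * 2 ^ ((ℓ + 1) / 2) : ℕ) + 1 : ℝ) ≤
        D * (2 : ℝ) ^ ((1 / 2 + ε / 16) * ℓ) := by
      have h6 : (1 : ℝ) ≤ (300 * (S ℓ + 1) * (ℓ + 2) * 2 ^ ((ℓ + 1) / 2) : ℕ) := by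
        exact_mod_cast Nat.succ_le_of_lt (by positivity)
      have h7 : ((300 * (S ℓ + 1) * (ℓ + 2) * 2 ^ ((ℓ + 1) / 2) : ℕ) : ℝ) =
          300 * ((S ℓ + 1 : ℕ) : ℝ) * (ℓ + 2) * ((2 ^ ((ℓ + 1) / 2) : ℕ) : ℝ) := by
        push_cast; ring
      calc ((300 * (S ℓ + 1) * (ℓ + 2) * 2 ^ ((ℓ + 1) / 2) : ℕ) + 1 : ℝ)
          ≤ 2 * (300 * ((S ℓ + 1 : ℕ) : ℝ) * (ℓ + 2) * ((2 ^ ((ℓ + 1) / 2) : ℕ) : ℝ)) := by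
            rw [← h7]; linarith
        _ ≤ 2 * (300 * ((k + 2) * 2 ^ k * (ℓ + 2 : ℝ) ^ k) * (ℓ + 2) * (2 * (2 : ℝ) ^ (1 / 2 * (ℓ : ℝ)))) := by
            gcongr
        _ = 1200 * (k + 2) * 2 ^ k * (ℓ + 2 : ℝ) ^ (k + 1) * (2 : ℝ) ^ (1 / 2 * (ℓ : ℝ)) := by ring
        _ ≤ 1200 * (k + 2) * 2 ^ k * (2 ^ (2 * (ε / 16)) * (2 : ℝ) ^ (ε / 16 * ℓ)) *
            (2 : ℝ) ^ (1 / 2 * (ℓ : ℝ)) := by gcongr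
        _ = D * (2 : ℝ) ^ ((1 / 2 + ε / 16) * ℓ) := by
            rw [add_mul, Real.rpow_add two_pos]; ring
    have h12 : (2 : ℝ) - ε + ε / 2 = 2 - ε / 2 := by ring
    rw [h12]
    refine (Real.rpow_le_rpow (by positivity) h5 (by linarith)).trans ?_
    rw [Real.mul_rpow (by positivity) (by positivity), ← Real.rpow_mul two_pos.le]
    refine mul_le_mul_of_nonneg_left (Real.rpow_le_rpow_of_exponent_le one_le_two ?_) (by positivity)
    have hℓ0 : (0 : ℝ) ≤ ℓ := Nat.cast_nonneg ℓ
    -- The left-hand side is $1-\epsilon/8-\epsilon^2/32$.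
    have : (1 / 2 + ε / 16) * (2 - ε / 2) ≤ 1 - ε / 8 := by nlinarith
    calc (1 / 2 + ε / 16) * (ℓ : ℝ) * (2 - ε / 2) = (1 / 2 + ε / 16) * (2 - ε / 2) * ℓ := by ring
      _ ≤ (1 - ε / 8) * ℓ := by gcongr

end LoopProg

/-! ### The separation -/

theorem mainTheorem5 (h : LowDimensionOVConjecture ∨ SETH) (ε : ℝ) (hε : 0 < ε) :
    ¬ (NDTIME (fun n : ℕ => ⌈Real.logb 2 (n : ℝ)⌉₊) (fun n : ℕ => (n : ℝ)) ⊆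
      DTIME (fun n : ℕ => (n : ℝ) ^ (2 - ε))) := by
  intro hincl
  obtain ⟨M, T, hTO, hT, hacc⟩ := hincl (TapeCode.lang_mem_NDTIME _)
  have hT' : ∀ x, M.HaltsWithin x [] (T x.length) := fun x => hT x [] rfl
  have hL : ∀ x, x ∈ TapeCode.lang (fun n : ℕ => ⌈Real.logb 2 n⌉₊) ↔ M.Accepts x [] := fun x => by
    rw [hacc x]
    constructor
    · rintro ⟨w, hw, hA⟩
      rwa [List.length_eq_zero_iff.1 hw] at hA
    · exact fun hA => ⟨[], rfl, hA⟩
  -- A smaller saving is also available, and with at most $1/2$ the exponent stays between $1$ and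
  -- $2$, as the simulation requires.
  have hδ : 0 < min ε (1 / 2) := lt_min hε (by norm_num)
  have hδ' : min ε (1 / 2) ≤ 1 / 2 := min_le_right _ _
  obtain ⟨C, hC, hTC⟩ := LoopProg.exists_bound_of_isBigO (s := 2 - min ε (1 / 2))
    (by linarith [min_le_left ε (1 / 2)]) (by linarith) hTO
  rcases h with h | h
  · exact h _ LoopProg.log_isLittleO_dimension (min ε (1 / 2) / 4) (by positivity)
      (LoopProg.OV_solvable hδ hδ' hC hTC hT' hL)
  · obtain ⟨k, hk⟩ := h (min ε (1 / 2) / 8) (by positivity)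
    exact hk (LoopProg.kSAT_solvable hδ hδ' hC hTC hT' hL k)
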